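/- Let $M$ be a smooth manifold, let $G,H$ be Lie groups (all finite-dimensional, $H$ Hausdorff) with Lie algebras $\mathfrak g,\mathfrak h$, and let $(\mathfrak g,\mathfrak h,dt,d\alpha)$ be a differential crossed module, i.e. $dt:\mathfrak h\to\mathfrak g$ and $d\alpha:\mathfrak g\to\mathrm{Der}(\mathfrak h)$ are Lie algebra homomorphisms with $dt(d\alpha(x)(y))=[x,dt(y)]$ and $d\alpha(dt(y))(y')=[y,y']$. For $A\in\Omega^1(M,\mathfrak g)$ and $a\in\Omega^1(M,\mathfrak h)$ put $F_A=dA+\tfrac12[A\wedge A]$, $d_Aa=da+A^b\wedge d\alpha(T_b)(a)$ ($T_b$ a basis of $\mathfrak g$) and $(a\wedge a)(u,v)=[a(u),a(v)]$. A based path from $s$ to $t$ in $M$ is a smooth map $X:[0,1]\to M$ that is constantly $s$ near $0$ and constantly $t$ near $1$; $\mathcal P_s^t(M)$ is the space of these. For $y\in\mathfrak h$ let $$W_A[X](\sigma,1)(y)=\sum_{n\ge 0}\ \int_{\sigma<\sigma_1<\dots<\sigma_n<1} d\alpha\big(-A(X'(\sigma_n))\big)\circ\cdots\circ d\alpha\big(-A(X'(\sigma_1))\big)(y)\,d\sigma_1\cdots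 d\sigma_n$$ be its parallel transport along $X$. For an $\mathfrak h$-valued $(k+1)$-form $\omega$ on $M$ let $\oint_A(\omega)$ be the $k$-form on $\mathcal P_s^t(M)$ with $$\oint_A(\omega)_X(D_1,\dots,D_k)=\int_0^1 W_A[X](\sigma,1)\big(\omega(X'(\sigma),D_1(\sigma),\dots,D_k(\sigma))\big)\,d\sigma .$$ For $B\in\Omega^2(M,\mathfrak h)$ the standard connection 1-form is $\mathcal A_{(A,B)}=\oint_A(B)$. Its holonomy along a smooth curve $\Sigma:[0,1]\ni\tau\mapsto\Sigma_\tau\in\mathcal P_s^t(M)$ (smooth means that $(\tau,\sigma)\mapsto\Sigma_\tau(\sigma)$ is smooth on $[0,1]^2$) is $\mathcal W_{\mathcal A_{(A,B)}}(\Sigma)=w(1)\in H$, where $w:[0,1]\to H$ solves $w(0)=1$, $w'(\tau)=w(\tau)\cdot\mathcal A_{(A,B)}(\partial_\tau\Sigma)$. The finite path space holonomy gauge transformation with parameter $a\in\Omega^1(M,\mathfrak h)$ sends $h\in H$, over a curve with end paths $X_0=\Sigma_0$, $X_1=\Sigma_1$, to $$\lim_{N\to\infty}\ \prod_{j=N-1}^{0}\Big(1-\tfrac1N\oint_{A+\frac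 jN dt(a)}(a)\Big)_{X_0}\cdot h\cdot\prod_{j=0}^{N-1}\Big(1+\tfrac1N\oint_{A+\frac jN dt(a)}(a)\Big)_{X_1},$$ the factors being written from left to right in the indicated order of $j$. Here $1+x$ stands for $\kappa(x)$, where $\kappa:\mathfrak h\to H$ is any fixed map with $\kappa(0)=1$ that is differentiable at $0$ with derivative $\mathrm{id}_{\mathfrak h}$ (for instance the exponential map). **Proposition.** Let $A\in\Omega^1(M,\mathfrak g)$, $B\in\Omega^2(M,\mathfrak h)$, $a\in\Omega^1(M,\mathfrak h)$ be smooth forms, with vanishing fake curvature $F_A+dt(B)=0$, and put $$A'=A+dt(a),\qquad B'=B-(d_Aa+a\wedge a).$$ Then for all $s,t\in M$ and every smooth curve $\Sigma$ in $\mathcal P_s^t(M)$ the holonomies $\mathcal W_{\mathcal A_{(A,B)}}(\Sigma)$ and $\mathcal W_{\mathcal A_{(A',B')}}(\Sigma)$ exist and are unique. There are $U_0,U_1\in H$, not depending on $\kappa$, such that for $i=0,1$ and every $\kappa$ the products of the factors $1+\tfrac1N\oint(a)$ at the path $X_i$, ordered as above, converge to $U_i$, and those of the factors $1-\tfrac1N\oint(a)$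 at $X_i$ converge to $U_i^{-1}$. For every $\kappa$ the finite gauge transformation with parameter $a$ sends $\mathcal W_{\mathcal A_{(A,B)}}(\Sigma)$ to $$U_0^{-1}\,\mathcal W_{\mathcal A_{(A,B)}}(\Sigma)\,U_1=\mathcal W_{\mathcal A_{(A',B')}}(\Sigma).$$ -/

import Mathlib

open Set Filter Topology
open scoped Manifold ContDiff

noncomputable section

/-! ### The Lie algebra of a finite-dimensional Lie group as a normed space -/

section LieGroupInstances

variable {n : ℕ} {G : Type*} [TopologicalSpace G] [ChartedSpace (EuclideanSpace ℝ (Fin n)) G]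
  [Group G]

instance instLieGroupMinSmoothnessThree [LieGroup (𝓡 n) ∞ G] :
    LieGroup (𝓡 n) (minSmoothness ℝ 3) G := by
  rw [minSmoothness_of_isRCLikeNormedField]; infer_instance

/-- `T_1 G` is the model space `ℝⁿ` (through the preferred chart at `1`); we use its norm. -/
instance instNormedAddCommGroupGroupLieAlgebra : NormedAddCommGroup (GroupLieAlgebra (𝓡 n) G) :=
  inferInstanceAs (NormedAddCommGroup (EuclideanSpace ℝ (Fin n)))

instance instNormedSpaceGroupLieAlgebra : NormedSpace ℝ (GroupLieAlgebra (𝓡 n) G) :=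
  inferInstanceAs (NormedSpace ℝ (EuclideanSpace ℝ (Fin n)))

instance instFiniteDimensionalGroupLieAlgebra :
    FiniteDimensional ℝ (GroupLieAlgebra (𝓡 n) G) :=
  inferInstanceAs (FiniteDimensional ℝ (EuclideanSpace ℝ (Fin n)))

end LieGroupInstances

/-! ### Differential crossed modules -/

/-- A differential crossed module `(𝔤, 𝔥, dt, dα)`: a Lie algebra homomorphism `dt : 𝔥 → 𝔤` and
an action `dα` of `𝔤` on `𝔥` by derivations, with `dt (dα x y) = [x, dt y]` and
`dα (dt y) y' = [y, y']`. -/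
structure DifferentialCrossedModule (𝔤 𝔥 : Type*) [LieRing 𝔤] [LieAlgebra ℝ 𝔤]
    [LieRing 𝔥] [LieAlgebra ℝ 𝔥] where
  dt : 𝔥 →ₗ⁅ℝ⁆ 𝔤
  dα : 𝔤 →ₗ⁅ℝ⁆ LieDerivation ℝ 𝔥 𝔥
  dt_dα : ∀ (x : 𝔤) (y : 𝔥), dt (dα x y) = ⁅x, dt y⁆
  dα_dt : ∀ y y' : 𝔥, dα (dt y) y' = ⁅y, y'⁆

/-- The action `(x, y) ↦ dα x y` as a bilinear map. -/
def DifferentialCrossedModule.action {𝔤 𝔥 : Type*} [LieRing 𝔤] [LieAlgebra ℝ 𝔤]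
    [LieRing 𝔥] [LieAlgebra ℝ 𝔥] (𝒞 : DifferentialCrossedModule 𝔤 𝔥) : 𝔤 →ₗ[ℝ] 𝔥 →ₗ[ℝ] 𝔥 :=
  LinearMap.mk₂ ℝ (fun x y => 𝒞.dα x y) (by simp) (by simp) (by simp) (by simp)

/-- The Lie bracket as a bilinear map. -/
def bracketBilin (L : Type*) [LieRing L] [LieAlgebra ℝ L] : L →ₗ[ℝ] L →ₗ[ℝ] L :=
  LinearMap.mk₂ ℝ (fun x y => ⁅x, y⁆) (by simp) (by simp) (by simp) (by simp)

/-! ### Vector-valued differential forms on a manifold -/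

section Forms

variable {m : ℕ} {M : Type*} [TopologicalSpace M] [ChartedSpace (EuclideanSpace ℝ (Fin m)) M]
  {k : ℕ}
  {V : Type*} [NormedAddCommGroup V] [NormedSpace ℝ V]
  {W : Type*} [NormedAddCommGroup W] [NormedSpace ℝ W]
  {Z : Type*} [NormedAddCommGroup Z] [NormedSpace ℝ Z]

/-- `V`-valued differential `k`-forms on `M`; smoothness is the predicate `SmoothForm`. -/
abbrev MForm (m : ℕ) (M : Type*) [TopologicalSpace M]
    [ChartedSpace (EuclideanSpace ℝ (Fin m)) M] (k : ℕ) (V : Type*) [NormedAddCommGroup V]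
    [NormedSpace ℝ V] : Type _ :=
  ∀ x : M, TangentSpace (𝓡 m) x [⋀^Fin k]→L[ℝ] V

/-- The expression of `η` in the chart at `p`: the pullback of `η` along the inverse chart. -/
def MForm.inChart (η : MForm m M k V) (p : M) (y : EuclideanSpace ℝ (Fin m)) :
    EuclideanSpace ℝ (Fin m) [⋀^Fin k]→L[ℝ] V :=
  (η ((extChartAt (𝓡 m) p).symm y)).compContinuousLinearMap
    (mfderiv (𝓡 m) (𝓡 m) (extChartAt (𝓡 m) p).symm y)

/-- A form is smooth if its expressions in all charts are. -/
def SmoothForm (η : MForm m M k V) : Prop :=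
  ∀ p : M, ContDiffOn ℝ ∞ (η.inChart p) (extChartAt (𝓡 m) p).target

/-- The exterior derivative, computed in the chart at the point. -/
def MForm.extd (η : MForm m M k V) : MForm m M (k + 1) V := fun p =>
  (extDeriv (η.inChart p) (extChartAt (𝓡 m) p p)).compContinuousLinearMap
    (mfderiv (𝓡 m) (𝓡 m) (extChartAt (𝓡 m) p) p)

/-- Application of a linear map to the values of a form. -/
def MForm.mapValues [FiniteDimensional ℝ V] (L : V →ₗ[ℝ] W) (η : MForm m M k V) :
    MForm m M k W := fun x =>
  (LinearMap.toContinuousLinearMap L).compContinuousAlternatingMap (η x)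

/-- A `1`-form at a point, as a linear map on the tangent space. -/
def MForm.linearAt (a : MForm m M 1 V) (x : M) : TangentSpace (𝓡 m) x →L[ℝ] V :=
  (ContinuousAlternatingMap.ofSubsingleton ℝ (TangentSpace (𝓡 m) x) V (0 : Fin 1)).symm (a x)

/-- The wedge product of two `1`-forms with respect to a bilinear pairing `β` of their values:
`(a ∧ b)(u, v) = β (a u) (b v) - β (a v) (b u)`. -/
def MForm.wedge [FiniteDimensional ℝ V] [FiniteDimensional ℝ W] (β : V →ₗ[ℝ] W →ₗ[ℝ] Z)
    (a : MForm m M 1 V) (b : MForm m M 1 W) : MForm m M 2 Z := fun x =>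
  { toFun := fun v => β (a.linearAt x (v 0)) (b.linearAt x (v 1))
      - β (a.linearAt x (v 1)) (b.linearAt x (v 0))
    map_update_add' := by
      intro _ v i u w
      fin_cases i <;> simp <;> abel
    map_update_smul' := by
      intro _ v i c u
      fin_cases i <;> simp [smul_sub]
    cont := by
      have hβ : Continuous fun z : V × W => β z.1 z.2 :=
        ((LinearMap.toContinuousLinearMap
          ((LinearMap.toContinuousLinearMap : (W →ₗ[ℝ] Z) ≃ₗ[ℝ] (W →L[ℝ] Z)).toLinearMap ∘ₗ β))
          ).isBoundedBilinearMap.continuous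
      have h0 : Continuous fun v : Fin 2 → TangentSpace (𝓡 m) x => v 0 := continuous_apply 0
      have h1 : Continuous fun v : Fin 2 → TangentSpace (𝓡 m) x => v 1 := continuous_apply 1
      exact (hβ.comp (((a.linearAt x).continuous.comp h0).prodMk
        ((b.linearAt x).continuous.comp h1))).sub
        (hβ.comp (((a.linearAt x).continuous.comp h1).prodMk
        ((b.linearAt x).continuous.comp h0)))
    map_eq_zero_of_eq' := by
      intro v i j hij hne
      fin_cases i <;> fin_cases j <;> simp_all }

end Forms

/-! ### Covariant derivative, curvature and fake curvature -/

section Gauge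

variable {m : ℕ} {M : Type*} [TopologicalSpace M] [ChartedSpace (EuclideanSpace ℝ (Fin m)) M]
  {p : ℕ} {G : Type*} [TopologicalSpace G] [ChartedSpace (EuclideanSpace ℝ (Fin p)) G]
  [Group G] [LieGroup (𝓡 p) ∞ G]
  {q : ℕ} {H : Type*} [TopologicalSpace H] [ChartedSpace (EuclideanSpace ℝ (Fin q)) H]
  [Group H] [LieGroup (𝓡 q) ∞ H]
  (𝒞 : DifferentialCrossedModule (GroupLieAlgebra (𝓡 p) G) (GroupLieAlgebra (𝓡 q) H))

/-- The curvature `F_A = dA + ½ [A ∧ A]`. -/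
def curvature (A : MForm m M 1 (GroupLieAlgebra (𝓡 p) G)) :
    MForm m M 2 (GroupLieAlgebra (𝓡 p) G) :=
  A.extd + (1 / 2 : ℝ) • MForm.wedge (bracketBilin (GroupLieAlgebra (𝓡 p) G)) A A

/-- The covariant exterior derivative `d_A a = da + Aᵇ ∧ dα(T_b)(a)` of an `𝔥`-valued `1`-form. -/
def covExtd (A : MForm m M 1 (GroupLieAlgebra (𝓡 p) G))
    (a : MForm m M 1 (GroupLieAlgebra (𝓡 q) H)) : MForm m M 2 (GroupLieAlgebra (𝓡 q) H) :=
  a.extd + MForm.wedge 𝒞.action A a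

/-- The square `a ∧ a` of a Lie algebra valued `1`-form: `(a ∧ a)(u, v) = [a u, a v]`. -/
def wedgeSelf (a : MForm m M 1 (GroupLieAlgebra (𝓡 q) H)) :
    MForm m M 2 (GroupLieAlgebra (𝓡 q) H) :=
  (1 / 2 : ℝ) • MForm.wedge (bracketBilin (GroupLieAlgebra (𝓡 q) H)) a a

/-- `dt` applied to the values of an `𝔥`-valued form. -/
def dtForm {k : ℕ} (η : MForm m M k (GroupLieAlgebra (𝓡 q) H)) :
    MForm m M k (GroupLieAlgebra (𝓡 p) G) :=
  η.mapValues (𝒞.dt : GroupLieAlgebra (𝓡 q) H →ₗ[ℝ] GroupLieAlgebra (𝓡 p) G)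

/-- The fake curvature `F_A + dt(B)`. -/
def fakeCurvature (A : MForm m M 1 (GroupLieAlgebra (𝓡 p) G))
    (B : MForm m M 2 (GroupLieAlgebra (𝓡 q) H)) : MForm m M 2 (GroupLieAlgebra (𝓡 p) G) :=
  curvature A + dtForm 𝒞 B

/-! ### Based paths and curves in path space -/

/-- Based parametrized paths with sitting instants: smooth maps `X : [0,1] → M` that are equal to
`s` near `0` and to `t` near `1`. Only the restriction of `X` to `[0,1]` matters. -/
structure IsBasedPath (m : ℕ) {M : Type*} [TopologicalSpace M]
    [ChartedSpace (EuclideanSpace ℝ (Fin m)) M] (s t : M) (X : ℝ → M) : Prop where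
  smooth : ContMDiffOn 𝓘(ℝ, ℝ) (𝓡 m) ∞ X (Icc 0 1)
  source : ∀ᶠ σ in 𝓝[Icc 0 1] (0 : ℝ), X σ = s
  target : ∀ᶠ σ in 𝓝[Icc 0 1] (1 : ℝ), X σ = t

/-- Smooth curves `τ ↦ S τ`, `τ ∈ [0,1]`, in the space of based paths from `s` to `t`. -/
structure IsPathSpaceCurve (m : ℕ) {M : Type*} [TopologicalSpace M]
    [ChartedSpace (EuclideanSpace ℝ (Fin m)) M] (s t : M) (S : ℝ → ℝ → M) : Prop where
  smooth : ContMDiffOn 𝓘(ℝ, ℝ × ℝ) (𝓡 m) ∞ (fun z : ℝ × ℝ => S z.1 z.2) (Icc 0 1 ×ˢ Icc 0 1)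
  based : ∀ τ ∈ Icc (0 : ℝ) 1, IsBasedPath m s t (S τ)

/-- The velocity of a curve on `[0,1]` (one-sided at the end points). -/
def velocity (m : ℕ) {M : Type*} [TopologicalSpace M]
    [ChartedSpace (EuclideanSpace ℝ (Fin m)) M] (X : ℝ → M) (σ : ℝ) : TangentSpace (𝓡 m) (X σ) :=
  mfderivWithin 𝓘(ℝ, ℝ) (𝓡 m) X (Icc 0 1) σ (1 : ℝ)

/-- The tangent vector `∂S/∂τ` at the path `S τ` of a curve in path space: a vector field along
the path `S τ`. -/
def pathSpaceVelocity (m : ℕ) {M : Type*} [TopologicalSpace M]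
    [ChartedSpace (EuclideanSpace ℝ (Fin m)) M] (S : ℝ → ℝ → M) (τ σ : ℝ) :
    TangentSpace (𝓡 m) (S τ σ) :=
  velocity m (fun τ' => S τ' σ) τ

/-! ### Parallel transport and Chen forms -/

/-- The `n`-th iterated integral in the parallel transport of `y ∈ 𝔥` along `X` from `σ` to `τ`:
`∫_{σ < σ₁ < ⋯ < σₙ < τ} dα(-A(X'(σₙ))) ∘ ⋯ ∘ dα(-A(X'(σ₁))) (y) dσ₁ ⋯ dσₙ`. -/
def transportTerm (A : MForm m M 1 (GroupLieAlgebra (𝓡 p) G)) (X : ℝ → M) (σ : ℝ)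
    (y : GroupLieAlgebra (𝓡 q) H) : ℕ → ℝ → GroupLieAlgebra (𝓡 q) H
  | 0, _ => y
  | n + 1, τ => ∫ ρ in σ..τ, 𝒞.dα (-(A.linearAt (X ρ) (velocity m X ρ))) (transportTerm A X σ y n ρ)

/-- The parallel transport `W_A[X](σ, 1)(y)` of `y ∈ 𝔥` along `X` from parameter `σ` to `1`, as
the sum of the series of iterated integrals. -/
def transport (A : MForm m M 1 (GroupLieAlgebra (𝓡 p) G)) (X : ℝ → M) (σ : ℝ)
    (y : GroupLieAlgebra (𝓡 q) H) : GroupLieAlgebra (𝓡 q) H :=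
  ∑' n, transportTerm 𝒞 A X σ y n 1

/-- The Chen form `∮_A (η)` with parallel transport, of a single `(k+1)`-form `η`: the `k`-form on
path space whose value at the path `X` on vector fields `D₁, …, D_k` along `X` is
`∫₀¹ W_A[X](σ, 1) (η(X'(σ), D₁(σ), …, D_k(σ))) dσ`. -/
def chenForm {k : ℕ} (A : MForm m M 1 (GroupLieAlgebra (𝓡 p) G))
    (η : MForm m M (k + 1) (GroupLieAlgebra (𝓡 q) H)) (X : ℝ → M)
    (D : Fin k → ∀ σ : ℝ, TangentSpace (𝓡 m) (X σ)) : GroupLieAlgebra (𝓡 q) H :=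
  ∫ σ in (0 : ℝ)..1, transport 𝒞 A X σ
    (η (X σ) (Fin.cons (velocity m X σ) fun i => D i σ))

/-- The path space `0`-form `∮_A (a)`, for a `1`-form `a`, at the path `X`. -/
def chenFunction (A : MForm m M 1 (GroupLieAlgebra (𝓡 p) G))
    (a : MForm m M 1 (GroupLieAlgebra (𝓡 q) H)) (X : ℝ → M) : GroupLieAlgebra (𝓡 q) H :=
  chenForm 𝒞 A a X fun i => i.elim0

/-- The standard connection `1`-form `𝒜_{(A,B)} = ∮_A (B)` on path space, at the path `X`, on the
vector field `D` along `X`. -/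
def standardConnection (A : MForm m M 1 (GroupLieAlgebra (𝓡 p) G))
    (B : MForm m M 2 (GroupLieAlgebra (𝓡 q) H)) (X : ℝ → M)
    (D : ∀ σ : ℝ, TangentSpace (𝓡 m) (X σ)) : GroupLieAlgebra (𝓡 q) H :=
  chenForm 𝒞 A B X fun _ => D

/-! ### Path space holonomy -/

/-- `h` is the path ordered exponential `P exp ∫₀¹ x(τ) dτ` of `x : [0,1] → 𝔥`, with higher
parameter values to the right: `h = w 1` for a solution of `w' = w · x`, `w 0 = 1`, in `H`. -/
def IsPathOrderedExp (x : ℝ → GroupLieAlgebra (𝓡 q) H) (h : H) : Prop :=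
  ∃ w : ℝ → H, w 0 = 1 ∧ w 1 = h ∧ ∀ τ ∈ Icc (0 : ℝ) 1,
    HasMFDerivWithinAt 𝓘(ℝ, ℝ) (𝓡 q) w (Icc 0 1) τ
      ((1 : ℝ →L[ℝ] ℝ).smulRight (mulInvariantVectorField (x τ) (w τ)))

/-- `h` is the path space line holonomy `P exp ∫_S 𝒜_{(A,B)}` of the standard connection `1`-form
along the curve `S` in path space. -/
def IsPathSpaceHolonomy (A : MForm m M 1 (GroupLieAlgebra (𝓡 p) G))
    (B : MForm m M 2 (GroupLieAlgebra (𝓡 q) H)) (S : ℝ → ℝ → M) (h : H) : Prop :=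
  IsPathOrderedExp (fun τ => standardConnection 𝒞 A B (S τ) (pathSpaceVelocity m S τ)) h

/-! ### Finite path space gauge transformations -/

/-- A reading of the group elements `1 + x` for infinitesimal `x ∈ 𝔥`: a map `κ : 𝔥 → H` with
`κ 0 = 1` whose derivative at `0` is the identity of `𝔥 = T_1 H`. Examples are the exponential map
and, for an open subgroup `H` of the units of an algebra, `x ↦ 1 + x` near `0`. -/
structure IsInfinitesimalStep (κ : GroupLieAlgebra (𝓡 q) H → H) : Prop where
  map_zero : κ 0 = 1
  hasMFDerivAt : HasMFDerivAt 𝓘(ℝ, GroupLieAlgebra (𝓡 q) H) (𝓡 q) κ 0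
    (ContinuousLinearMap.id ℝ (GroupLieAlgebra (𝓡 q) H))

/-- Such maps exist: translate an inverse chart at `1`. -/
theorem exists_isInfinitesimalStep (q : ℕ) (H : Type*) [TopologicalSpace H]
    [ChartedSpace (EuclideanSpace ℝ (Fin q)) H] [Group H] [LieGroup (𝓡 q) ∞ H] :
    ∃ κ : GroupLieAlgebra (𝓡 q) H → H, IsInfinitesimalStep κ := by
  let e := extChartAt (𝓡 q) (1:H)
  let κ : GroupLieAlgebra (𝓡 q) H → H := fun y => e.symm (e 1 + (show EuclideanSpace ℝ (Fin q) from y))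
  have h0 : κ 0 = 1 := by
    show e.symm (e 1 + 0) = 1
    rw [add_zero]; exact extChartAt_to_inv (I := 𝓡 q) (1:H)
  refine ⟨κ, h0, ?_, ?_⟩
  · have h1 : ContinuousAt e.symm (e 1 + 0) := by
      rw [add_zero]; exact continuousAt_extChartAt_symm (I := 𝓡 q) (1:H)
    have h2 : ContinuousAt (fun y : EuclideanSpace ℝ (Fin q) => e 1 + y) 0 := by fun_prop
    exact ContinuousAt.comp (f := fun y : EuclideanSpace ℝ (Fin q) => e 1 + y) (x := 0) h1 h2
  · have key : HasFDerivAt (fun y : EuclideanSpace ℝ (Fin q) => e 1 + y) (ContinuousLinearMap.id ℝ _) 0 :=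
      (hasFDerivAt_id _).const_add _
    have hev : ∀ᶠ y : EuclideanSpace ℝ (Fin q) in 𝓝 0, e (e.symm (e 1 + y)) = e 1 + y := by
      have : ∀ᶠ z in 𝓝 (e 1 + 0), z ∈ e.target := by
        rw [add_zero]; exact extChartAt_target_mem_nhds (I := 𝓡 q) (1:H)
      have h2 : ContinuousAt (fun y : EuclideanSpace ℝ (Fin q) => e 1 + y) 0 := by fun_prop
      filter_upwards [h2.eventually this] with y hy using e.right_inv hy
    have := key.congr_of_eventuallyEq hev
    have := this.hasFDerivWithinAt (s := Set.univ)
    simp only [writtenInExtChartAt]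
    rw [h0, ModelWithCorners.range_eq_univ]
    exact this

/-- `(1 + ε ∮_A (a)) (1 + ε ∮_{A + ε dt(a)} (a)) ⋯ (1 + ε ∮_{A + (N-1) ε dt(a)} (a))` at the path
`X`, with `ε = 1/N`. -/
def rightGaugeProduct (κ : GroupLieAlgebra (𝓡 q) H → H)
    (A : MForm m M 1 (GroupLieAlgebra (𝓡 p) G)) (a : MForm m M 1 (GroupLieAlgebra (𝓡 q) H))
    (X : ℝ → M) (N : ℕ) : H :=
  ((List.range N).map fun j =>
    κ ((1 / N : ℝ) • chenFunction 𝒞 (A + (j / N : ℝ) • dtForm 𝒞 a) a X)).prod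

/-- `(1 - ε ∮_{A + (N-1) ε dt(a)} (a)) ⋯ (1 - ε ∮_{A + ε dt(a)} (a)) (1 - ε ∮_A (a))` at the path
`X`, with `ε = 1/N`. -/
def leftGaugeProduct (κ : GroupLieAlgebra (𝓡 q) H → H)
    (A : MForm m M 1 (GroupLieAlgebra (𝓡 p) G)) (a : MForm m M 1 (GroupLieAlgebra (𝓡 q) H))
    (X : ℝ → M) (N : ℕ) : H :=
  ((List.range N).map fun j =>
    κ (-((1 / N : ℝ) • chenFunction 𝒞 (A + (j / N : ℝ) • dtForm 𝒞 a) a X))).reverse.prod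

/-- `U` is the limit `U(A, a)` at the path `X` of the right products, and `U⁻¹` that of the left
products. -/
def IsGaugeFactor (A : MForm m M 1 (GroupLieAlgebra (𝓡 p) G))
    (a : MForm m M 1 (GroupLieAlgebra (𝓡 q) H)) (X : ℝ → M) (U : H) : Prop :=
  ∀ κ : GroupLieAlgebra (𝓡 q) H → H, IsInfinitesimalStep κ →
    Tendsto (rightGaugeProduct 𝒞 κ A a X) atTop (𝓝 U) ∧
    Tendsto (leftGaugeProduct 𝒞 κ A a X) atTop (𝓝 U⁻¹)

/-- The finite path space holonomy gauge transformation with parameter `a`, over a curve in path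
space with end paths `X₀` and `X₁`, maps `h` to `h'`. -/
def IsFiniteGaugeTransform (A : MForm m M 1 (GroupLieAlgebra (𝓡 p) G))
    (a : MForm m M 1 (GroupLieAlgebra (𝓡 q) H)) (X₀ X₁ : ℝ → M) (h h' : H) : Prop :=
  ∀ κ : GroupLieAlgebra (𝓡 q) H → H, IsInfinitesimalStep κ →
    Tendsto (fun N => leftGaugeProduct 𝒞 κ A a X₀ N * h * rightGaugeProduct 𝒞 κ A a X₁ N)
      atTop (𝓝 h')

end Gauge

end

/-! Deform the pair `(A, B)` along `A + ε dt(a)`, `B - ε d_A a - ε² a ∧ a` for `ε ∈ [0,1]`. Over the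
square with coordinates `(τ, ε)` this yields an `𝔥`-valued connection with `τ`-component `𝒜(τ, ε) =
∮_{A + ε dt(a)}(B - ε d_A a - ε² a ∧ a)` on `∂_τ Σ` and `ε`-component `c(τ, ε) = ∮_{A + ε dt(a)}(a)`
at `Σ_τ`. The point is that it is flat: `∂_ε 𝒜 - ∂_τ c + [c, 𝒜] = 0`. Its transport along two sides
of the square then agrees with that along the other two: with `U_τ` the path ordered exponential of
`c(τ, ·)` over `0 ≤ ε ≤ 1`, `W_{(A,B)} U_1 = U_0 W_{(A',B')}`. The gauge products are the Riemann
products of `c(i, ·)`, so they converge to `U_i`.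

Flatness (`SquareData.hasDerivWithinAt_connection`) is a computation on the `(τ, σ)`-square, to
which all forms are pulled back. The transport `W` solves `∂_σ W = W ∘ k` with `W = id` at `σ = 1`,
where `k` acts by derivations, so `W` preserves the bracket. Hence `∂_ε W` is `-ad(∫_σ^1 W a) ∘ W`.
Vanishing fake curvature gives `∂_τ W = W ∘ kt - ad(∫_σ^1 W b) ∘ W`. With these two formulas the
integrand of `∂_ε 𝒜 - ∂_τ c` is the `σ`-derivative of `[∫_σ^1 W a, ∫_σ^1 W b] - W(a_τ)`. The term
`a_τ` vanishes at both ends because the end points of the paths are fixed, and what remains is `-[c,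
𝒜]`.

The Lie group side works in the chart at `1` through the single local map `Ψ(x, z, y) = x⁻¹ z y`. A
quotient `f⁻¹ g` of two curves satisfies an equation with left and right invariant fields, and the
difference of these fields is the bracket to first order. Grönwall estimates for such quotients give
convergence of products (`IsChartStep.tendsto_prod`), hence uniqueness, and the passage from
flatness to holonomies (`HasLogDerivWithinAt.mul_of_zeroCurvature`). Existence comes from
Picard-Lindelöf near `1` and left translation. -/

noncomputable section

/-! ### Grönwall estimates -/

section Gronwall

variable {E : Type*} [NormedAddCommGroup E] [NormedSpace ℝ E]

/-- A cruder bound without division by `K`, so that `K = 0` needs no separate treatment later. It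
rests on `exp u - 1 ≤ u exp u`, which is `1 - u ≤ exp (-u)` multiplied by `exp u`. -/
theorem gronwallBound_le {δ K η x : ℝ} (hK : 0 ≤ K) (hη : 0 ≤ η) :
    gronwallBound δ K η x ≤ (δ + η * x) * Real.exp (K * x) ∨ x < 0 := by
  rcases lt_or_ge x 0 with hx | hx
  · exact Or.inr hx
  left
  rcases hK.eq_or_lt with rfl | hK
  · simp [gronwallBound_K0]
  · rw [gronwallBound_of_K_ne_0 hK.ne']
    have h1 : Real.exp (K * x) - 1 ≤ K * x * Real.exp (K * x) := by
      have h2 := Real.add_one_le_exp (-(K * x))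
      have h3 := Real.exp_pos (K * x)
      have h4 : Real.exp (-(K * x)) * Real.exp (K * x) = 1 := by
        rw [← Real.exp_add]; simp
      nlinarith
    have h5 : η / K * (Real.exp (K * x) - 1) ≤ η / K * (K * x * Real.exp (K * x)) :=
      mul_le_mul_of_nonneg_left h1 (by positivity)
    have h6 : η / K * (K * x * Real.exp (K * x)) = η * x * Real.exp (K * x) := by
      field_simp
    simp only
    linarith

/-- Grönwall's inequality on an interval, in exponential form. -/
theorem norm_le_exp_of_norm_deriv_le {f f' : ℝ → E} {δ K η a b : ℝ} (hK : 0 ≤ K) (hη : 0 ≤ η)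
    (hf : ∀ x ∈ Icc a b, HasDerivWithinAt f (f' x) (Icc a b) x) (ha : ‖f a‖ ≤ δ)
    (bound : ∀ x ∈ Ico a b, ‖f' x‖ ≤ K * ‖f x‖ + η) :
    ∀ x ∈ Icc a b, ‖f x‖ ≤ (δ + η * (x - a)) * Real.exp (K * (x - a)) := by
  intro x hx
  have h := norm_le_gronwallBound_of_norm_deriv_right_le (f := f) (f' := f') (δ := δ) (K := K)
    (ε := η) (a := a) (b := b) (fun y hy => (hf y hy).continuousWithinAt)
    (fun y hy => (hf y (Ico_subset_Icc_self hy)).mono_of_mem_nhdsWithin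
      (Icc_mem_nhdsGE_of_mem hy)) ha bound x hx
  rcases gronwallBound_le (δ := δ) (x := x - a) hK hη with h' | h'
  · exact h.trans h'
  · exact absurd h' (by simpa using hx.1)

/-- Grönwall's inequality on `[0,1]`, from the right end point. -/
theorem norm_le_exp_of_norm_deriv_le_left {f f' : ℝ → E} {K η : ℝ} (hK : 0 ≤ K) (hη : 0 ≤ η)
    (hf : ∀ x ∈ Icc (0 : ℝ) 1, HasDerivWithinAt f (f' x) (Icc 0 1) x) (h1 : f 1 = 0)
    (bound : ∀ x ∈ Icc (0 : ℝ) 1, ‖f' x‖ ≤ K * ‖f x‖ + η) :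
    ∀ x ∈ Icc (0 : ℝ) 1, ‖f x‖ ≤ η * Real.exp K := by
  intro x hx
  have hm : ∀ y ∈ Icc (0 : ℝ) 1, 1 - y ∈ Icc (0 : ℝ) 1 := fun y hy =>
    ⟨by linarith [hy.2], by linarith [hy.1]⟩
  -- The reflection `y ↦ 1 - y` turns the final condition into an initial one.
  have key := norm_le_exp_of_norm_deriv_le (f := fun y => f (1 - y)) (f' := fun y => -f' (1 - y))
    (δ := 0) (K := K) (η := η) (a := 0) (b := 1) hK hη
    (fun y hy => by
      have h2 : HasDerivWithinAt (fun y : ℝ => 1 - y) (-1) (Icc 0 1) y := by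
        simpa using ((hasDerivAt_id y).const_sub 1).hasDerivWithinAt
      have h3 := (hf _ (hm y hy)).scomp y h2 (fun z hz => hm z hz)
      rw [neg_one_smul] at h3
      exact h3)
    (by simp [h1])
    (fun y hy => by simpa using bound _ (hm y (Ico_subset_Icc_self hy))) (1 - x) (hm x hx)
  have h3 : (0 + η * (1 - x - 0)) * Real.exp (K * (1 - x - 0)) ≤ η * Real.exp K := by
    have hx' := hm x hx
    apply mul_le_mul _ _ (Real.exp_pos _).le hη
    · nlinarith [hx'.1, hx'.2]
    · apply Real.exp_le_exp.2; nlinarith [hx'.1, hx'.2]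
  simpa using key.trans h3

end Gronwall

/-! ### Linear differential equations and their Dyson series -/

section Dyson

variable {E : Type*} [NormedAddCommGroup E] [NormedSpace ℝ E]
  {P : Type*}

/-- The `n`-th iterated integral of the linear differential equation `u' = K u`, `u σ₀ = y`, with
parameter `p`. -/
def dysonTerm (K : P → ℝ → E →L[ℝ] E) (σ₀ : ℝ) (y : E) : ℕ → P → ℝ → E
  | 0, _, _ => y
  | n + 1, p, σ => ∫ ρ in σ₀..σ, K p ρ (dysonTerm K σ₀ y n p ρ)

/-- The solution of the linear differential equation `u' = K u`, `u σ₀ = y`, with parameter `p`. -/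
def dysonSum (K : P → ℝ → E →L[ℝ] E) (σ₀ : ℝ) (y : E) (p : P) (σ : ℝ) : E :=
  ∑' n, dysonTerm K σ₀ y n p σ

variable {K : P → ℝ → E →L[ℝ] E} {σ₀ : ℝ} {y : E}

/-- Each integration raises the power of `|ρ - σ₀|` by one and contributes `1 / (n + 1)`; together
these produce the volume of the simplex. The interval is unoriented since the equation is also
solved backwards from `σ₀`. -/
theorem norm_dysonTerm_le {p : P} {C σ : ℝ} (hK : ∀ ρ ∈ uIcc σ₀ σ, ‖K p ρ‖ ≤ C)
    (n : ℕ) : ‖dysonTerm K σ₀ y n p σ‖ ≤ ‖y‖ * ((C * |σ - σ₀|) ^ n / n.factorial) := by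
  induction n generalizing σ with
  | zero => simp [dysonTerm]
  | succ n ih =>
    have hC : 0 ≤ C := (norm_nonneg _).trans (hK σ₀ left_mem_uIcc)
    have h1 : ∀ ρ ∈ uIoc σ₀ σ, ‖K p ρ (dysonTerm K σ₀ y n p ρ)‖ ≤
        ‖y‖ * C ^ (n + 1) / n.factorial * |ρ - σ₀| ^ n := by
      intro ρ hρ
      have hρ' := uIoc_subset_uIcc hρ
      have h2 := ih (σ := ρ) fun r hr => hK r (uIcc_subset_uIcc_left hρ' hr)
      calc _ ≤ ‖K p ρ‖ * ‖dysonTerm K σ₀ y n p ρ‖ := (K p ρ).le_opNorm _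
        _ ≤ C * (‖y‖ * ((C * |ρ - σ₀|) ^ n / n.factorial)) :=
          mul_le_mul (hK ρ hρ') h2 (norm_nonneg _) hC
        _ = _ := by rw [mul_pow]; ring
    have hint : IntervalIntegrable (fun ρ => ‖y‖ * C ^ (n + 1) / n.factorial * |ρ - σ₀| ^ n)
        MeasureTheory.volume σ₀ σ := by
      apply Continuous.intervalIntegrable; fun_prop
    have h3 : ‖dysonTerm K σ₀ y (n + 1) p σ‖ ≤
        |∫ ρ in σ₀..σ, ‖y‖ * C ^ (n + 1) / n.factorial * |ρ - σ₀| ^ n| :=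
      intervalIntegral.norm_integral_le_abs_of_norm_le
        ((MeasureTheory.ae_restrict_iff' measurableSet_uIoc).2 (MeasureTheory.ae_of_all _ h1)) hint
    refine h3.trans (le_of_eq ?_)
    rw [intervalIntegral.integral_const_mul, abs_mul, intervalIntegral.abs_intervalIntegral_eq,
      integral_pow_abs_sub_uIoc, abs_of_nonneg (by positivity), abs_of_nonneg (by positivity),
      Nat.factorial_succ, mul_pow]
    push_cast
    field_simp

theorem summable_dysonBound (C R c : ℝ) :
    Summable fun n : ℕ => c * ((C * R) ^ n / n.factorial) :=
  (Real.summable_pow_div_factorial _).mul_left _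

variable [TopologicalSpace P]

theorem continuous_dysonTerm (hK : Continuous fun z : P × ℝ => K z.1 z.2) (n : ℕ) :
    Continuous fun z : P × ℝ => dysonTerm K σ₀ y n z.1 z.2 := by
  induction n with
  | zero => exact continuous_const
  | succ n ih =>
    have h1 : Continuous fun z : (P × ℝ) × ℝ => K z.1.1 z.2 (dysonTerm K σ₀ y n z.1.1 z.2) := by
      have h2 : Continuous fun z : (P × ℝ) × ℝ => (z.1.1, z.2) := by fun_prop
      exact (hK.comp h2).clm_apply (ih.comp h2)
    exact intervalIntegral.continuous_parametric_intervalIntegral_of_continuous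
      (f := fun (z : P × ℝ) ρ => K z.1 ρ (dysonTerm K σ₀ y n z.1 ρ)) h1 continuous_snd

/-- A summable majorant, uniform over compact sets of parameters and bounded times. It serves both
the termwise integration and the continuity of the sum. -/
theorem exists_dysonBound (hK : Continuous fun z : P × ℝ => K z.1 z.2) {N : Set P}
    (hN : IsCompact N) (R : ℝ) :
    ∃ C, 0 ≤ C ∧ ∀ p ∈ N, ∀ σ, |σ - σ₀| ≤ R → ‖K p σ‖ ≤ C ∧
      ∀ n, ‖dysonTerm K σ₀ y n p σ‖ ≤ ‖y‖ * ((C * R) ^ n / n.factorial) := by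
  obtain ⟨C, hC⟩ := (hN.prod (isCompact_Icc (a := σ₀ - R) (b := σ₀ + R))).exists_bound_of_continuousOn
    hK.continuousOn
  have hC' : ∀ p ∈ N, ∀ σ, |σ - σ₀| ≤ R → ‖K p σ‖ ≤ max C 0 := fun p hp σ hσ => by
    have := abs_le.1 hσ
    exact (hC (p, σ) ⟨hp, by simp only [mem_Icc]; constructor <;> linarith⟩).trans (le_max_left _ _)
  refine ⟨max C 0, le_max_right _ _, fun p hp σ hσ => ⟨hC' p hp σ hσ, fun n => ?_⟩⟩
  refine (norm_dysonTerm_le (C := max C 0) (fun ρ hρ => hC' p hp ρ ?_) n).trans ?_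
  · exact (abs_sub_left_of_mem_uIcc hρ).trans hσ
  · gcongr

variable [CompleteSpace E]

theorem hasSum_dysonSum (hK : Continuous fun z : P × ℝ => K z.1 z.2) (p : P) (σ : ℝ) :
    HasSum (fun n => dysonTerm K σ₀ y n p σ) (dysonSum K σ₀ y p σ) := by
  obtain ⟨C, -, hC⟩ := exists_dysonBound (σ₀ := σ₀) (y := y) hK (isCompact_singleton (x := p))
    |σ - σ₀|
  exact (Summable.of_norm_bounded (summable_dysonBound C _ _)
    fun n => (hC p rfl σ le_rfl).2 n).hasSum

theorem dysonSum_eq (hK : Continuous fun z : P × ℝ => K z.1 z.2) (p : P) (σ : ℝ) :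
    dysonSum K σ₀ y p σ = y + ∫ ρ in σ₀..σ, K p ρ (dysonSum K σ₀ y p ρ) := by
  obtain ⟨C, hC0, hC⟩ := exists_dysonBound (σ₀ := σ₀) (y := y) hK (isCompact_singleton (x := p))
    |σ - σ₀|
  have hmem : ∀ ρ ∈ uIoc σ₀ σ, |ρ - σ₀| ≤ |σ - σ₀| := fun ρ hρ =>
    abs_sub_left_of_mem_uIcc (uIoc_subset_uIcc hρ)
  have h1 : HasSum (fun n => ∫ ρ in σ₀..σ, K p ρ (dysonTerm K σ₀ y n p ρ))
      (∫ ρ in σ₀..σ, K p ρ (dysonSum K σ₀ y p ρ)) := by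
    refine intervalIntegral.hasSum_integral_of_dominated_convergence
      (fun n _ => C * (‖y‖ * ((C * |σ - σ₀|) ^ n / n.factorial))) ?_ ?_ ?_ ?_ ?_
    · intro n
      have h2 : Continuous fun ρ : ℝ => (p, ρ) := by fun_prop
      exact ((hK.comp h2).clm_apply ((continuous_dysonTerm hK n).comp h2)).aestronglyMeasurable
    · refine fun n => MeasureTheory.ae_of_all _ fun ρ hρ => ?_
      exact ((K p ρ).le_opNorm _).trans (mul_le_mul (hC p rfl ρ (hmem ρ hρ)).1
        ((hC p rfl ρ (hmem ρ hρ)).2 n) (norm_nonneg _) hC0)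
    · exact MeasureTheory.ae_of_all _ fun _ _ => (summable_dysonBound C _ _).mul_left _
    · exact intervalIntegrable_const
    · exact MeasureTheory.ae_of_all _ fun ρ _ => (K p ρ).hasSum (hasSum_dysonSum hK p ρ)
  -- The integrals just summed are the terms of index `n + 1`; restoring the term of index `0` adds
  -- `y`.
  have h2 := (hasSum_nat_add_iff (f := fun n => dysonTerm K σ₀ y n p σ) 1).1 h1
  rw [(hasSum_dysonSum hK p σ).unique h2]
  simp [dysonTerm, add_comm]

@[simp]
theorem dysonSum_self (hK : Continuous fun z : P × ℝ => K z.1 z.2) (p : P) :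
    dysonSum K σ₀ y p σ₀ = y := by
  rw [dysonSum_eq hK]; simp

variable [WeaklyLocallyCompactSpace P]

theorem continuous_dysonSum (hK : Continuous fun z : P × ℝ => K z.1 z.2) :
    Continuous fun z : P × ℝ => dysonSum K σ₀ y z.1 z.2 := by
  rw [continuous_iff_continuousAt]
  rintro ⟨p, σ⟩
  obtain ⟨N, hN, hpN⟩ := exists_compact_mem_nhds p
  obtain ⟨C, -, hC⟩ := exists_dysonBound (σ₀ := σ₀) (y := y) hK hN (|σ - σ₀| + 1)
  have h1 : ContinuousOn (fun z : P × ℝ => dysonSum K σ₀ y z.1 z.2)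
      (N ×ˢ {ρ | |ρ - σ₀| ≤ |σ - σ₀| + 1}) :=
    continuousOn_tsum (fun n => (continuous_dysonTerm hK n).continuousOn)
      (summable_dysonBound C _ _) fun n z hz => (hC z.1 hz.1 z.2 hz.2).2 n
  refine h1.continuousAt (prod_mem_nhds hpN ?_)
  have h2 : ContinuousAt (fun ρ : ℝ => |ρ - σ₀|) σ := by fun_prop
  exact (h2.eventually (eventually_lt_nhds (by linarith))).mono fun ρ hρ => le_of_lt hρ

/-- The integral equation has a continuous integrand, so the fundamental theorem of calculus
applies. -/
theorem hasDerivAt_dysonSum (hK : Continuous fun z : P × ℝ => K z.1 z.2) (p : P) (σ : ℝ) :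
    HasDerivAt (dysonSum K σ₀ y p) (K p σ (dysonSum K σ₀ y p σ)) σ := by
  have h2 : Continuous fun ρ : ℝ => (p, ρ) := by fun_prop
  have h3 : Continuous fun ρ => K p ρ (dysonSum K σ₀ y p ρ) :=
    (hK.comp h2).clm_apply ((continuous_dysonSum hK).comp h2)
  have h4 := (h3.integral_hasStrictDerivAt σ₀ σ).hasDerivAt.const_add y
  exact h4.congr_of_eventuallyEq (Eventually.of_forall fun ρ => dysonSum_eq hK p ρ)

end Dyson

/-! ### Differentiation with respect to parameters -/

section Parameters

variable {E : Type*} [NormedAddCommGroup E] [NormedSpace ℝ E]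
  {Q : Type*} [TopologicalSpace Q]

/-- A jointly continuous derivative on `[0,1]` is a derivative uniformly in a compact set of
parameters. -/
theorem uniform_hasDerivWithinAt {F F' : ℝ → Q → E} {N : Set Q} (hN : IsCompact N)
    (hF : ∀ x ∈ Icc (0 : ℝ) 1, ∀ r ∈ N,
      HasDerivWithinAt (fun x => F x r) (F' x r) (Icc 0 1) x)
    (hF' : Continuous fun z : ℝ × Q => F' z.1 z.2) {x : ℝ} (hx : x ∈ Icc (0 : ℝ) 1) {η : ℝ}
    (hη : 0 < η) :
    ∃ δ > 0, ∀ x' ∈ Icc (0 : ℝ) 1, |x' - x| < δ → ∀ r ∈ N,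
      ‖F x' r - F x r - (x' - x) • F' x r‖ ≤ η * |x' - x| := by
  -- Compactness of `N` makes the continuity of `F'` at `x` uniform in `r`.
  have h1 : ∀ᶠ x' in 𝓝 x, ∀ r ∈ N, ‖F' x' r - F' x r‖ < η := by
    refine hN.eventually_forall_of_forall_eventually fun r _ => ?_
    have h2 : Continuous fun z : ℝ × Q => ‖F' z.1 z.2 - F' x z.2‖ := by
      have : Continuous fun z : ℝ × Q => F' x z.2 :=
        hF'.comp (by fun_prop : Continuous fun z : ℝ × Q => (x, z.2))
      exact (hF'.sub this).norm
    exact h2.continuousAt.eventually (eventually_lt_nhds (by simpa using hη))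
  obtain ⟨δ, hδ, h3⟩ := Metric.eventually_nhds_iff.1 h1
  refine ⟨δ, hδ, fun x' hx' hxx' r hr => ?_⟩
  have hsub : uIcc x x' ⊆ Icc (0 : ℝ) 1 := uIcc_subset_Icc hx hx'
  -- Mean value inequality for `u ↦ F u r - u • F' x r`, whose derivative is below `η` between `x`
  -- and `x'`.
  have key := (convex_uIcc x x').norm_image_sub_le_of_norm_hasDerivWithin_le
    (f := fun u => F u r - u • F' x r) (f' := fun u => F' u r - F' x r) (C := η)
    (fun u hu => by
      have h5 := ((hF u (hsub hu) r hr).mono hsub).sub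
        ((hasDerivWithinAt_id u (uIcc x x')).smul_const (F' x r))
      rw [one_smul] at h5
      exact h5)
    (fun u hu => (h3 (by
      rw [Real.dist_eq]
      exact (abs_sub_left_of_mem_uIcc hu).trans_lt hxx') r hr).le)
    left_mem_uIcc right_mem_uIcc
  rw [Real.norm_eq_abs] at key
  convert key using 2
  rw [sub_smul]; abel

/-- The derivative of a solution of a linear differential equation on `[0,1]`, with a final
condition at `1`, with respect to a parameter. -/
theorem hasDerivWithinAt_of_linear_ode {K dK : ℝ → ℝ → E →L[ℝ] E} {U dU : ℝ → ℝ → E}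
    (hK : Continuous fun z : ℝ × ℝ => K z.1 z.2) (hdK : Continuous fun z : ℝ × ℝ => dK z.1 z.2)
    (hUc : Continuous fun z : ℝ × ℝ => U z.1 z.2)
    (hKd : ∀ x ∈ Icc (0 : ℝ) 1, ∀ σ ∈ Icc (0 : ℝ) 1,
      HasDerivWithinAt (fun x => K x σ) (dK x σ) (Icc 0 1) x)
    (hU : ∀ x ∈ Icc (0 : ℝ) 1, ∀ σ ∈ Icc (0 : ℝ) 1,
      HasDerivWithinAt (U x) (K x σ (U x σ)) (Icc 0 1) σ)
    (hU1 : ∀ x ∈ Icc (0 : ℝ) 1, U x 1 = U 0 1)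
    {x : ℝ} (hx : x ∈ Icc (0 : ℝ) 1)
    (hdU : ∀ σ ∈ Icc (0 : ℝ) 1,
      HasDerivWithinAt (dU x) (K x σ (dU x σ) + dK x σ (U x σ)) (Icc 0 1) σ)
    (hdU1 : dU x 1 = 0) {σ : ℝ} (hσ : σ ∈ Icc (0 : ℝ) 1) :
    HasDerivWithinAt (fun x => U x σ) (dU x σ) (Icc 0 1) x := by
  obtain ⟨C, hC⟩ := (isCompact_Icc (a := (0 : ℝ)) (b := 1)).exists_bound_of_continuousOn
    (f := K x) (hK.comp (by fun_prop : Continuous fun s : ℝ => (x, s))).continuousOn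
  have hC0 : 0 ≤ C := (norm_nonneg _).trans (hC 0 (by simp))
  -- the total inhomogeneity has derivative `dK x σ (U x σ)` uniformly in `σ`
  have hunif : ∀ η > 0, ∃ δ > 0, ∀ x' ∈ Icc (0 : ℝ) 1, |x' - x| < δ → ∀ r ∈ Icc (0 : ℝ) 1,
      ‖(K x' r - K x r) (U x' r) - (x' - x) • dK x r (U x r)‖ ≤ η * |x' - x| := by
    intro η hη
    obtain ⟨B, hB⟩ := ((isCompact_Icc (a := (0 : ℝ)) (b := 1)).prod
      (isCompact_Icc (a := (0 : ℝ)) (b := 1))).exists_bound_of_continuousOn hUc.continuousOn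
    have hB0 : 0 ≤ B := (norm_nonneg _).trans (hB (0, 0) (by simp))
    obtain ⟨B', hB'⟩ := (isCompact_Icc (a := (0 : ℝ)) (b := 1)).exists_bound_of_continuousOn
      (f := dK x) (hdK.comp (by fun_prop : Continuous fun s : ℝ => (x, s))).continuousOn
    have hB'0 : 0 ≤ B' := (norm_nonneg _).trans (hB' 0 (by simp))
    obtain ⟨δ₁, hδ₁, h1⟩ := uniform_hasDerivWithinAt (F := K) (F' := dK) isCompact_Icc hKd hdK hx
      (η := η / (2 * (B + 1))) (by positivity)
    have h2 : ∀ᶠ x' in 𝓝 x, ∀ r ∈ Icc (0 : ℝ) 1, ‖U x' r - U x r‖ < η / (2 * (B' + 1)) := by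
      refine isCompact_Icc.eventually_forall_of_forall_eventually fun r _ => ?_
      have h2 : Continuous fun z : ℝ × ℝ => ‖U z.1 z.2 - U x z.2‖ := by
        have : Continuous fun z : ℝ × ℝ => U x z.2 :=
          hUc.comp (by fun_prop : Continuous fun z : ℝ × ℝ => (x, z.2))
        exact (hUc.sub this).norm
      exact h2.continuousAt.eventually
        (eventually_lt_nhds (by simp only [sub_self, norm_zero]; positivity))
    obtain ⟨δ₂, hδ₂, h3⟩ := Metric.eventually_nhds_iff.1 h2
    refine ⟨min δ₁ δ₂, lt_min hδ₁ hδ₂, fun x' hx' hxx' r hr => ?_⟩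
    have e1 := h1 x' hx' (hxx'.trans_le (min_le_left _ _)) r hr
    have e2 := (h3 (y := x') (by rw [Real.dist_eq]; exact hxx'.trans_le (min_le_right _ _)) r hr).le
    have e3 : (K x' r - K x r) (U x' r) - (x' - x) • dK x r (U x r)
        = (K x' r - K x r - (x' - x) • dK x r) (U x' r) +
          (x' - x) • dK x r (U x' r - U x r) := by
      simp only [sub_apply, smul_apply, map_sub, smul_sub]
      abel
    rw [e3]
    refine (norm_add_le _ _).trans ?_
    have e4 : ‖(K x' r - K x r - (x' - x) • dK x r) (U x' r)‖ ≤
        (η / (2 * (B + 1)) * |x' - x|) * (B + 1) := by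
      refine (ContinuousLinearMap.le_opNorm _ _).trans (mul_le_mul e1 ?_ (norm_nonneg _) ?_)
      · exact (hB (x', r) ⟨hx', hr⟩).trans (by linarith)
      · positivity
    have e5 : ‖(x' - x) • dK x r (U x' r - U x r)‖ ≤
        |x' - x| * ((B' + 1) * (η / (2 * (B' + 1)))) := by
      rw [norm_smul, Real.norm_eq_abs]
      refine mul_le_mul_of_nonneg_left ?_ (abs_nonneg _)
      refine (ContinuousLinearMap.le_opNorm _ _).trans (mul_le_mul ?_ e2 (norm_nonneg _) ?_)
      · exact (hB' r hr).trans (by linarith)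
      · positivity
    refine (add_le_add e4 e5).trans (le_of_eq ?_)
    field_simp
    ring
  rw [hasDerivWithinAt_iff_isLittleO, Asymptotics.isLittleO_iff]
  intro η hη
  -- The factor `1 / exp C` compensates the exponential in the Grönwall estimate below.
  obtain ⟨δ, hδ, h1⟩ := hunif (η / Real.exp C) (by positivity)
  have hball : ∀ᶠ x' in 𝓝[Icc 0 1] x, |x' - x| < δ := by
    refine mem_nhdsWithin_of_mem_nhds ?_
    exact Metric.ball_mem_nhds x hδ
  filter_upwards [hball, self_mem_nhdsWithin] with x' hx'δ hx'
  -- The remainder `U x' - U x - (x' - x) dU x` vanishes at `1` and solves the linear equation with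
  -- operator `K x` up to the inhomogeneity controlled by `hunif`.
  have key := norm_le_exp_of_norm_deriv_le_left (K := C) (η := η / Real.exp C * |x' - x|) hC0
    (by positivity) (f := fun s => U x' s - U x s - (x' - x) • dU x s)
    (fun s hs => ((hU x' hx' s hs).sub (hU x hx s hs)).sub ((hdU s hs).const_smul (x' - x)))
    (by simp [hdU1, hU1 x' hx', hU1 x hx])
    (fun s hs => by
      have e : K x' s (U x' s) - K x s (U x s) -
          (x' - x) • (K x s (dU x s) + dK x s (U x s)) =
          K x s (U x' s - U x s - (x' - x) • dU x s) +
          ((K x' s - K x s) (U x' s) - (x' - x) • dK x s (U x s)) := by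
        simp only [sub_apply, map_sub, map_smul, smul_add]
        abel
      rw [e]
      refine (norm_add_le _ _).trans (add_le_add ?_ (h1 x' hx' hx'δ s hs))
      exact (ContinuousLinearMap.le_opNorm _ _).trans
        (mul_le_mul_of_nonneg_right (hC s hs) (norm_nonneg _)))
    σ hσ
  rw [Real.norm_eq_abs]
  refine key.trans (le_of_eq ?_)
  field_simp

/-- Differentiation under the integral sign on `[0,1]`, at all points of `[0,1]`. -/
theorem hasDerivWithinAt_integral_of_continuous [CompleteSpace E] {F F' : ℝ → ℝ → E}
    (hF : ∀ x ∈ Icc (0 : ℝ) 1, ∀ r ∈ Icc (0 : ℝ) 1,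
      HasDerivWithinAt (fun x => F x r) (F' x r) (Icc 0 1) x)
    (hFc : Continuous fun z : ℝ × ℝ => F z.1 z.2)
    (hF' : Continuous fun z : ℝ × ℝ => F' z.1 z.2) {x : ℝ} (hx : x ∈ Icc (0 : ℝ) 1) :
    HasDerivWithinAt (fun x => ∫ r in (0 : ℝ)..1, F x r) (∫ r in (0 : ℝ)..1, F' x r)
      (Icc 0 1) x := by
  rw [hasDerivWithinAt_iff_isLittleO, Asymptotics.isLittleO_iff]
  intro η hη
  obtain ⟨δ, hδ, h1⟩ := uniform_hasDerivWithinAt isCompact_Icc hF hF' hx hη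
  have hball : ∀ᶠ x' in 𝓝[Icc 0 1] x, |x' - x| < δ := by
    refine mem_nhdsWithin_of_mem_nhds ?_
    exact Metric.ball_mem_nhds x hδ
  filter_upwards [hball, self_mem_nhdsWithin] with x' hx'δ hx'
  have hi : ∀ u, IntervalIntegrable (F u) MeasureTheory.volume 0 1 := fun u =>
    (hFc.comp (by fun_prop : Continuous fun s : ℝ => (u, s))).intervalIntegrable _ _
  have hi' : IntervalIntegrable (fun r => (x' - x) • F' x r) MeasureTheory.volume 0 1 :=
    ((hF'.comp (by fun_prop : Continuous fun s : ℝ => (x, s))).const_smul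
      (x' - x)).intervalIntegrable _ _
  rw [← intervalIntegral.integral_smul, ← intervalIntegral.integral_sub (hi x') (hi x),
    ← intervalIntegral.integral_sub ((hi x').sub (hi x)) hi', Real.norm_eq_abs]
  have h2 := intervalIntegral.norm_integral_le_of_norm_le_const (a := (0 : ℝ)) (b := 1)
    (f := fun r => F x' r - F x r - (x' - x) • F' x r) (C := η * |x' - x|) (fun r hr => by
      rw [uIoc_of_le zero_le_one] at hr
      exact h1 x' hx' hx'δ r ⟨hr.1.le, hr.2⟩)
  simpa using h2

end Parameters

/-! ### Linear parallel transport -/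

section LinearTransport

variable {V : Type*} [NormedAddCommGroup V] [NormedSpace ℝ V] {P : Type*}

/-- The operator valued solution of `W' = W ∘ k`, `W 1 = id`, with parameter `p`. -/
def linearTransport (k : P → ℝ → V →L[ℝ] V) (p : P) (σ : ℝ) : V →L[ℝ] V :=
  dysonSum (fun p σ => (ContinuousLinearMap.compL ℝ V V V).flip (k p σ)) 1
    (ContinuousLinearMap.id ℝ V) p σ

variable [CompleteSpace V] [TopologicalSpace P] {k : P → ℝ → V →L[ℝ] V}

theorem linearTransport_one (hk : Continuous fun z : P × ℝ => k z.1 z.2) (p : P) :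
    linearTransport k p 1 = ContinuousLinearMap.id ℝ V :=
  dysonSum_self (((ContinuousLinearMap.compL ℝ V V V).flip.continuous).comp hk) p

variable [WeaklyLocallyCompactSpace P]

theorem continuous_linearTransport (hk : Continuous fun z : P × ℝ => k z.1 z.2) :
    Continuous fun z : P × ℝ => linearTransport k z.1 z.2 :=
  continuous_dysonSum (((ContinuousLinearMap.compL ℝ V V V).flip.continuous).comp hk)

theorem hasDerivAt_linearTransport (hk : Continuous fun z : P × ℝ => k z.1 z.2) (p : P) (σ : ℝ) :
    HasDerivAt (linearTransport k p) (linearTransport k p σ ∘L k p σ) σ :=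
  hasDerivAt_dysonSum (((ContinuousLinearMap.compL ℝ V V V).flip.continuous).comp hk) p σ

/-- Linear transport from `σ` to `1` is the value at `1` of the Dyson series started at `σ`. -/
theorem linearTransport_apply_dysonSum (hk : Continuous fun z : P × ℝ => k z.1 z.2) (p : P)
    (σ ρ : ℝ) (y : V) :
    linearTransport k p ρ (dysonSum (fun p ρ => -k p ρ) σ y p ρ) = linearTransport k p σ y := by
  have hk' : Continuous fun z : P × ℝ => -k z.1 z.2 := hk.neg
  -- With `W' = W ∘ k` and `u' = -k u` the product `W(r) u(r)` has derivative zero.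
  have h : ∀ r, HasDerivAt
      (fun r => linearTransport k p r (dysonSum (fun p ρ => -k p ρ) σ y p r)) 0 r := fun r => by
    have := (hasDerivAt_linearTransport hk p r).clm_apply
      (hasDerivAt_dysonSum (K := fun p ρ => -k p ρ) (σ₀ := σ) (y := y) hk' p r)
    simpa using this
  have h2 := is_const_of_deriv_eq_zero (fun r => (h r).differentiableAt) (fun r => (h r).deriv) ρ σ
  rwa [dysonSum_self (K := fun p ρ => -k p ρ) (σ₀ := σ) (y := y) hk' p] at h2

/-- The bridge from the series of iterated integrals, with its operators ordered from `σ` to `1`, to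
the operator equation in `σ`: the conserved quantity of the preceding lemma is evaluated at `ρ = 1`.
-/
theorem dysonSum_neg_one_eq_linearTransport (hk : Continuous fun z : P × ℝ => k z.1 z.2) (p : P)
    (σ : ℝ) (y : V) :
    dysonSum (fun p ρ => -k p ρ) σ y p 1 = linearTransport k p σ y := by
  rw [← linearTransport_apply_dysonSum hk p σ 1 y, linearTransport_one hk]; rfl

/-- Linear transport along derivations of a bilinear operation is an endomorphism of it. -/
theorem linearTransport_bilinear (hk : Continuous fun z : P × ℝ => k z.1 z.2)
    {br : V →L[ℝ] V →L[ℝ] V} {p : P}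
    (hd : ∀ σ ∈ Icc (0 : ℝ) 1, ∀ x y, k p σ (br x y) = br (k p σ x) y + br x (k p σ y))
    {σ : ℝ} (hσ : σ ∈ Icc (0 : ℝ) 1) (x y : V) :
    linearTransport k p σ (br x y) =
      br (linearTransport k p σ x) (linearTransport k p σ y) := by
  have hk' : Continuous fun z : P × ℝ => -k z.1 z.2 := hk.neg
  let u : V → ℝ → V := fun x => dysonSum (fun p ρ => -k p ρ) σ x p
  have hu : ∀ x r, HasDerivAt (u x) (-k p r (u x r)) r := fun x r =>
    hasDerivAt_dysonSum (K := fun p ρ => -k p ρ) (σ₀ := σ) (y := x) hk' p r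
  have hu0 : ∀ x, u x σ = x := fun x => dysonSum_self (K := fun p ρ => -k p ρ) (σ₀ := σ) (y := x) hk' p
  have hWu : ∀ x r, linearTransport k p r (u x r) = linearTransport k p σ x := fun x r =>
    linearTransport_apply_dysonSum hk p σ r x
  -- With `u x`, `u y` the solutions of `u' = -k u` starting at `x`, `y`, the vector `W(r) [u x r, u
  -- y r]` is constant by the derivation property. Its values at `r = σ` and `r = 1` are the two
  -- sides of the claim.
  have h : ∀ r ∈ Icc σ 1, HasDerivWithinAt
      (fun r => linearTransport k p r (br (u x r) (u y r))) 0 (Icc σ 1) r := fun r hr => by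
    have h1 : HasDerivAt (fun r => br (u x r) (u y r))
        (br (-k p r (u x r)) (u y r) + br (u x r) (-k p r (u y r))) r :=
      (br.hasFDerivAt.comp_hasDerivAt r (hu x r)).clm_apply (hu y r)
    have h2 := (hasDerivAt_linearTransport hk p r).clm_apply h1
    have h3 := hd r ⟨hσ.1.trans hr.1, hr.2⟩ (u x r) (u y r)
    simp only [ContinuousLinearMap.comp_apply, h3, map_neg, neg_apply, map_add] at h2
    convert h2.hasDerivWithinAt using 1
    abel
  have h2 := constant_of_has_deriv_right_zero (fun r hr => (h r hr).continuousWithinAt)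
    (fun r hr => (h r (Ico_subset_Icc_self hr)).mono_of_mem_nhdsWithin
      (Icc_mem_nhdsGE_of_mem hr)) 1 ⟨hσ.2, le_rfl⟩
  simp only [hu0] at h2
  have h3 : ∀ x, u x 1 = linearTransport k p σ x := fun x => by
    rw [← hWu x 1, linearTransport_one hk]; rfl
  rw [← h2, linearTransport_one hk, h3, h3]; rfl

end LinearTransport

/-! ### The curvature identity for the path space connection -/

section Square

/-- The data on the square `[0,1]²`, with coordinates `(τ, σ)`, from which the standard connection
on path space and the infinitesimal gauge transformations are built: `k`, `kt` are the actions of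
the `σ`- and `τ`-component of a `𝔤`-valued `1`-form `A`, while `a`, `at'` are the components of an
`𝔥`-valued `1`-form and `b` is the `(σ, τ)`-component of an `𝔥`-valued `2`-form `B`, where
`F_A + dt(B) = 0`. -/
structure SquareData (V : Type*) [NormedAddCommGroup V] [NormedSpace ℝ V] where
  br : V →L[ℝ] V →L[ℝ] V
  br_self : ∀ x, br x x = 0
  jacobi : ∀ x y z, br x (br y z) = br (br x y) z + br y (br x z)
  (k kt dk dkt : ℝ → ℝ → V →L[ℝ] V)
  (a at' da dat b : ℝ → ℝ → V)
  continuous_k : Continuous fun z : ℝ × ℝ => k z.1 z.2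
  continuous_kt : Continuous fun z : ℝ × ℝ => kt z.1 z.2
  continuous_dk : Continuous fun z : ℝ × ℝ => dk z.1 z.2
  continuous_a : Continuous fun z : ℝ × ℝ => a z.1 z.2
  continuous_at : Continuous fun z : ℝ × ℝ => at' z.1 z.2
  continuous_da : Continuous fun z : ℝ × ℝ => da z.1 z.2
  continuous_dat : Continuous fun z : ℝ × ℝ => dat z.1 z.2
  continuous_b : Continuous fun z : ℝ × ℝ => b z.1 z.2
  hasDeriv_k : ∀ τ ∈ Icc (0 : ℝ) 1, ∀ σ ∈ Icc (0 : ℝ) 1,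
    HasDerivWithinAt (fun τ => k τ σ) (dk τ σ) (Icc 0 1) τ
  hasDeriv_kt : ∀ τ ∈ Icc (0 : ℝ) 1, ∀ σ ∈ Icc (0 : ℝ) 1,
    HasDerivWithinAt (fun σ => kt τ σ) (dkt τ σ) (Icc 0 1) σ
  hasDeriv_a : ∀ τ ∈ Icc (0 : ℝ) 1, ∀ σ ∈ Icc (0 : ℝ) 1,
    HasDerivWithinAt (fun τ => a τ σ) (da τ σ) (Icc 0 1) τ
  hasDeriv_at : ∀ τ ∈ Icc (0 : ℝ) 1, ∀ σ ∈ Icc (0 : ℝ) 1,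
    HasDerivWithinAt (fun σ => at' τ σ) (dat τ σ) (Icc 0 1) σ
  derivation_k : ∀ τ ∈ Icc (0 : ℝ) 1, ∀ σ ∈ Icc (0 : ℝ) 1, ∀ x y,
    k τ σ (br x y) = br (k τ σ x) y + br x (k τ σ y)
  derivation_kt : ∀ τ ∈ Icc (0 : ℝ) 1, ∀ σ ∈ Icc (0 : ℝ) 1, ∀ x y,
    kt τ σ (br x y) = br (kt τ σ x) y + br x (kt τ σ y)
  flat : ∀ τ ∈ Icc (0 : ℝ) 1, ∀ σ ∈ Icc (0 : ℝ) 1, ∀ x,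
    dk τ σ x = dkt τ σ x + (k τ σ (kt τ σ x) - kt τ σ (k τ σ x)) + br (b τ σ) x
  kt_one : ∀ τ ∈ Icc (0 : ℝ) 1, kt τ 1 = 0
  at_zero : ∀ τ ∈ Icc (0 : ℝ) 1, at' τ 0 = 0
  at_one : ∀ τ ∈ Icc (0 : ℝ) 1, at' τ 1 = 0

namespace SquareData

variable {V : Type*} [NormedAddCommGroup V] [NormedSpace ℝ V] (D : SquareData V)

theorem br_skew (x y : V) : D.br x y = -D.br y x := by
  have h := D.br_self (x + y)
  simp only [map_add, add_apply, D.br_self, zero_add, add_zero] at h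
  exact eq_neg_of_add_eq_zero_right h

/-- The `σ`-component of `A + ε dt(a)`, acting on `𝔥`. -/
def kE (p : ℝ × ℝ) (σ : ℝ) : V →L[ℝ] V := D.k p.1 σ + p.2 • D.br (D.a p.1 σ)

/-- The `τ`-component of `A + ε dt(a)`, acting on `𝔥`. -/
def ktE (p : ℝ × ℝ) (σ : ℝ) : V →L[ℝ] V := D.kt p.1 σ + p.2 • D.br (D.at' p.1 σ)

/-- The component of `B - ε d_A a - ε² a ∧ a`. -/
def bE (p : ℝ × ℝ) (σ : ℝ) : V :=
  D.b p.1 σ - p.2 • (D.dat p.1 σ - D.da p.1 σ + (D.k p.1 σ (D.at' p.1 σ) - D.kt p.1 σ (D.a p.1 σ)))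
    - p.2 ^ 2 • D.br (D.a p.1 σ) (D.at' p.1 σ)

/-- Transport for `A + ε dt(a)`. -/
def W (p : ℝ × ℝ) (σ : ℝ) : V →L[ℝ] V := linearTransport D.kE p σ

/-- `∫_σ^1 W(a)`. -/
def intA (p : ℝ × ℝ) (σ : ℝ) : V := -∫ ρ in (1 : ℝ)..σ, D.W p ρ (D.a p.1 ρ)

/-- `∫_σ^1 W(B)`. -/
def intB (p : ℝ × ℝ) (σ : ℝ) : V := -∫ ρ in (1 : ℝ)..σ, D.W p ρ (D.bE p ρ)

/-- The derivative of `W` in the direction of `ε`. -/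
def dεW (p : ℝ × ℝ) (σ : ℝ) : V →L[ℝ] V := -(D.br (D.intA p σ) ∘L D.W p σ)

/-- The derivative of `W` in the direction of `τ`. -/
def dτW (p : ℝ × ℝ) (σ : ℝ) : V →L[ℝ] V :=
  D.W p σ ∘L D.ktE p σ - D.br (D.intB p σ) ∘L D.W p σ

/-- The function `∮_{A + ε dt(a)} (a)` of `τ` and `ε`. -/
def gaugeFunction (p : ℝ × ℝ) : V := ∫ σ in (0 : ℝ)..1, D.W p σ (D.a p.1 σ)

/-- The connection `∮_{A + ε dt(a)} (B - ε d_A a - ε² a ∧ a)` as a function of `τ` and `ε`. -/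
def connection (p : ℝ × ℝ) : V := ∫ σ in (0 : ℝ)..1, D.W p σ (D.bE p σ)

/-- The derivative of `gaugeFunction` in the direction of `τ`. -/
def dGaugeFunction (p : ℝ × ℝ) : V :=
  ∫ σ in (0 : ℝ)..1, (D.dτW p σ (D.a p.1 σ) + D.W p σ (D.da p.1 σ))

theorem intA_zero (p : ℝ × ℝ) : D.intA p 0 = D.gaugeFunction p := by
  rw [intA, gaugeFunction, intervalIntegral.integral_symm, neg_neg]

theorem intB_zero (p : ℝ × ℝ) : D.intB p 0 = D.connection p := by
  rw [intB, connection, intervalIntegral.integral_symm, neg_neg]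

theorem intA_one (p : ℝ × ℝ) : D.intA p 1 = 0 := by simp [intA]

theorem intB_one (p : ℝ × ℝ) : D.intB p 1 = 0 := by simp [intB]

/-! ### Joint continuity in the parameters `(τ, ε)` and `σ`. -/

section Continuity

theorem continuous_k' : Continuous fun z : (ℝ × ℝ) × ℝ => D.k z.1.1 z.2 :=
  D.continuous_k.comp (by fun_prop : Continuous fun z : (ℝ × ℝ) × ℝ => (z.1.1, z.2))
theorem continuous_kt' : Continuous fun z : (ℝ × ℝ) × ℝ => D.kt z.1.1 z.2 :=
  D.continuous_kt.comp (by fun_prop : Continuous fun z : (ℝ × ℝ) × ℝ => (z.1.1, z.2))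
theorem continuous_a' : Continuous fun z : (ℝ × ℝ) × ℝ => D.a z.1.1 z.2 :=
  D.continuous_a.comp (by fun_prop : Continuous fun z : (ℝ × ℝ) × ℝ => (z.1.1, z.2))
theorem continuous_at' : Continuous fun z : (ℝ × ℝ) × ℝ => D.at' z.1.1 z.2 :=
  D.continuous_at.comp (by fun_prop : Continuous fun z : (ℝ × ℝ) × ℝ => (z.1.1, z.2))
theorem continuous_da' : Continuous fun z : (ℝ × ℝ) × ℝ => D.da z.1.1 z.2 :=
  D.continuous_da.comp (by fun_prop : Continuous fun z : (ℝ × ℝ) × ℝ => (z.1.1, z.2))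
theorem continuous_dat' : Continuous fun z : (ℝ × ℝ) × ℝ => D.dat z.1.1 z.2 :=
  D.continuous_dat.comp (by fun_prop : Continuous fun z : (ℝ × ℝ) × ℝ => (z.1.1, z.2))
theorem continuous_b' : Continuous fun z : (ℝ × ℝ) × ℝ => D.b z.1.1 z.2 :=
  D.continuous_b.comp (by fun_prop : Continuous fun z : (ℝ × ℝ) × ℝ => (z.1.1, z.2))

theorem continuous_kE : Continuous fun z : (ℝ × ℝ) × ℝ => D.kE z.1 z.2 :=
  D.continuous_k'.add ((continuous_snd.comp continuous_fst).smul (D.br.continuous.comp D.continuous_a'))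

theorem continuous_ktE : Continuous fun z : (ℝ × ℝ) × ℝ => D.ktE z.1 z.2 :=
  D.continuous_kt'.add
    ((continuous_snd.comp continuous_fst).smul (D.br.continuous.comp D.continuous_at'))

theorem continuous_bE : Continuous fun z : (ℝ × ℝ) × ℝ => D.bE z.1 z.2 := by
  have h : Continuous fun z : (ℝ × ℝ) × ℝ => z.1.2 := by fun_prop
  exact (D.continuous_b'.sub (h.smul ((D.continuous_dat'.sub D.continuous_da').add
    ((D.continuous_k'.clm_apply D.continuous_at').sub
      (D.continuous_kt'.clm_apply D.continuous_a'))))).sub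
    ((h.pow 2).smul ((D.br.continuous.comp D.continuous_a').clm_apply D.continuous_at'))

variable [CompleteSpace V]

theorem continuous_W : Continuous fun z : (ℝ × ℝ) × ℝ => D.W z.1 z.2 :=
  continuous_linearTransport D.continuous_kE

theorem continuous_W_a : Continuous fun z : (ℝ × ℝ) × ℝ => D.W z.1 z.2 (D.a z.1.1 z.2) :=
  D.continuous_W.clm_apply D.continuous_a'

theorem continuous_W_bE : Continuous fun z : (ℝ × ℝ) × ℝ => D.W z.1 z.2 (D.bE z.1 z.2) :=
  D.continuous_W.clm_apply D.continuous_bE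

theorem continuous_intA : Continuous fun z : (ℝ × ℝ) × ℝ => D.intA z.1 z.2 :=
  (intervalIntegral.continuous_parametric_intervalIntegral_of_continuous
    (f := fun (z : (ℝ × ℝ) × ℝ) ρ => D.W z.1 ρ (D.a z.1.1 ρ))
    (D.continuous_W_a.comp (by fun_prop :
      Continuous fun z : ((ℝ × ℝ) × ℝ) × ℝ => (z.1.1, z.2))) continuous_snd).neg

theorem continuous_intB : Continuous fun z : (ℝ × ℝ) × ℝ => D.intB z.1 z.2 :=
  (intervalIntegral.continuous_parametric_intervalIntegral_of_continuous
    (f := fun (z : (ℝ × ℝ) × ℝ) ρ => D.W z.1 ρ (D.bE z.1 ρ))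
    (D.continuous_W_bE.comp (by fun_prop :
      Continuous fun z : ((ℝ × ℝ) × ℝ) × ℝ => (z.1.1, z.2))) continuous_snd).neg

theorem continuous_dεW : Continuous fun z : (ℝ × ℝ) × ℝ => D.dεW z.1 z.2 :=
  ((D.br.continuous.comp D.continuous_intA).clm_comp D.continuous_W).neg

theorem continuous_dτW : Continuous fun z : (ℝ × ℝ) × ℝ => D.dτW z.1 z.2 :=
  (D.continuous_W.clm_comp D.continuous_ktE).sub
    ((D.br.continuous.comp D.continuous_intB).clm_comp D.continuous_W)

theorem continuous_gaugeFunction : Continuous D.gaugeFunction :=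
  intervalIntegral.continuous_parametric_intervalIntegral_of_continuous'
    (f := fun p σ => D.W p σ (D.a p.1 σ)) D.continuous_W_a 0 1

theorem continuous_connection : Continuous D.connection :=
  intervalIntegral.continuous_parametric_intervalIntegral_of_continuous'
    (f := fun p σ => D.W p σ (D.bE p σ)) D.continuous_W_bE 0 1

theorem continuous_dτW_a : Continuous fun z : (ℝ × ℝ) × ℝ => D.dτW z.1 z.2 (D.a z.1.1 z.2) :=
  D.continuous_dτW.clm_apply D.continuous_a'

theorem continuous_W_da : Continuous fun z : (ℝ × ℝ) × ℝ => D.W z.1 z.2 (D.da z.1.1 z.2) :=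
  D.continuous_W.clm_apply D.continuous_da'

theorem continuous_dGaugeFunction_integrand : Continuous fun z : (ℝ × ℝ) × ℝ =>
    D.dτW z.1 z.2 (D.a z.1.1 z.2) + D.W z.1 z.2 (D.da z.1.1 z.2) :=
  D.continuous_dτW_a.add D.continuous_W_da

theorem continuous_dGaugeFunction : Continuous D.dGaugeFunction :=
  intervalIntegral.continuous_parametric_intervalIntegral_of_continuous'
    (f := fun p σ => D.dτW p σ (D.a p.1 σ) + D.W p σ (D.da p.1 σ))
    D.continuous_dGaugeFunction_integrand 0 1

end Continuity

/-- The derivative of the component `bE` in the direction of `ε`. -/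
def dεb (p : ℝ × ℝ) (σ : ℝ) : V :=
  -(D.dat p.1 σ - D.da p.1 σ + (D.kE p σ (D.at' p.1 σ) - D.ktE p σ (D.a p.1 σ)))

/-- The derivative `-d_A a - 2 ε a ∧ a` regroups as minus the covariant derivative of `a` for the
deformed form `A + ε dt(a)`: passing from `A` to it adds `ε([a, a_τ] - [a_τ, a]) = 2 ε [a, a_τ]`. -/
theorem hasDerivAt_bE (τ ε σ : ℝ) :
    HasDerivAt (fun ε => D.bE (τ, ε) σ) (D.dεb (τ, ε) σ) ε := by
  have h1 := (((hasDerivAt_id ε).smul_const (D.dat τ σ - D.da τ σ + (D.k τ σ (D.at' τ σ) -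
    D.kt τ σ (D.a τ σ)))).const_sub (D.b τ σ)).sub
    (((hasDerivAt_id ε).pow 2).smul_const (D.br (D.a τ σ) (D.at' τ σ)))
  refine h1.congr_deriv ?_
  simp only [dεb, kE, ktE, add_apply, smul_apply, D.br_skew (D.at' τ σ) (D.a τ σ), id]
  module

/-! ### Variation of the transport and flatness in the directions `τ` and `ε`. -/

section Derivatives

variable [CompleteSpace V]

/-- The generator `k + ε ad a` is a derivation: `k` by assumption and `ad a` by the Jacobi identity.
-/
theorem W_br {p : ℝ × ℝ} (hp : p.1 ∈ Icc (0 : ℝ) 1) {σ : ℝ} (hσ : σ ∈ Icc (0 : ℝ) 1) (x y : V) :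
    D.W p σ (D.br x y) = D.br (D.W p σ x) (D.W p σ y) :=
  linearTransport_bilinear D.continuous_kE (fun s hs x y => by
    simp only [kE, add_apply, smul_apply, map_add, map_smul, D.derivation_k _ hp s hs]
    rw [D.jacobi (D.a p.1 s) x y, smul_add]
    abel) hσ x y

theorem hasDerivAt_W (p : ℝ × ℝ) (σ : ℝ) : HasDerivAt (D.W p) (D.W p σ ∘L D.kE p σ) σ :=
  hasDerivAt_linearTransport D.continuous_kE p σ

theorem hasDerivAt_intA (p : ℝ × ℝ) (σ : ℝ) :
    HasDerivAt (D.intA p) (-D.W p σ (D.a p.1 σ)) σ :=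
  ((D.continuous_W_a.comp (by fun_prop : Continuous fun s : ℝ => (p, s))).integral_hasStrictDerivAt
    1 σ).hasDerivAt.neg

theorem hasDerivAt_intB (p : ℝ × ℝ) (σ : ℝ) :
    HasDerivAt (D.intB p) (-D.W p σ (D.bE p σ)) σ :=
  ((D.continuous_W_bE.comp (by fun_prop : Continuous fun s : ℝ => (p, s))).integral_hasStrictDerivAt
    1 σ).hasDerivAt.neg

/-- Variation of constants. The generator varies by `ad a`, and `W ∘ ad a = ad (W a) ∘ W` because
`W` preserves the bracket, so the Duhamel integral is `-ad (∫_σ^1 W a) ∘ W`. -/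
theorem hasDerivWithinAt_W_ε {τ ε σ : ℝ} (hτ : τ ∈ Icc (0 : ℝ) 1) (hε : ε ∈ Icc (0 : ℝ) 1)
    (hσ : σ ∈ Icc (0 : ℝ) 1) :
    HasDerivWithinAt (fun ε => D.W (τ, ε) σ) (D.dεW (τ, ε) σ) (Icc 0 1) ε := by
  let R := (ContinuousLinearMap.compL ℝ V V V).flip
  have hc : Continuous fun z : ℝ × ℝ => ((τ, z.1), z.2) := by fun_prop
  refine hasDerivWithinAt_of_linear_ode (K := fun ε σ => R (D.kE (τ, ε) σ))
    (dK := fun ε σ => R (D.br (D.a τ σ))) (U := fun ε σ => D.W (τ, ε) σ)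
    (dU := fun ε σ => D.dεW (τ, ε) σ) (R.continuous.comp (D.continuous_kE.comp hc))
    (R.continuous.comp (D.br.continuous.comp (D.continuous_a'.comp hc)))
    (D.continuous_W.comp hc) ?_ (fun ε _ σ _ => (D.hasDerivAt_W (τ, ε) σ).hasDerivWithinAt)
    (fun ε _ => by simp only [W, linearTransport_one D.continuous_kE]) hε ?_ ?_ hσ
  · intro ε _ s _
    refine R.hasFDerivAt.comp_hasDerivWithinAt ε ?_
    have := ((hasDerivWithinAt_id ε (Icc (0 : ℝ) 1)).smul_const (D.br (D.a τ s))).const_add (D.k τ s)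
    rw [one_smul] at this
    exact this
  · intro s hs
    have h1 : HasDerivAt (fun s => D.dεW (τ, ε) s) _ s := ((D.br.hasFDerivAt.comp_hasDerivAt s
      (D.hasDerivAt_intA (τ, ε) s)).clm_comp (D.hasDerivAt_W (τ, ε) s)).neg
    convert h1.hasDerivWithinAt using 1
    ext x
    simp [R, dεW, D.W_br (p := (τ, ε)) hτ hs]
  · simp [dεW, intA_one]

/-- Fake flatness persists along the deformation at the level of the action on `𝔥`: `∂_τ k_ε = ∂_σ
kt_ε + [k_ε, kt_ε] + ad b_ε`, with `b_ε` the component `bE`. The first two terms integrate to `W ∘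
kt_ε` and the last to `-ad (∫_σ^1 W b_ε) ∘ W`. The condition at `σ = 1` holds because `kt` and `at'`
vanish there. -/
theorem hasDerivWithinAt_W_τ {τ ε σ : ℝ} (hτ : τ ∈ Icc (0 : ℝ) 1)
    (hσ : σ ∈ Icc (0 : ℝ) 1) :
    HasDerivWithinAt (fun τ => D.W (τ, ε) σ) (D.dτW (τ, ε) σ) (Icc 0 1) τ := by
  let R := (ContinuousLinearMap.compL ℝ V V V).flip
  have hc : Continuous fun z : ℝ × ℝ => ((z.1, ε), z.2) := by fun_prop
  refine hasDerivWithinAt_of_linear_ode (K := fun τ σ => R (D.kE (τ, ε) σ))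
    (dK := fun τ σ => R (D.dk τ σ + ε • D.br (D.da τ σ))) (U := fun τ σ => D.W (τ, ε) σ)
    (dU := fun τ σ => D.dτW (τ, ε) σ) (R.continuous.comp (D.continuous_kE.comp hc))
    (R.continuous.comp (D.continuous_dk.add ((D.br.continuous.comp D.continuous_da).const_smul ε)))
    (D.continuous_W.comp hc) ?_ (fun τ _ σ _ => (D.hasDerivAt_W (τ, ε) σ).hasDerivWithinAt)
    (fun τ _ => by simp only [W, linearTransport_one D.continuous_kE]) hτ ?_ ?_ hσ
  · intro τ hτ s hs
    exact R.hasFDerivAt.comp_hasDerivWithinAt τ ((D.hasDeriv_k τ hτ s hs).add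
      ((D.br.hasFDerivAt.comp_hasDerivWithinAt τ (D.hasDeriv_a τ hτ s hs)).const_smul ε))
  · intro s hs
    have h0 : HasDerivWithinAt (fun s => D.ktE (τ, ε) s) _ (Icc 0 1) s :=
      (D.hasDeriv_kt τ hτ s hs).add
        ((D.br.hasFDerivAt.comp_hasDerivWithinAt s (D.hasDeriv_at τ hτ s hs)).const_smul ε)
    have h1 : HasDerivWithinAt (fun s => D.dτW (τ, ε) s) _ (Icc 0 1) s :=
      ((D.hasDerivAt_W (τ, ε) s).hasDerivWithinAt.clm_comp h0).sub
      (((D.br.hasFDerivAt.comp_hasDerivAt s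
      (D.hasDerivAt_intB (τ, ε) s)).clm_comp (D.hasDerivAt_W (τ, ε) s)).hasDerivWithinAt)
    refine h1.congr_deriv (ContinuousLinearMap.ext fun x => ?_)
    have h2 : D.br (D.W (τ, ε) s (D.bE (τ, ε) s)) (D.W (τ, ε) s x) =
      D.W (τ, ε) s (D.br (D.bE (τ, ε) s) x) := (D.W_br (p := (τ, ε)) hτ hs _ _).symm
    -- The next three identities express `ad` of `k(a_τ)`, of `kt(a)` and of `[a, a_τ]` as
    -- commutators of operators; after that the deformed flatness is a linear identity.
    have h3 : D.br (D.k τ s (D.at' τ s)) x =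
      D.k τ s (D.br (D.at' τ s) x) - D.br (D.at' τ s) (D.k τ s x) := by
      rw [D.derivation_k τ hτ s hs]; abel
    have h4 : D.br (D.kt τ s (D.a τ s)) x =
      D.kt τ s (D.br (D.a τ s) x) - D.br (D.a τ s) (D.kt τ s x) := by
      rw [D.derivation_kt τ hτ s hs]; abel
    have h5 : D.br (D.br (D.a τ s) (D.at' τ s)) x = D.br (D.a τ s) (D.br (D.at' τ s) x) -
      D.br (D.at' τ s) (D.br (D.a τ s) x) := by
      rw [D.jacobi]; abel
    simp only [R, dτW, ktE, kE, ContinuousLinearMap.flip_apply, ContinuousLinearMap.compL_apply,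
      add_apply, sub_apply, smul_apply, neg_apply, ContinuousLinearMap.comp_apply, Function.comp_apply, map_neg, h2]
    simp only [bE, map_sub, map_add, map_smul, sub_apply, add_apply, smul_apply, h3, h4, h5,
      D.flat τ hτ s hs, smul_add, smul_sub, smul_smul]
    module
  · simp [dτW, intB_one, ktE, D.kt_one τ hτ, D.at_one τ hτ]

theorem hasDerivWithinAt_gaugeFunction {τ ε : ℝ} (hτ : τ ∈ Icc (0 : ℝ) 1) :
    HasDerivWithinAt (fun τ => D.gaugeFunction (τ, ε)) (D.dGaugeFunction (τ, ε)) (Icc 0 1) τ := by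
  have hc : Continuous fun z : ℝ × ℝ => ((z.1, ε), z.2) := by fun_prop
  have h1 : ∀ τ ∈ Icc (0 : ℝ) 1, ∀ s ∈ Icc (0 : ℝ) 1,
      HasDerivWithinAt (fun τ => D.W (τ, ε) s (D.a τ s))
        (D.dτW (τ, ε) s (D.a τ s) + D.W (τ, ε) s (D.da τ s)) (Icc 0 1) τ :=
    fun τ hτ s hs => (D.hasDerivWithinAt_W_τ hτ hs).clm_apply (D.hasDeriv_a τ hτ s hs)
  have h2 : Continuous fun z : ℝ × ℝ => D.W (z.1, ε) z.2 (D.a z.1 z.2) := D.continuous_W_a.comp hc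
  have h3 : Continuous fun z : ℝ × ℝ =>
      D.dτW (z.1, ε) z.2 (D.a z.1 z.2) + D.W (z.1, ε) z.2 (D.da z.1 z.2) :=
    (D.continuous_dτW_a.comp hc).add (D.continuous_W_da.comp hc)
  exact hasDerivWithinAt_integral_of_continuous h1 h2 h3 hτ

/-- The vanishing of the curvature of the connection with components `connection` and
`gaugeFunction`. -/
theorem hasDerivWithinAt_connection {τ ε : ℝ} (hτ : τ ∈ Icc (0 : ℝ) 1) (hε : ε ∈ Icc (0 : ℝ) 1) :
    HasDerivWithinAt (fun ε => D.connection (τ, ε))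
      (D.dGaugeFunction (τ, ε) - D.br (D.gaugeFunction (τ, ε)) (D.connection (τ, ε)))
      (Icc 0 1) ε := by
  have hc : Continuous fun z : ℝ × ℝ => ((τ, z.1), z.2) := by fun_prop
  have hdb : Continuous fun z : (ℝ × ℝ) × ℝ => D.dεb z.1 z.2 :=
    ((D.continuous_dat'.sub D.continuous_da').add
      ((D.continuous_kE.clm_apply D.continuous_at').sub
        (D.continuous_ktE.clm_apply D.continuous_a'))).neg
  have hF1 : Continuous fun z : (ℝ × ℝ) × ℝ => D.dεW z.1 z.2 (D.bE z.1 z.2) :=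
    D.continuous_dεW.clm_apply D.continuous_bE
  have hF2 : Continuous fun z : (ℝ × ℝ) × ℝ => D.W z.1 z.2 (D.dεb z.1 z.2) :=
    D.continuous_W.clm_apply hdb
  have h1 : ∀ ε ∈ Icc (0 : ℝ) 1, ∀ s ∈ Icc (0 : ℝ) 1,
      HasDerivWithinAt (fun ε => D.W (τ, ε) s (D.bE (τ, ε) s))
        (D.dεW (τ, ε) s (D.bE (τ, ε) s) + D.W (τ, ε) s (D.dεb (τ, ε) s)) (Icc 0 1) ε :=
    fun ε hε s hs => (D.hasDerivWithinAt_W_ε hτ hε hs).clm_apply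
      (D.hasDerivAt_bE τ ε s).hasDerivWithinAt
  have h2 : Continuous fun z : ℝ × ℝ => D.W (τ, z.1) z.2 (D.bE (τ, z.1) z.2) :=
    D.continuous_W_bE.comp hc
  have h3 : Continuous fun z : ℝ × ℝ =>
      D.dεW (τ, z.1) z.2 (D.bE (τ, z.1) z.2) + D.W (τ, z.1) z.2 (D.dεb (τ, z.1) z.2) :=
    (hF1.comp hc).add (hF2.comp hc)
  refine (hasDerivWithinAt_integral_of_continuous h1 h2 h3 hε).congr_deriv ?_
  have hi : Continuous fun s : ℝ => ((τ, ε), s) := by fun_prop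
  have h4 : IntervalIntegrable (fun s => D.dεW (τ, ε) s (D.bE (τ, ε) s) +
      D.W (τ, ε) s (D.dεb (τ, ε) s)) MeasureTheory.volume 0 1 :=
    ((hF1.comp hi).add (hF2.comp hi)).intervalIntegrable _ _
  have h5 : IntervalIntegrable (fun s => D.dτW (τ, ε) s (D.a τ s) + D.W (τ, ε) s (D.da τ s))
      MeasureTheory.volume 0 1 :=
    ((D.continuous_dτW_a.comp hi).add (D.continuous_W_da.comp hi)).intervalIntegrable _ _
  -- The integrand of `∂_ε 𝒜 - ∂_τ c` is exact: it is the derivative in `s` of `[intA, intB] -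
  -- W(at')`.
  have h2 : ∫ s in (0 : ℝ)..1, ((D.dεW (τ, ε) s (D.bE (τ, ε) s) + D.W (τ, ε) s (D.dεb (τ, ε) s)) -
      (D.dτW (τ, ε) s (D.a τ s) + D.W (τ, ε) s (D.da τ s))) =
      (D.br (D.intA (τ, ε) 1) (D.intB (τ, ε) 1) - D.W (τ, ε) 1 (D.at' τ 1)) -
      (D.br (D.intA (τ, ε) 0) (D.intB (τ, ε) 0) - D.W (τ, ε) 0 (D.at' τ 0)) := by
    refine intervalIntegral.integral_eq_sub_of_hasDeriv_right_of_le zero_le_one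
      (f := fun s => D.br (D.intA (τ, ε) s) (D.intB (τ, ε) s) - D.W (τ, ε) s (D.at' τ s)) ?_ ?_ ?_
    · exact Continuous.continuousOn
        ((((D.br.continuous.comp D.continuous_intA).clm_apply D.continuous_intB).sub
          (D.continuous_W.clm_apply D.continuous_at')).comp hi)
    · intro s hs
      have hs' := Ioo_subset_Icc_self hs
      have h3 : HasDerivAt (fun s => D.br (D.intA (τ, ε) s) (D.intB (τ, ε) s) -
          D.W (τ, ε) s (D.at' τ s)) _ s :=
        ((D.br.hasFDerivAt.comp_hasDerivAt s (D.hasDerivAt_intA (τ, ε) s)).clm_apply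
          (D.hasDerivAt_intB (τ, ε) s)).sub
        ((D.hasDerivAt_W (τ, ε) s).clm_apply ((D.hasDeriv_at τ hτ s hs').hasDerivAt
          (Icc_mem_nhds hs.1 hs.2)))
      refine h3.hasDerivWithinAt.congr_deriv ?_
      simp only [dεW, dτW, dεb, neg_apply, sub_apply, ContinuousLinearMap.comp_apply,
        Function.comp_apply, map_neg, map_add, map_sub,
        D.br_skew (D.intB (τ, ε) s) (D.W (τ, ε) s (D.a τ s))]
      abel
    · exact h4.sub h5
  rw [intervalIntegral.integral_sub h4 h5] at h2
  -- Boundary terms: at `σ = 1` both integrals vanish, at `σ = 0` they are `c` and `𝒜`, and `at'` is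
  -- zero at both ends.
  rw [intA_one, intA_zero, intB_zero, D.at_one τ hτ, D.at_zero τ hτ] at h2
  simp only [map_zero, zero_apply, sub_zero, zero_sub] at h2
  rw [dGaugeFunction, sub_eq_add_neg]
  exact eq_add_of_sub_eq' h2

end Derivatives

end SquareData

end Square

/-! ### The centered chart at the identity of a Lie group -/

section LieChart

variable {q : ℕ} {H : Type*} [TopologicalSpace H] [ChartedSpace (EuclideanSpace ℝ (Fin q)) H]

/-- The centered chart at the identity of `H`. -/
def lgChart (q : ℕ) {H : Type*} [TopologicalSpace H] [ChartedSpace (EuclideanSpace ℝ (Fin q)) H]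
    [Group H] (g : H) : EuclideanSpace ℝ (Fin q) :=
  extChartAt (𝓡 q) (1 : H) g - extChartAt (𝓡 q) (1 : H) 1

/-- The inverse of the centered chart at the identity of `H`. -/
def exChart (q : ℕ) (H : Type*) [TopologicalSpace H] [ChartedSpace (EuclideanSpace ℝ (Fin q)) H]
    [Group H] (x : EuclideanSpace ℝ (Fin q)) : H :=
  (extChartAt (𝓡 q) (1 : H)).symm (extChartAt (𝓡 q) (1 : H) 1 + x)

/-- Elements of the chart domain at `1` with coordinates of norm less than `r`. -/
def nearOne (q : ℕ) (H : Type*) [TopologicalSpace H] [ChartedSpace (EuclideanSpace ℝ (Fin q)) H] [Group H]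
    (r : ℝ) : Set H :=
  {g | g ∈ (extChartAt (𝓡 q) (1 : H)).source ∧ ‖lgChart q g‖ < r}

variable [Group H]

@[simp]
theorem lgChart_one : lgChart q (1 : H) = 0 := sub_self _

@[simp]
theorem exChart_zero : exChart q H 0 = 1 := by
  rw [exChart, add_zero]; exact extChartAt_to_inv (I := 𝓡 q) (1 : H)

theorem exChart_lgChart {g : H} (hg : g ∈ (extChartAt (𝓡 q) (1 : H)).source) :
    exChart q H (lgChart q g) = g := by
  rw [exChart, lgChart, add_sub_cancel]
  exact (extChartAt (𝓡 q) (1 : H)).left_inv hg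

theorem tendsto_add_chart_one (x : EuclideanSpace ℝ (Fin q)) :
    ContinuousAt (fun x => extChartAt (𝓡 q) (1 : H) 1 + x) x := by fun_prop

theorem eventually_add_mem_target :
    ∀ᶠ x in 𝓝 (0 : EuclideanSpace ℝ (Fin q)),
      extChartAt (𝓡 q) (1 : H) 1 + x ∈ (extChartAt (𝓡 q) (1 : H)).target := by
  refine (tendsto_add_chart_one (H := H) 0).eventually ?_
  simp only [add_zero]
  exact extChartAt_target_mem_nhds (I := 𝓡 q) (1 : H)

theorem eventually_lgChart_exChart :
    ∀ᶠ x in 𝓝 (0 : EuclideanSpace ℝ (Fin q)), lgChart q (exChart q H x) = x := by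
  filter_upwards [eventually_add_mem_target (H := H)] with x hx
  rw [lgChart, exChart, (extChartAt (𝓡 q) (1 : H)).right_inv hx, add_sub_cancel_left]

theorem source_mem_nhds_one : (extChartAt (𝓡 q) (1 : H)).source ∈ 𝓝 (1 : H) :=
  extChartAt_source_mem_nhds (I := 𝓡 q) (1 : H)

theorem continuousOn_lgChart :
    ContinuousOn (lgChart q (H := H)) (extChartAt (𝓡 q) (1 : H)).source :=
  (continuousOn_extChartAt (I := 𝓡 q) (1 : H)).sub continuousOn_const

theorem eventually_continuousAt_exChart :
    ∀ᶠ x in 𝓝 (0 : EuclideanSpace ℝ (Fin q)), ContinuousAt (exChart q H) x := by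
  filter_upwards [eventually_add_mem_target (H := H)] with x hx
  exact ContinuousAt.comp (f := fun x => extChartAt (𝓡 q) (1 : H) 1 + x)
    (continuousAt_extChartAt_symm'' (I := 𝓡 q) hx) (tendsto_add_chart_one (H := H) x)

theorem continuousAt_exChart : ContinuousAt (exChart q H) 0 :=
  (eventually_continuousAt_exChart (H := H)).self_of_nhds

theorem isOpen_nearOne (r : ℝ) : IsOpen (nearOne q H r) := by
  have := (continuousOn_lgChart (q := q) (H := H)).norm.isOpen_inter_preimage
    (isOpen_extChartAt_source (I := 𝓡 q) (1 : H)) (isOpen_Iio (a := r))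
  exact this

theorem nearOne_mem_nhds {r : ℝ} (hr : 0 < r) : nearOne q H r ∈ 𝓝 (1 : H) :=
  (isOpen_nearOne r).mem_nhds ⟨mem_extChartAt_source (I := 𝓡 q) (1 : H), by simpa using hr⟩

theorem eventually_nearOne_subset {U : Set H} (hU : U ∈ 𝓝 (1 : H)) :
    ∃ r > 0, nearOne q H r ⊆ U := by
  have h : ∀ᶠ x in 𝓝 (0 : EuclideanSpace ℝ (Fin q)), exChart q H x ∈ U := by
    refine (continuousAt_exChart (H := H)).eventually ?_
    rw [exChart_zero]; exact hU
  obtain ⟨r, hr, h⟩ := Metric.eventually_nhds_iff.1 h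
  refine ⟨r, hr, fun g hg => ?_⟩
  rw [← exChart_lgChart hg.1]
  exact h (by simpa using hg.2)

theorem tendsto_one_iff (q : ℕ) {H : Type*} [TopologicalSpace H]
    [ChartedSpace (EuclideanSpace ℝ (Fin q)) H] [Group H] {ι : Type*} {l : Filter ι} {f : ι → H} :
    Tendsto f l (𝓝 1) ↔ ∀ r > 0, ∀ᶠ i in l, f i ∈ nearOne q H r := by
  constructor
  · exact fun h r hr => h.eventually (nearOne_mem_nhds hr)
  · intro h U hU
    obtain ⟨r, hr, hrU⟩ := eventually_nearOne_subset (q := q) hU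
    exact (h r hr).mono fun i hi => hrU hi

theorem nearOne_mono {r r' : ℝ} (h : r ≤ r') : nearOne q H r ⊆ nearOne q H r' :=
  fun _ hg => ⟨hg.1, hg.2.trans_le h⟩

/-- Closed balls in the chart at `1` are closed in `H`. -/
theorem exists_isClosed_nearOne (H : Type*) [TopologicalSpace H]
    [ChartedSpace (EuclideanSpace ℝ (Fin q)) H] [Group H] [T2Space H] :
    ∃ r₀ > 0, ∀ r < r₀, IsClosed {g : H | g ∈ (extChartAt (𝓡 q) (1 : H)).source ∧
      ‖lgChart q g‖ ≤ r} := by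
  have h := (eventually_continuousAt_exChart (q := q) (H := H)).and ((eventually_add_mem_target (H := H)).and
    (eventually_lgChart_exChart (H := H)))
  obtain ⟨r₀, hr₀, h⟩ := Metric.eventually_nhds_iff.1 h
  refine ⟨r₀, hr₀, fun r hr => ?_⟩
  -- The set is the image of a compact ball under the inverse chart, and compact sets in the
  -- Hausdorff space `H` are closed.
  have hc : IsCompact (exChart q H '' Metric.closedBall 0 r) := by
    refine (isCompact_closedBall _ _).image_of_continuousOn fun x hx => ?_
    exact (h ((Metric.mem_closedBall.1 hx).trans_lt hr)).1.continuousWithinAt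
  convert hc.isClosed using 1
  ext g
  constructor
  · rintro ⟨hg, hgr⟩
    exact ⟨lgChart q g, by simpa using hgr, exChart_lgChart hg⟩
  · rintro ⟨x, hx, rfl⟩
    have h' := h ((Metric.mem_closedBall.1 hx).trans_lt hr)
    refine ⟨(extChartAt (𝓡 q) (1 : H)).map_target h'.2.1, ?_⟩
    rw [h'.2.2]; simpa using hx

variable (q H) in
/-- The map `(x, z, y) ↦ x⁻¹ z y` in the centered chart at `1`. -/
def conjMap (x : EuclideanSpace ℝ (Fin q) × EuclideanSpace ℝ (Fin q) × EuclideanSpace ℝ (Fin q)) :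
    EuclideanSpace ℝ (Fin q) :=
  lgChart q ((exChart q H x.1)⁻¹ * exChart q H x.2.1 * exChart q H x.2.2)

theorem contMDiffAt_lgChart : ContMDiffAt (𝓡 q) 𝓘(ℝ, EuclideanSpace ℝ (Fin q)) ∞
    (lgChart q (H := H)) 1 :=
  (contMDiffAt_extChartAt (I := 𝓡 q) (n := ∞) (x := (1 : H))).sub contMDiffAt_const

/-! ### Logarithmic derivatives -/

/-- `ξ` is the left logarithmic derivative `w⁻¹ w'` at `τ` of a curve `w` in `H`. -/
def HasLogDerivWithinAt (w : ℝ → H) (ξ : EuclideanSpace ℝ (Fin q)) (s : Set ℝ) (τ : ℝ) : Prop :=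
  ContinuousWithinAt w s τ ∧ HasDerivWithinAt (fun t => lgChart q ((w τ)⁻¹ * w t)) ξ s τ

/-- The tangent space at `1` is identified with the model space through the preferred chart at `1`,
which is the chart of `lgChart`; the centering only subtracts a constant. -/
theorem hasMFDerivWithinAt_one_iff {v : ℝ → H} {s : Set ℝ} {τ : ℝ} (hv : v τ = 1)
    {ξ : EuclideanSpace ℝ (Fin q)} :
    HasMFDerivWithinAt 𝓘(ℝ, ℝ) (𝓡 q) v s τ
      ((1 : ℝ →L[ℝ] ℝ).smulRight ξ : ℝ →L[ℝ] EuclideanSpace ℝ (Fin q)) ↔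
    ContinuousWithinAt v s τ ∧ HasDerivWithinAt (fun t => lgChart q (v t)) ξ s τ := by
  rw [hasDerivWithinAt_iff_hasFDerivWithinAt]
  refine and_congr_right fun _ => ?_
  have h1 : writtenInExtChartAt 𝓘(ℝ, ℝ) (𝓡 q) τ v = fun t => extChartAt (𝓡 q) (v τ) (v t) := rfl
  have h2 : (extChartAt 𝓘(ℝ, ℝ) τ).symm ⁻¹' s ∩ range 𝓘(ℝ, ℝ) = s := by
    change s ∩ range (fun x : ℝ => x) = s
    simp
  have h3 : extChartAt 𝓘(ℝ, ℝ) τ τ = τ := rfl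
  change HasFDerivWithinAt (writtenInExtChartAt 𝓘(ℝ, ℝ) (𝓡 q) τ v)
    ((1 : ℝ →L[ℝ] ℝ).smulRight ξ : ℝ →L[ℝ] EuclideanSpace ℝ (Fin q))
    ((extChartAt 𝓘(ℝ, ℝ) τ).symm ⁻¹' s ∩ range 𝓘(ℝ, ℝ)) (extChartAt 𝓘(ℝ, ℝ) τ τ) ↔ _
  rw [h1, h2, h3, hv]
  exact (hasFDerivWithinAt_sub_const_iff _).symm

variable [LieGroup (𝓡 q) ∞ H]

theorem contMDiffAt_exChart : ContMDiffAt 𝓘(ℝ, EuclideanSpace ℝ (Fin q)) (𝓡 q) ∞ (exChart q H) 0 := by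
  have h1 : ContMDiffAt 𝓘(ℝ, EuclideanSpace ℝ (Fin q)) (𝓡 q) ∞ (extChartAt (𝓡 q) (1 : H)).symm
      (extChartAt (𝓡 q) (1 : H) 1 + 0) := by
    rw [add_zero]
    exact (contMDiffOn_extChartAt_symm (I := 𝓡 q) (n := ∞) (1 : H)).contMDiffAt
      (extChartAt_target_mem_nhds (I := 𝓡 q) (1 : H))
  have h2 : ContMDiffAt 𝓘(ℝ, EuclideanSpace ℝ (Fin q)) 𝓘(ℝ, EuclideanSpace ℝ (Fin q)) ∞
      (fun x => extChartAt (𝓡 q) (1 : H) 1 + x) 0 :=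
    (contDiff_const.add contDiff_id).contDiffAt.contMDiffAt
  exact h1.comp (x := (0 : EuclideanSpace ℝ (Fin q))) h2

theorem contDiffAt_conjMap : ContDiffAt ℝ ∞ (conjMap q H) 0 := by
  rw [← contMDiffAt_iff_contDiffAt]
  have h0 : ∀ ℓ : EuclideanSpace ℝ (Fin q) × EuclideanSpace ℝ (Fin q) × EuclideanSpace ℝ (Fin q)
      →L[ℝ] EuclideanSpace ℝ (Fin q), ContMDiffAt 𝓘(ℝ, EuclideanSpace ℝ (Fin q) ×
      EuclideanSpace ℝ (Fin q) × EuclideanSpace ℝ (Fin q)) (𝓡 q) ∞ (exChart q H ∘ ℓ) 0 := by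
    intro ℓ
    refine ContMDiffAt.comp (I' := 𝓘(ℝ, EuclideanSpace ℝ (Fin q))) _ ?_
      ℓ.contDiff.contDiffAt.contMDiffAt
    rw [map_zero]
    exact contMDiffAt_exChart
  have h1 := h0 (.fst ℝ _ _)
  have h2 := h0 (.fst ℝ _ _ ∘L .snd ℝ _ _)
  have h3 := h0 (.snd ℝ _ _ ∘L .snd ℝ _ _)
  have h4 := (h1.inv.mul h2).mul h3
  refine ContMDiffAt.comp (I' := 𝓡 q) (x := (0 : EuclideanSpace ℝ (Fin q) ×
    EuclideanSpace ℝ (Fin q) × EuclideanSpace ℝ (Fin q))) (g := lgChart q (H := H)) ?_ h4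
  simpa using contMDiffAt_lgChart (q := q) (H := H)

variable (q) in
/-- The derivative at `y` of left multiplication by `g`. -/
def mulLeftDeriv (g y : H) : EuclideanSpace ℝ (Fin q) →L[ℝ] EuclideanSpace ℝ (Fin q) :=
  mfderiv (𝓡 q) (𝓡 q) (fun x => g * x) y

theorem hasMFDerivAt_mul_left (g y : H) :
    HasMFDerivAt (𝓡 q) (𝓡 q) (fun x => g * x) y (mulLeftDeriv q g y) := by
  have hn : (∞ : WithTop ℕ∞) ≠ 0 := by simp
  exact ((contMDiff_mul_left (I := 𝓡 q) (n := ∞) (a := g)).contMDiffAt.mdifferentiableAt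
    hn).hasMFDerivAt

theorem mulLeftDeriv_inv_apply (g : H) (x : EuclideanSpace ℝ (Fin q)) :
    mulLeftDeriv q g⁻¹ g (mulLeftDeriv q g 1 x) = x := by
  have h1 : HasMFDerivAt (𝓡 q) (𝓡 q) ((fun x => g⁻¹ * x) ∘ (fun x => g * x)) (1 : H)
      (mulLeftDeriv q g⁻¹ (g * 1) ∘L mulLeftDeriv q g 1) :=
    (hasMFDerivAt_mul_left g⁻¹ (g * 1)).comp (1 : H) (hasMFDerivAt_mul_left g 1)
  have h2 : (fun x => g⁻¹ * x) ∘ (fun x => g * x) = (id : H → H) := by ext; simp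
  rw [h2, mul_one] at h1
  exact DFunLike.congr_fun (hasMFDerivAt_unique h1 (hasMFDerivAt_id (I := 𝓡 q) (1 : H))) x

theorem HasMFDerivWithinAt.mul_left_smulRight {w : ℝ → H} {s : Set ℝ} {τ : ℝ}
    {ξ : EuclideanSpace ℝ (Fin q)} (h : HasMFDerivWithinAt 𝓘(ℝ, ℝ) (𝓡 q) w s τ
      ((1 : ℝ →L[ℝ] ℝ).smulRight ξ : ℝ →L[ℝ] EuclideanSpace ℝ (Fin q))) (g : H) :
    HasMFDerivWithinAt 𝓘(ℝ, ℝ) (𝓡 q) (fun t => g * w t) s τ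
      ((1 : ℝ →L[ℝ] ℝ).smulRight (mulLeftDeriv q g (w τ) ξ) :
        ℝ →L[ℝ] EuclideanSpace ℝ (Fin q)) := by
  have h1 : HasMFDerivWithinAt 𝓘(ℝ, ℝ) (𝓡 q) (fun t => g * w t) s τ
      (mulLeftDeriv q g (w τ) ∘L ((1 : ℝ →L[ℝ] ℝ).smulRight ξ) :
        ℝ →L[ℝ] EuclideanSpace ℝ (Fin q)) :=
    (hasMFDerivAt_mul_left g (w τ)).comp_hasMFDerivWithinAt τ h
  have h2 : mulLeftDeriv q g (w τ) ∘L ((1 : ℝ →L[ℝ] ℝ).smulRight ξ) =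
      (1 : ℝ →L[ℝ] ℝ).smulRight (mulLeftDeriv q g (w τ) ξ) := by
    ext; simp
  rwa [h2] at h1

/-- The differential equation `w' = w · ξ` in terms of left invariant vector fields. -/
theorem hasMFDerivWithinAt_iff_hasLogDerivWithinAt {w : ℝ → H} {s : Set ℝ} {τ : ℝ}
    {ξ : EuclideanSpace ℝ (Fin q)} :
    HasMFDerivWithinAt 𝓘(ℝ, ℝ) (𝓡 q) w s τ
      ((1 : ℝ →L[ℝ] ℝ).smulRight (mulLeftDeriv q (w τ) 1 ξ) :
        ℝ →L[ℝ] EuclideanSpace ℝ (Fin q)) ↔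
    HasLogDerivWithinAt w ξ s τ := by
  have := topologicalGroup_of_lieGroup (𝓡 q) ∞ (G := H)
  constructor
  · intro h
    have h1 := h.mul_left_smulRight (w τ)⁻¹
    rw [mulLeftDeriv_inv_apply] at h1
    exact ⟨h.1, ((hasMFDerivWithinAt_one_iff (v := fun t => (w τ)⁻¹ * w t)
      (inv_mul_cancel _)).1 h1).2⟩
  · rintro ⟨h0, h⟩
    have h1 := ((hasMFDerivWithinAt_one_iff (v := fun t => (w τ)⁻¹ * w t)
      (inv_mul_cancel _)).2 ⟨continuousWithinAt_const.mul h0, h⟩).mul_left_smulRight (w τ)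
    have h2 : (fun t => w τ * ((w τ)⁻¹ * w t)) = w := by ext; simp
    rwa [h2, inv_mul_cancel] at h1

/-- `IsPathOrderedExp` in terms of logarithmic derivatives. -/
theorem isPathOrderedExp_iff {x : ℝ → EuclideanSpace ℝ (Fin q)} {h : H} :
    IsPathOrderedExp (H := H) x h ↔ ∃ w : ℝ → H, w 0 = 1 ∧ w 1 = h ∧
      ∀ τ ∈ Icc (0 : ℝ) 1, HasLogDerivWithinAt w (x τ) (Icc 0 1) τ := by
  refine exists_congr fun w => and_congr_right fun _ => and_congr_right fun _ =>
    forall₂_congr fun τ _ => ?_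
  rw [← hasMFDerivWithinAt_iff_hasLogDerivWithinAt]
  rfl

end LieChart

/-! ### Local calculus of the map `(x, z, y) ↦ x⁻¹ z y` -/

section LocalConj

theorem two_le_smooth : (2 : WithTop ℕ∞) ≤ ∞ := by
  change ((2 : ℕ∞) : WithTop ℕ∞) ≤ ((⊤ : ℕ∞) : WithTop ℕ∞)
  exact WithTop.coe_le_coe.2 le_top

variable {E : Type*} [NormedAddCommGroup E] [NormedSpace ℝ E]

/-- The second derivative of a composition with a linear map. -/
theorem fderiv_fderiv_comp_clm {F E' : Type*} [NormedAddCommGroup F] [NormedSpace ℝ F]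
    [NormedAddCommGroup E'] [NormedSpace ℝ E'] {Ψ : E' → E} (h : ContDiffAt ℝ ∞ Ψ 0)
    (ℓ : F →L[ℝ] E') (u v : F) :
    fderiv ℝ (fderiv ℝ (fun x => Ψ (ℓ x))) 0 u v = fderiv ℝ (fderiv ℝ Ψ) 0 (ℓ u) (ℓ v) := by
  have h2 : ContDiffAt ℝ 2 Ψ 0 := h.of_le two_le_smooth
  have hev : ∀ᶠ x in 𝓝 (0 : F), DifferentiableAt ℝ Ψ (ℓ x) := by
    have h3 : ∀ᶠ y in 𝓝 (ℓ 0), DifferentiableAt ℝ Ψ y := by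
      rw [map_zero]
      exact (h2.eventually (by simp)).mono fun y hy => hy.differentiableAt (by simp)
    exact ℓ.continuous.continuousAt.eventually h3
  have h4 : fderiv ℝ (fun x => Ψ (ℓ x)) =ᶠ[𝓝 0]
      fun x => (ContinuousLinearMap.compL ℝ F E' E).flip ℓ (fderiv ℝ Ψ (ℓ x)) := by
    filter_upwards [hev] with x hx
    exact (hx.hasFDerivAt.comp x ℓ.hasFDerivAt).fderiv
  rw [h4.fderiv_eq]
  have h5 : HasFDerivAt (fderiv ℝ Ψ) (fderiv ℝ (fderiv ℝ Ψ) 0) (ℓ 0) := by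
    rw [map_zero]
    exact ((h2.fderiv_right (m := 1) (by norm_num)).differentiableAt (by simp)).hasFDerivAt
  have h6 := (((ContinuousLinearMap.compL ℝ F E' E).flip ℓ).hasFDerivAt.comp (0 : F)
    (h5.comp (0 : F) ℓ.hasFDerivAt)).fderiv
  exact DFunLike.congr_fun (DFunLike.congr_fun h6 u) v

/-- The properties of the map `(x, z, y) ↦ x⁻¹ z y` in a chart of a Lie group centered at `1`. -/
structure IsLocalConj (Ψ : E × E × E → E) : Prop where
  contDiffAt : ContDiffAt ℝ ∞ Ψ 0
  mid : ∀ᶠ z in 𝓝 (0 : E), Ψ (0, z, 0) = z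
  cancel : ∀ᶠ x in 𝓝 (0 : E × E), Ψ (x.1, x.1, x.2) = x.2
  shift : ∀ᶠ x in 𝓝 (0 : E × E), Ψ (x.1, 0, x.2) = Ψ (x.1, x.2, 0)
  rightInv : ∀ᶠ x in 𝓝 (0 : E × E), Ψ (x.1, Ψ (0, x.1, x.2), 0) = x.2

/-- Left invariant vector fields in the chart. -/
def leftField (Ψ : E × E × E → E) (z : E) : E →L[ℝ] E :=
  fderiv ℝ Ψ (0, z, 0) ∘L (.inr ℝ E (E × E) ∘L .inr ℝ E E)

/-- Right invariant vector fields in the chart. -/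
def rightField (Ψ : E × E × E → E) (z : E) : E →L[ℝ] E :=
  -(fderiv ℝ Ψ (0, z, 0) ∘L .inl ℝ E (E × E))

/-- The Lie bracket, as the linearization of the difference of left and right invariant vector
fields. -/
def localBracket (Ψ : E × E × E → E) : E →L[ℝ] E →L[ℝ] E :=
  fderiv ℝ (fun z => leftField Ψ z - rightField Ψ z) 0

namespace IsLocalConj

variable {Ψ : E × E × E → E} (h : IsLocalConj Ψ)
include h

theorem hasFDerivAt_fderiv : HasFDerivAt (fderiv ℝ Ψ) (fderiv ℝ (fderiv ℝ Ψ) 0) 0 :=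
  ((h.contDiffAt.fderiv_right (m := 1) (by exact two_le_smooth)).differentiableAt
    (by simp)).hasFDerivAt

theorem eventually_contDiffAt : ∀ᶠ x in 𝓝 (0 : E × E × E), ContDiffAt ℝ 2 Ψ x :=
  (h.contDiffAt.of_le (m := 2) two_le_smooth).eventually (by simp)

theorem eventually_hasFDerivAt {F : Type*} [NormedAddCommGroup F] [NormedSpace ℝ F]
    (ℓ : F →L[ℝ] E × E × E) :
    ∀ᶠ x in 𝓝 (0 : F), HasFDerivAt Ψ (fderiv ℝ Ψ (ℓ x)) (ℓ x) := by
  have h3 : ∀ᶠ y in 𝓝 (ℓ 0), HasFDerivAt Ψ (fderiv ℝ Ψ y) y := by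
    rw [map_zero]
    exact h.eventually_contDiffAt.mono fun y hy => (hy.differentiableAt (by simp)).hasFDerivAt
  exact ℓ.continuous.continuousAt.eventually h3

theorem apply_zero : Ψ 0 = 0 := h.mid.self_of_nhds

/-- The rules `mid` and `cancel` give the derivative on `(0, w, 0)` and on `(u, u, v)`, and these
vectors span. -/
theorem fderiv_zero_apply (u w v : E) : fderiv ℝ Ψ 0 (u, w, v) = w + v - u := by
  have hd : HasFDerivAt Ψ (fderiv ℝ Ψ 0) 0 :=
    (h.contDiffAt.differentiableAt (by simp)).hasFDerivAt
  -- the middle variable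
  have h1 : ∀ w, fderiv ℝ Ψ 0 (0, w, 0) = w := by
    have e : HasFDerivAt (fun z : E => Ψ (0, z, 0))
        (fderiv ℝ Ψ 0 ∘L (.inr ℝ E (E × E) ∘L .inl ℝ E E)) 0 :=
      HasFDerivAt.comp (0 : E) (f := (.inr ℝ E (E × E) ∘L .inl ℝ E E : E →L[ℝ] E × E × E))
        hd (ContinuousLinearMap.hasFDerivAt _)
    have e2 : HasFDerivAt (fun z : E => Ψ (0, z, 0)) (.id ℝ E) 0 :=
      (hasFDerivAt_id (0 : E)).congr_of_eventuallyEq h.mid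
    exact fun w => DFunLike.congr_fun (e.unique e2) w
  have h2 : ∀ x y, fderiv ℝ Ψ 0 (x, x, y) = y := by
    let ℓ : E × E →L[ℝ] E × E × E := (ContinuousLinearMap.fst ℝ E E).prod
      ((ContinuousLinearMap.fst ℝ E E).prod (.snd ℝ E E))
    have e : HasFDerivAt (fun z : E × E => Ψ (z.1, z.1, z.2)) (fderiv ℝ Ψ 0 ∘L ℓ) 0 :=
      HasFDerivAt.comp (0 : E × E) (f := ℓ) (by rw [map_zero]; exact hd) ℓ.hasFDerivAt
    have e2 : HasFDerivAt (fun z : E × E => Ψ (z.1, z.1, z.2)) (.snd ℝ E E) 0 :=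
      (hasFDerivAt_snd (p := (0 : E × E))).congr_of_eventuallyEq h.cancel
    exact fun x y => DFunLike.congr_fun (e.unique e2) (x, y)
  have h3 : ((u, w, v) : E × E × E) = (u, u, v) + ((0, w, 0) - (0, u, 0)) := by simp
  rw [h3, map_add, map_sub, h1, h1, h2]; abel

theorem hasStrictFDerivAt : HasStrictFDerivAt Ψ (fderiv ℝ Ψ 0) 0 :=
  h.contDiffAt.hasStrictFDerivAt (by simp)

theorem leftField_zero : leftField Ψ 0 = .id ℝ E := by
  ext x
  change fderiv ℝ Ψ 0 (0, 0, x) = x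
  rw [h.fderiv_zero_apply]; simp

theorem rightField_zero : rightField Ψ 0 = .id ℝ E := by
  ext x
  change -fderiv ℝ Ψ 0 (x, 0, 0) = x
  rw [h.fderiv_zero_apply]; simp

theorem hasFDerivAt_fderiv_mid :
    HasFDerivAt (fun z : E => fderiv ℝ Ψ (0, z, 0))
      (fderiv ℝ (fderiv ℝ Ψ) 0 ∘L (.inr ℝ E (E × E) ∘L .inl ℝ E E)) 0 :=
  HasFDerivAt.comp (0 : E) (f := (.inr ℝ E (E × E) ∘L .inl ℝ E E : E →L[ℝ] E × E × E))
    h.hasFDerivAt_fderiv (ContinuousLinearMap.hasFDerivAt _)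

theorem hasFDerivAt_leftField : HasFDerivAt (leftField Ψ)
    ((ContinuousLinearMap.compL ℝ E (E × E × E) E).flip (.inr ℝ E (E × E) ∘L .inr ℝ E E) ∘L
      (fderiv ℝ (fderiv ℝ Ψ) 0 ∘L (.inr ℝ E (E × E) ∘L .inl ℝ E E))) 0 :=
  (((ContinuousLinearMap.compL ℝ E (E × E × E) E).flip
    (.inr ℝ E (E × E) ∘L .inr ℝ E E)).hasFDerivAt).comp (0 : E) h.hasFDerivAt_fderiv_mid

theorem hasFDerivAt_rightField : HasFDerivAt (rightField Ψ)
    (-((ContinuousLinearMap.compL ℝ E (E × E × E) E).flip (.inl ℝ E (E × E)) ∘L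
      (fderiv ℝ (fderiv ℝ Ψ) 0 ∘L (.inr ℝ E (E × E) ∘L .inl ℝ E E)))) 0 :=
  ((((ContinuousLinearMap.compL ℝ E (E × E × E) E).flip
    (.inl ℝ E (E × E))).hasFDerivAt).comp (0 : E) h.hasFDerivAt_fderiv_mid).neg

theorem hasFDerivAt_left_sub_right :
    HasFDerivAt (fun z => leftField Ψ z - rightField Ψ z) (localBracket Ψ) 0 :=
  (h.hasFDerivAt_leftField.sub h.hasFDerivAt_rightField).differentiableAt.hasFDerivAt

/-- Let `D2` be the second derivative of `Ψ` at `0`. Differentiating `x⁻¹ x y = y` twice gives `D2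
(u, u, 0) (0, 0, v) = 0`, and differentiating `x⁻¹ 1 y = x⁻¹ y 1` gives `D2 (u, 0, 0) (0, 0, v) = D2
(u, 0, 0) (0, v, 0)`. With the symmetry of `D2`, the derivative of the right invariant field is that
of the left invariant field with its arguments exchanged. -/
theorem localBracket_apply (x y : E) :
    localBracket Ψ x y = fderiv ℝ (leftField Ψ) 0 x y - fderiv ℝ (leftField Ψ) 0 y x := by
  let D2 := fderiv ℝ (fderiv ℝ Ψ) 0
  have hsymm : ∀ u v, D2 u v = D2 v u := fun u v =>
    (h.contDiffAt.isSymmSndFDerivAt (by simpa using two_le_smooth)).eq u v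
  have h1 : ∀ u v, fderiv ℝ (leftField Ψ) 0 u v = D2 (0, u, 0) (0, 0, v) := fun u v => by
    rw [h.hasFDerivAt_leftField.fderiv]; rfl
  have h2 : localBracket Ψ x y = D2 (0, x, 0) (0, 0, y) - -D2 (0, x, 0) (y, 0, 0) := by
    have e : localBracket Ψ = _ := (h.hasFDerivAt_leftField.sub h.hasFDerivAt_rightField).fderiv
    rw [e]; rfl
  have h3 : ∀ u v : E, D2 (u, u, 0) (0, 0, v) = 0 := by
    intro u v
    let ℓ : E × E →L[ℝ] E × E × E := (ContinuousLinearMap.fst ℝ E E).prod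
      ((ContinuousLinearMap.fst ℝ E E).prod (.snd ℝ E E))
    have e : (fun z => Ψ (ℓ z)) =ᶠ[𝓝 0] fun z : E × E => z.2 := h.cancel
    have e2 := fderiv_fderiv_comp_clm h.contDiffAt ℓ (u, 0) (0, v)
    have e3 : fderiv ℝ (fun z => Ψ (ℓ z)) =ᶠ[𝓝 0] fun _ => ContinuousLinearMap.snd ℝ E E := by
      filter_upwards [e.fderiv (𝕜 := ℝ)] with z hz
      rw [hz]; exact fderiv_snd
    rw [e3.fderiv_eq] at e2
    simpa [ℓ] using e2.symm
  have h4 : ∀ u v : E, D2 (u, 0, 0) (0, 0, v) = D2 (u, 0, 0) (0, v, 0) := by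
    intro u v
    let ℓ : E × E →L[ℝ] E × E × E := (ContinuousLinearMap.fst ℝ E E).prod
      ((0 : E × E →L[ℝ] E).prod (ContinuousLinearMap.snd ℝ E E))
    let ℓ' : E × E →L[ℝ] E × E × E := (ContinuousLinearMap.fst ℝ E E).prod
      ((ContinuousLinearMap.snd ℝ E E).prod 0)
    have e : (fun z => Ψ (ℓ z)) =ᶠ[𝓝 0] fun z : E × E => Ψ (ℓ' z) := h.shift
    have e2 := fderiv_fderiv_comp_clm h.contDiffAt ℓ (u, 0) (0, v)
    have e3 := fderiv_fderiv_comp_clm h.contDiffAt ℓ' (u, 0) (0, v)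
    rw [(e.fderiv (𝕜 := ℝ)).fderiv_eq, e3] at e2
    simpa [ℓ, ℓ'] using e2.symm
  have h5 : D2 (y, 0, 0) (0, 0, x) = -D2 (0, y, 0) (0, 0, x) := by
    have e : ((y, y, 0) : E × E × E) = (y, 0, 0) + (0, y, 0) := by simp
    have e2 := h3 y x
    rw [e, map_add, add_apply] at e2
    exact eq_neg_of_add_eq_zero_left e2
  rw [h2, h1, h1, hsymm (0, x, 0) (y, 0, 0), ← h4, h5]; abel

theorem eventually_hasFDerivAt_right : ∀ᶠ z in 𝓝 (0 : E),
    HasFDerivAt (fun y => Ψ (0, z, y)) (leftField Ψ z) 0 := by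
  filter_upwards [h.eventually_hasFDerivAt (.inr ℝ E (E × E) ∘L .inl ℝ E E)] with z hz
  have a2 : HasFDerivAt Ψ (fderiv ℝ Ψ (0, z, 0)) (0, z, 0) := hz
  exact HasFDerivAt.comp (f := fun y : E => ((0 : E), z, y)) 0 a2
      (((hasFDerivAt_const (0 : E) (0 : E)).prodMk
        ((hasFDerivAt_const z (0 : E)).prodMk (hasFDerivAt_id (0 : E)))).congr_fderiv
        (by ext <;> simp))

/-- The logarithmic derivative of the curve with velocity `leftField Ψ z c` is `c`. -/
theorem eventually_fderiv_leftField : ∀ᶠ z in 𝓝 (0 : E),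
    HasFDerivAt (fun y => Ψ (z, y, 0)) (fderiv ℝ Ψ (z, z, 0) ∘L (.inr ℝ E (E × E) ∘L .inl ℝ E E)) z ∧
    ∀ c, fderiv ℝ Ψ (z, z, 0) (0, leftField Ψ z c, 0) = c := by
  let ℓ : E →L[ℝ] E × E × E := (ContinuousLinearMap.id ℝ E).prod ((ContinuousLinearMap.id ℝ E).prod 0)
  have h1 := h.eventually_hasFDerivAt ℓ
  have h2 := h.eventually_hasFDerivAt_right
  have h3 : ∀ᶠ z in 𝓝 (0 : E), ∀ᶠ x in 𝓝 ((z, 0) : E × E), Ψ (x.1, Ψ (0, x.1, x.2), 0) = x.2 := by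
    have : Continuous fun z : E => (z, (0 : E)) := by fun_prop
    exact this.continuousAt.eventually h.rightInv.eventually_nhds
  filter_upwards [h1, h2, h3, h.mid] with z hz1 hz2 hz3 hz4
  have a1 : HasFDerivAt Ψ (fderiv ℝ Ψ (z, z, 0)) (z, z, 0) := hz1
  have b1 : HasFDerivAt (fun y => Ψ (z, y, 0))
      (fderiv ℝ Ψ (z, z, 0) ∘L (.inr ℝ E (E × E) ∘L .inl ℝ E E)) z :=
    HasFDerivAt.comp (f := fun y : E => (z, y, (0 : E))) z a1
      (((hasFDerivAt_const z z).prodMk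
        ((hasFDerivAt_id z).prodMk (hasFDerivAt_const (0 : E) z))).congr_fderiv (by ext <;> simp))
  refine ⟨b1, fun c => ?_⟩
  -- Multiplication by `z` followed by multiplication by `z⁻¹` is the identity near `0`; comparing
  -- the derivatives given by the chain rule yields the claim.
  have b3 : HasFDerivAt (fun y => Ψ (z, Ψ (0, z, y), 0)) _ 0 :=
    HasFDerivAt.comp (g := fun y => Ψ (z, y, 0)) (f := fun y => Ψ (0, z, y)) (0 : E)
      (by simpa only [hz4] using b1) hz2
  have b4 : HasFDerivAt (fun y => Ψ (z, Ψ (0, z, y), 0)) (.id ℝ E) 0 := by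
    refine (hasFDerivAt_id (0 : E)).congr_of_eventuallyEq ?_
    have : Continuous fun y : E => (z, y) := by fun_prop
    exact this.continuousAt.eventually hz3
  exact DFunLike.congr_fun (b3.unique b4) c

end IsLocalConj

end LocalConj

/-! ### The Lie bracket in the chart at the identity -/

section LieGroupChart

variable {q : ℕ} {H : Type*} [TopologicalSpace H] [ChartedSpace (EuclideanSpace ℝ (Fin q)) H]
  [Group H]

theorem hasMFDerivAt_exChart : HasMFDerivAt 𝓘(ℝ, EuclideanSpace ℝ (Fin q)) (𝓡 q) (exChart q H) 0
    (ContinuousLinearMap.id ℝ (EuclideanSpace ℝ (Fin q)) :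
      EuclideanSpace ℝ (Fin q) →L[ℝ] EuclideanSpace ℝ (Fin q)) := by
  refine ⟨continuousAt_exChart, ?_⟩
  have h1 : HasFDerivAt (fun y : EuclideanSpace ℝ (Fin q) => extChartAt (𝓡 q) (1 : H) 1 + y)
      (ContinuousLinearMap.id ℝ _) 0 := (hasFDerivAt_id _).const_add _
  have h2 := h1.congr_of_eventuallyEq (f₁ := fun y => extChartAt (𝓡 q) (1 : H) (exChart q H y)) (by
    filter_upwards [eventually_add_mem_target (H := H)] with y hy
    exact (extChartAt (𝓡 q) (1 : H)).right_inv hy)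
  have h3 := h2.hasFDerivWithinAt (s := Set.univ)
  simp only [writtenInExtChartAt]
  rw [exChart_zero, ModelWithCorners.range_eq_univ]
  exact h3

theorem tendsto_exChart_nhds_one : Tendsto (exChart q H) (𝓝 0) (𝓝 1) := by
  simpa using (continuousAt_exChart (q := q) (H := H)).tendsto

variable [LieGroup (𝓡 q) ∞ H]

theorem tendsto_exChart_mul :
    Tendsto (fun x : EuclideanSpace ℝ (Fin q) × EuclideanSpace ℝ (Fin q) =>
      exChart q H x.1 * exChart q H x.2) (𝓝 0) (𝓝 1) := by
  have := topologicalGroup_of_lieGroup (𝓡 q) ∞ (G := H)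
  have h := tendsto_exChart_nhds_one (q := q) (H := H)
  simpa using (h.comp (continuous_fst.tendsto (0 : EuclideanSpace ℝ (Fin q) ×
    EuclideanSpace ℝ (Fin q)))).mul (h.comp (continuous_snd.tendsto (0 : EuclideanSpace ℝ (Fin q) ×
    EuclideanSpace ℝ (Fin q))))

variable (q H) in
theorem isLocalConj_conjMap : IsLocalConj (conjMap q H) where
  contDiffAt := contDiffAt_conjMap
  mid := by
    filter_upwards [eventually_lgChart_exChart (q := q) (H := H)] with z hz
    simp [conjMap, hz]
  cancel := by
    have h := (continuous_snd.tendsto (0 : EuclideanSpace ℝ (Fin q) ×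
      EuclideanSpace ℝ (Fin q))).eventually (eventually_lgChart_exChart (q := q) (H := H))
    filter_upwards [h] with z hz
    simp [conjMap, hz]
  shift := Eventually.of_forall fun z => by simp [conjMap]
  rightInv := by
    have h := (continuous_snd.tendsto (0 : EuclideanSpace ℝ (Fin q) ×
      EuclideanSpace ℝ (Fin q))).eventually (eventually_lgChart_exChart (q := q) (H := H))
    have h2 := (tendsto_exChart_mul (q := q) (H := H)).eventually (source_mem_nhds_one (q := q) (H := H))
    filter_upwards [h, h2] with z hz hz2
    simp [conjMap, hz, exChart_lgChart hz2]

variable (q H) in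
/-- The derivative of the inverse of the chart at `1`. -/
def chartSymmDeriv (y : EuclideanSpace ℝ (Fin q)) :
    EuclideanSpace ℝ (Fin q) →L[ℝ] EuclideanSpace ℝ (Fin q) :=
  mfderivWithin 𝓘(ℝ, EuclideanSpace ℝ (Fin q)) (𝓡 q) (extChartAt (𝓡 q) (1 : H)).symm
    (range (𝓡 q)) y

/-- Left invariant vector fields in the chart at `1`. -/
theorem eventually_mulLeftDeriv_eq : ∀ᶠ z in 𝓝 (0 : EuclideanSpace ℝ (Fin q)),
    ∀ c, mulLeftDeriv q (exChart q H z) 1 c =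
      chartSymmDeriv q H (extChartAt (𝓡 q) (1 : H) 1 + z) (leftField (conjMap q H) z c) := by
  have := topologicalGroup_of_lieGroup (𝓡 q) ∞ (G := H)
  have hc := isLocalConj_conjMap q H
  filter_upwards [hc.eventually_hasFDerivAt_right, hc.mid, eventually_add_mem_target (H := H)]
    with z hz1 hz2 hz3
  intro c
  have h1 : HasMFDerivAt 𝓘(ℝ, EuclideanSpace ℝ (Fin q)) (𝓡 q)
      (fun t => exChart q H z * exChart q H t) 0 (mulLeftDeriv q (exChart q H z) 1 ∘L
        (ContinuousLinearMap.id ℝ (EuclideanSpace ℝ (Fin q))) :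
        EuclideanSpace ℝ (Fin q) →L[ℝ] EuclideanSpace ℝ (Fin q)) :=
    HasMFDerivAt.comp (0 : EuclideanSpace ℝ (Fin q)) (g := fun x => exChart q H z * x)
      (by rw [exChart_zero]; exact hasMFDerivAt_mul_left (exChart q H z) 1) hasMFDerivAt_exChart
  have h2 : HasMFDerivAt 𝓘(ℝ, EuclideanSpace ℝ (Fin q)) (𝓡 q) (extChartAt (𝓡 q) (1 : H)).symm
      (extChartAt (𝓡 q) (1 : H) 1 + conjMap q H (0, z, 0))
      (chartSymmDeriv q H (extChartAt (𝓡 q) (1 : H) 1 + z)) := by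
    rw [hz2]
    have h3 := (mdifferentiableWithinAt_extChartAt_symm (I := 𝓡 q) hz3).hasMFDerivWithinAt
    exact h3.hasMFDerivAt (by rw [ModelWithCorners.range_eq_univ]; exact univ_mem)
  have h3 : HasMFDerivAt 𝓘(ℝ, EuclideanSpace ℝ (Fin q)) (𝓡 q)
      ((extChartAt (𝓡 q) (1 : H)).symm ∘
        fun t => extChartAt (𝓡 q) (1 : H) 1 + conjMap q H (0, z, t)) 0
      (chartSymmDeriv q H (extChartAt (𝓡 q) (1 : H) 1 + z) ∘L leftField (conjMap q H) z :
        EuclideanSpace ℝ (Fin q) →L[ℝ] EuclideanSpace ℝ (Fin q)) :=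
    HasMFDerivAt.comp (0 : EuclideanSpace ℝ (Fin q)) h2 (hz1.const_add _).hasMFDerivAt
  have h4 : (fun t => exChart q H z * exChart q H t) =ᶠ[𝓝 0]
      ((extChartAt (𝓡 q) (1 : H)).symm ∘
        fun t => extChartAt (𝓡 q) (1 : H) 1 + conjMap q H (0, z, t)) := by
    have h5 : ContinuousAt (fun t => exChart q H z * exChart q H t) 0 :=
      continuousAt_const.mul continuousAt_exChart
    have h6 : ∀ᶠ t in 𝓝 (0 : EuclideanSpace ℝ (Fin q)),
        exChart q H z * exChart q H t ∈ (extChartAt (𝓡 q) (1 : H)).source := by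
      refine h5.eventually ((isOpen_extChartAt_source (I := 𝓡 q) (1 : H)).mem_nhds ?_)
      simp only [exChart_zero, mul_one]
      exact (extChartAt (𝓡 q) (1 : H)).map_target hz3
    filter_upwards [h6] with t ht
    have h7 := exChart_lgChart ht
    simpa [conjMap, exChart] using h7.symm
  exact DFunLike.congr_fun (hasMFDerivAt_unique h1 (h3.congr_of_eventuallyEq h4)) c

/-- The Lie bracket of the Lie algebra of `H` in the chart at `1`. -/
theorem bracket_eq_localBracket (x y : GroupLieAlgebra (𝓡 q) H) :
    ⁅x, y⁆ = localBracket (conjMap q H) x y := by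
  suffices h : ∀ x y : EuclideanSpace ℝ (Fin q),
      (show EuclideanSpace ℝ (Fin q) from
        Bracket.bracket (L := GroupLieAlgebra (𝓡 q) H) (M := GroupLieAlgebra (𝓡 q) H) x y) =
      localBracket (conjMap q H) x y from h x y
  intro x y
  have hc := isLocalConj_conjMap q H
  let φ : PartialEquiv H (EuclideanSpace ℝ (Fin q)) := extChartAt (𝓡 q) (1 : H)
  -- `V c` is the left invariant field with value `c` at `1`, pulled back to the chart. The bracket
  -- of the Lie algebra is by definition computed from these fields, and near the base point they
  -- are `leftField`.
  let V : EuclideanSpace ℝ (Fin q) → EuclideanSpace ℝ (Fin q) → EuclideanSpace ℝ (Fin q) :=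
    fun c y => (chartSymmDeriv q H y).inverse (mulLeftDeriv q (φ.symm y) 1 c)
  have hV : ∀ c, V c =ᶠ[𝓝 (φ 1)] fun y => leftField (conjMap q H) (y - φ 1) c := by
    intro c
    have h1 : Tendsto (fun y => y - φ 1) (𝓝 (φ 1)) (𝓝 0) := by
      have : ContinuousAt (fun y => y - φ 1) (φ 1) := by fun_prop
      simpa [ContinuousAt] using this
    filter_upwards [h1.eventually (eventually_mulLeftDeriv_eq (q := q) (H := H)),
      extChartAt_target_mem_nhds (I := 𝓡 q) (1 : H)] with y hy hy2
    have h2 := hy c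
    have h3 : φ 1 + (y - φ 1) = y := by abel
    have h4 : exChart q H (y - φ 1) = φ.symm y := by
      change φ.symm (φ 1 + (y - φ 1)) = φ.symm y
      rw [h3]
    rw [h4] at h2
    change _ = chartSymmDeriv q H (φ 1 + (y - φ 1)) _ at h2
    rw [h3] at h2
    have h5 : (chartSymmDeriv q H y).IsInvertible :=
      isInvertible_mfderivWithin_extChartAt_symm (I := 𝓡 q) hy2
    change (chartSymmDeriv q H y).inverse (mulLeftDeriv q (φ.symm y) 1 c) = _
    rw [h5.inverse_apply_eq]
    exact h2
  have hd : ∀ c, HasFDerivAt (fun y => leftField (conjMap q H) (y - φ 1) c)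
      ((fderiv ℝ (leftField (conjMap q H)) 0).flip c) (φ 1) := by
    intro c
    have h1 : HasFDerivAt (leftField (conjMap q H)) (fderiv ℝ (leftField (conjMap q H)) 0)
        (φ 1 - φ 1) := by
      rw [sub_self]; exact hc.hasFDerivAt_leftField.differentiableAt.hasFDerivAt
    have h2 := HasFDerivAt.comp (g := leftField (conjMap q H)) (f := fun y => y - φ 1) (φ 1) h1
      ((hasFDerivAt_id (φ 1)).sub_const (φ 1))
    exact (h2.clm_apply (hasFDerivAt_const c (φ 1))).congr_fderiv (by ext; simp)
  -- `D` is the derivative of the chart at its own base point. Naming it isolates the definitional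
  -- unfolding of the bracket from the fact that `D` is the identity.
  obtain ⟨D, hD, h0⟩ : ∃ D : EuclideanSpace ℝ (Fin q) →L[ℝ] EuclideanSpace ℝ (Fin q),
      D = ContinuousLinearMap.id ℝ (EuclideanSpace ℝ (Fin q)) ∧
      (show EuclideanSpace ℝ (Fin q) from
        Bracket.bracket (L := GroupLieAlgebra (𝓡 q) H) (M := GroupLieAlgebra (𝓡 q) H) x y) = D.inverse (VectorField.lieBracketWithin ℝ (E := EuclideanSpace ℝ (Fin q)) (V x) (V y)
        (φ.symm ⁻¹' univ ∩ range (𝓡 q)) (φ 1)) :=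
    ⟨mfderiv (𝓡 q) 𝓘(ℝ, EuclideanSpace ℝ (Fin q)) φ (1 : H),
      mfderiv_extChartAt_self (I := 𝓡 q) (x := (1 : H)), rfl⟩
  rw [h0, hD, ContinuousLinearMap.inverse_id, preimage_univ, univ_inter,
    ModelWithCorners.range_eq_univ, VectorField.lieBracketWithin_univ,
    (hV x).lieBracket_vectorField_eq (hV y), VectorField.lieBracket, (hd x).fderiv, (hd y).fderiv,
    hc.localBracket_apply]
  simp only [sub_self, hc.leftField_zero]
  rfl

end LieGroupChart

/-! ### Estimates for invariant vector fields near the identity -/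

section LocalConjEstimates

variable {E : Type*} [NormedAddCommGroup E] [NormedSpace ℝ E] {Ψ : E × E × E → E}

/-- The constants for the Grönwall estimates. Both fields are the identity at `0`, so the left field
has norm at most `2` nearby and the difference of the two is of order `‖z‖`. -/
theorem IsLocalConj.exists_bounds (h : IsLocalConj Ψ) : ∃ r > 0, ∃ C ≥ 0, ∀ z : E, ‖z‖ < r →
    HasFDerivAt Ψ (fderiv ℝ Ψ (0, z, 0)) (0, z, 0) ∧ Ψ (0, z, 0) = z ∧
    ‖leftField Ψ z‖ ≤ 2 ∧ ‖leftField Ψ z - .id ℝ E‖ ≤ C * ‖z‖ ∧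
    ‖leftField Ψ z - rightField Ψ z‖ ≤ C * ‖z‖ := by
  obtain ⟨C₁, h1⟩ := h.hasFDerivAt_leftField.isBigO_sub.bound
  obtain ⟨C₂, h2⟩ := h.hasFDerivAt_left_sub_right.isBigO_sub.bound
  have h3 := h.eventually_hasFDerivAt (.inr ℝ E (E × E) ∘L .inl ℝ E E)
  have h4 : ∀ᶠ z in 𝓝 (0 : E), ‖leftField Ψ z‖ < 2 := by
    refine h.hasFDerivAt_leftField.continuousAt.norm.eventually_lt continuousAt_const ?_
    rw [h.leftField_zero]
    exact ContinuousLinearMap.norm_id_le.trans_lt (by norm_num)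
  obtain ⟨r, hr, H⟩ := Metric.eventually_nhds_iff.1
    (h1.and (h2.and (h3.and (h.mid.and h4))))
  refine ⟨r, hr, max (max C₁ C₂) 0, le_max_right _ _, fun z hz => ?_⟩
  obtain ⟨e1, e2, e3, e4, e5⟩ := @H z (by simpa using hz)
  simp only [sub_zero, h.leftField_zero, h.rightField_zero, sub_self] at e1 e2
  refine ⟨e3, e4, e5.le, e1.trans ?_, e2.trans ?_⟩
  · gcongr; exact (le_max_left _ _).trans (le_max_left _ _)
  · gcongr; exact (le_max_right _ _).trans (le_max_left _ _)

/-- `localBracket` is the derivative at `0` of the difference of the fields, which vanishes there.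
This is where the bracket enters the differential equation of a quotient. -/
theorem IsLocalConj.exists_sub_localBracket_le (h : IsLocalConj Ψ) {η : ℝ} (hη : 0 < η) :
    ∃ r > 0, ∀ z : E, ‖z‖ < r → ∀ c,
      ‖leftField Ψ z c - rightField Ψ z c - localBracket Ψ z c‖ ≤ η * ‖z‖ * ‖c‖ := by
  have h1 := h.hasFDerivAt_left_sub_right.isLittleO.bound hη
  obtain ⟨r, hr, H⟩ := Metric.eventually_nhds_iff.1 h1
  refine ⟨r, hr, fun z hz c => ?_⟩
  have e := @H z (by simpa using hz)
  simp only [sub_zero, h.leftField_zero, h.rightField_zero, sub_self] at e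
  exact (((leftField Ψ z - rightField Ψ z) - localBracket Ψ z).le_opNorm c).trans (by gcongr)

/-- Strict differentiability at `0`, where the derivative in the first variable is `-id`; the
estimate is therefore uniform in `z` and `y`. -/
theorem IsLocalConj.exists_strict_bound (h : IsLocalConj Ψ) {η : ℝ} (hη : 0 < η) :
    ∃ r > 0, ∀ x x' z y : E, ‖x‖ < r → ‖x'‖ < r → ‖z‖ < r → ‖y‖ < r →
      ‖Ψ (x, z, y) - Ψ (x', z, y) + (x - x')‖ ≤ η * ‖x - x'‖ := by
  have h1 := h.hasStrictFDerivAt.isLittleO.bound hη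
  obtain ⟨r, hr, H⟩ := Metric.eventually_nhds_iff.1 h1
  refine ⟨r, hr, fun x x' z y hx hx' hz hy => ?_⟩
  have e := @H ((x, z, y), (x', z, y)) (by
    simp [dist_eq_norm, Prod.norm_def, hx, hx', hy, hz])
  have e1 : ((x, z, y) : E × E × E) - (x', z, y) = (x - x', 0, 0) :=
    Prod.ext rfl (Prod.ext (sub_self _) (sub_self _))
  simp only [e1, h.fderiv_zero_apply, zero_add, zero_sub, sub_neg_eq_add] at e
  have e2 : ‖((x - x', 0, 0) : E × E × E)‖ = ‖x - x'‖ := by simp [Prod.norm_def]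
  rwa [e2] at e

/-- Conjugation is the identity up to a bilinear error. -/
theorem IsLocalConj.exists_conj_bound (h : IsLocalConj Ψ) :
    ∃ r > 0, ∃ C ≥ 0, ∀ z y : E, ‖z‖ < r → ‖y‖ < r → ‖Ψ (y, z, y) - z‖ ≤ C * ‖z‖ * ‖y‖ := by
  have hc : ContDiffAt ℝ 1 (fderiv ℝ Ψ) 0 :=
    h.contDiffAt.fderiv_right (m := 1) (by exact two_le_smooth)
  obtain ⟨C, t, ht, hC⟩ := hc.exists_lipschitzOnWith
  have h1 : ∀ᶠ y in 𝓝 (0 : E), Ψ (y, 0, y) = 0 := by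
    have e1 : Tendsto (fun y : E => (y, y)) (𝓝 0) (𝓝 0) :=
      Continuous.tendsto' (by fun_prop) _ _ rfl
    have e2 : Tendsto (fun y : E => (y, (0 : E))) (𝓝 0) (𝓝 0) :=
      Continuous.tendsto' (by fun_prop) _ _ rfl
    filter_upwards [e1.eventually h.shift, e2.eventually h.cancel] with y a1 a2
    exact a1.trans a2
  obtain ⟨r₁, hr₁, H1⟩ := Metric.eventually_nhds_iff.1 h1
  obtain ⟨r₂, hr₂, H2⟩ := Metric.eventually_nhds_iff.1 h.mid
  obtain ⟨r₃, hr₃, H3⟩ := Metric.eventually_nhds_iff.1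
    (ht : ∀ᶠ x in 𝓝 (0 : E × E × E), x ∈ t)
  obtain ⟨r₄, hr₄, H4⟩ := Metric.eventually_nhds_iff.1 h.eventually_contDiffAt
  have hr : 0 < min (min r₁ r₂) (min r₃ r₄) := lt_min (lt_min hr₁ hr₂) (lt_min hr₃ hr₄)
  refine ⟨_, hr, C, C.2, fun z y hz hy => ?_⟩
  simp only [lt_min_iff] at hz hy
  let ℓ : E →L[ℝ] E × E × E := (ContinuousLinearMap.id ℝ E).prod
    ((0 : E →L[ℝ] E).prod (ContinuousLinearMap.id ℝ E))
  have hℓ : ‖ℓ‖ ≤ 1 := ContinuousLinearMap.opNorm_le_bound _ zero_le_one fun k => by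
    simp [ℓ, Prod.norm_def]
  have hd : ∀ z' : E, ‖z'‖ ≤ ‖z‖ → ∀ u ∈ Metric.closedBall (0 : E) ‖y‖,
      HasFDerivAt (fun u => Ψ (u, z', u)) (fderiv ℝ Ψ (u, z', u) ∘L ℓ) u := by
    intro z' hz' u hu
    rw [mem_closedBall_zero_iff] at hu
    have a1 : HasFDerivAt Ψ (fderiv ℝ Ψ (u, z', u)) (u, z', u) := by
      refine ((@H4 (u, z', u) ?_).differentiableAt (by simp)).hasFDerivAt
      simp [dist_eq_norm, Prod.norm_def, hu.trans_lt hy.2.2, hz'.trans_lt hz.2.2]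
    exact HasFDerivAt.comp (f := fun u : E => (u, z', u)) u a1
      (((hasFDerivAt_id u).prodMk ((hasFDerivAt_const z' u).prodMk (hasFDerivAt_id u))))
  have hmem : ∀ z' : E, ‖z'‖ ≤ ‖z‖ → ∀ u ∈ Metric.closedBall (0 : E) ‖y‖, (u, z', u) ∈ t := by
    intro z' hz' u hu
    rw [mem_closedBall_zero_iff] at hu
    refine @H3 (u, z', u) ?_
    simp [dist_eq_norm, Prod.norm_def, hu.trans_lt hy.2.1, hz'.trans_lt hz.2.1]
  -- The function `Ψ(u, z, u) - Ψ(u, 0, u)` of `u` has derivative at most `C ‖z‖`, since the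
  -- derivative of `Ψ` is Lipschitz. Its increment from `u = 0` to `u = y` is `Ψ(y, z, y) - z`,
  -- because `y⁻¹ 1 y = 1`.
  have hd2 : ∀ u ∈ Metric.closedBall (0 : E) ‖y‖, HasFDerivWithinAt
      (fun u => Ψ (u, z, u) - Ψ (u, 0, u))
      (fderiv ℝ Ψ (u, z, u) ∘L ℓ - fderiv ℝ Ψ (u, 0, u) ∘L ℓ) (Metric.closedBall 0 ‖y‖) u :=
    fun u hu => ((hd z le_rfl u hu).sub (hd 0 (by simp) u hu)).hasFDerivWithinAt
  have hb : ∀ u ∈ Metric.closedBall (0 : E) ‖y‖,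
      ‖fderiv ℝ Ψ (u, z, u) ∘L ℓ - fderiv ℝ Ψ (u, 0, u) ∘L ℓ‖ ≤ C * ‖z‖ := by
    intro u hu
    rw [← ContinuousLinearMap.sub_comp]
    refine (ContinuousLinearMap.opNorm_comp_le _ _).trans ?_
    have e := hC.norm_sub_le (hmem z le_rfl u hu) (hmem 0 (by simp) u hu)
    have e2 : ‖((u, z, u) : E × E × E) - (u, 0, u)‖ = ‖z‖ := by simp [Prod.norm_def]
    rw [e2] at e
    calc _ ≤ (C * ‖z‖) * 1 := by gcongr
      _ = _ := mul_one _
  have key := (convex_closedBall (0 : E) ‖y‖).norm_image_sub_le_of_norm_hasFDerivWithin_le hd2 hb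
    (show (0 : E) ∈ _ by simp) (show y ∈ _ by simp)
  have k1 : Ψ (y, 0, y) = 0 := H1 (by simpa using hy.1.1)
  have k2 : Ψ (0, z, 0) = z := H2 (by simpa using hz.1.2)
  have k3 : Ψ (0, 0, 0) = 0 := h.apply_zero
  simpa [k1, k2, k3] using key

end LocalConjEstimates

/-- Continuous induction: a curve that starts in the closed set `K`, and is in `K` at `t` as soon
as it is in an open neighbourhood `U` of `K` up to `t`, stays in `K`. -/
theorem forall_mem_of_bootstrap {X : Type*} [TopologicalSpace X] {v : ℝ → X} {a b : ℝ}
    (hv : ContinuousOn v (Icc a b)) {K U : Set X} (hK : IsClosed K) (hU : IsOpen U) (hKU : K ⊆ U)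
    (ha : v a ∈ K) (h : ∀ t ∈ Icc a b, (∀ u ∈ Icc a t, v u ∈ U) → v t ∈ K) :
    ∀ t ∈ Icc a b, v t ∈ K := by
  let s : Set ℝ := {t | ∀ u ∈ Icc a t, v u ∈ K}
  have hs : IsClosed (s ∩ Icc a b) := by
    have hc : IsClosed (Icc a b ∩ v ⁻¹' K) := hv.preimage_isClosed_of_isClosed isClosed_Icc hK
    refine isClosed_of_closure_subset fun t ht => ?_
    have htI : t ∈ Icc a b := closure_minimal inter_subset_right isClosed_Icc ht
    have h1 : ∀ u ∈ Icc a b, u < t → v u ∈ K := fun u hu hut => by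
      obtain ⟨x, hx, hx2⟩ := mem_closure_iff.1 ht (Ioi u) isOpen_Ioi hut
      exact hx2.1 u ⟨hu.1, (mem_Ioi.1 hx).le⟩
    refine ⟨fun u hu => ?_, htI⟩
    rcases hu.2.lt_or_eq with h2 | rfl
    · exact h1 u ⟨hu.1, hu.2.trans htI.2⟩ h2
    · rcases hu.1.lt_or_eq with h3 | rfl
      · have h4 : u ∈ closure (Ico a u) := by
          rw [closure_Ico h3.ne]; exact ⟨h3.le, le_rfl⟩
        have h5 : Ico a u ⊆ Icc a b ∩ v ⁻¹' K := fun y hy =>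
          ⟨⟨hy.1, hy.2.le.trans htI.2⟩, h1 y ⟨hy.1, hy.2.le.trans htI.2⟩ hy.2⟩
        exact (closure_minimal h5 hc h4).2
      · exact ha
  have hsub : Icc a b ⊆ s := by
    refine hs.Icc_subset_of_forall_exists_gt (fun u hu => ?_) fun x hx y hy => ?_
    · rw [le_antisymm hu.2 hu.1]; exact ha
    · have hxI : x ∈ Icc a b := Ico_subset_Icc_self hx.2
      -- Openness of `U` lets the curve stay in `U` for a time `d` after `x`, and the hypothesis `h`
      -- then upgrades `U` to `K` on that interval.
      have h1 : ∀ᶠ u in 𝓝[Icc a b] x, v u ∈ U :=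
        (hv x hxI).eventually (hU.mem_nhds (hKU (hx.1 x ⟨hxI.1, le_rfl⟩)))
      obtain ⟨ε, hε, h1⟩ := Metric.mem_nhdsWithin_iff.1 h1
      have h2 : 0 < min (min (y - x) (b - x)) (ε / 2) :=
        lt_min (lt_min (sub_pos.2 hy) (sub_pos.2 hx.2.2)) (half_pos hε)
      set d := min (min (y - x) (b - x)) (ε / 2)
      have d1 : d ≤ y - x := (min_le_left _ _).trans (min_le_left _ _)
      have d2 : d ≤ b - x := (min_le_left _ _).trans (min_le_right _ _)
      have d3 : d ≤ ε / 2 := min_le_right _ _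
      have hUd : ∀ u ∈ Icc a (x + d), v u ∈ U := fun u hu => by
        rcases le_or_gt u x with h3 | h3
        · exact hKU (hx.1 u ⟨hu.1, h3⟩)
        · refine h1 ⟨?_, hu.1, by linarith [hu.2]⟩
          rw [Metric.mem_ball, Real.dist_eq, abs_of_pos (sub_pos.2 h3)]
          linarith [hu.2]
      refine ⟨x + d, fun u hu => h u ⟨hu.1, by linarith [hu.2]⟩ fun u' hu' =>
        hUd u' ⟨hu'.1, hu'.2.trans hu.2⟩, by linarith, by linarith⟩
  exact fun t ht => hsub ht t ⟨ht.1, le_rfl⟩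

/-! ### Quotients of curves in a Lie group -/

section Quotients

variable {q : ℕ} {H : Type*} [TopologicalSpace H] [ChartedSpace (EuclideanSpace ℝ (Fin q)) H]
  [Group H]

theorem HasLogDerivWithinAt.mono {w : ℝ → H} {ξ : EuclideanSpace ℝ (Fin q)} {s s' : Set ℝ} {τ : ℝ}
    (h : HasLogDerivWithinAt w ξ s τ) (hs : s' ⊆ s) : HasLogDerivWithinAt w ξ s' τ :=
  ⟨h.1.mono hs, h.2.mono hs⟩

theorem HasLogDerivWithinAt.mono_of_mem_nhdsWithin {w : ℝ → H} {ξ : EuclideanSpace ℝ (Fin q)}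
    {s s' : Set ℝ} {τ : ℝ} (h : HasLogDerivWithinAt w ξ s τ) (hs : s ∈ 𝓝[s'] τ) :
    HasLogDerivWithinAt w ξ s' τ :=
  ⟨h.1.mono_of_mem_nhdsWithin hs, h.2.mono_of_mem_nhdsWithin hs⟩

theorem HasLogDerivWithinAt.union {w : ℝ → H} {ξ : EuclideanSpace ℝ (Fin q)}
    {s s' : Set ℝ} {τ : ℝ} (h : HasLogDerivWithinAt w ξ s τ) (h' : HasLogDerivWithinAt w ξ s' τ) :
    HasLogDerivWithinAt w ξ (s ∪ s') τ :=
  ⟨h.1.union h'.1, h.2.union h'.2⟩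

theorem HasLogDerivWithinAt.congr {w w' : ℝ → H} {ξ : EuclideanSpace ℝ (Fin q)}
    {s : Set ℝ} {τ : ℝ} (h : HasLogDerivWithinAt w ξ s τ) (hs : ∀ t ∈ s, w' t = w t) (hτ : τ ∈ s) :
    HasLogDerivWithinAt w' ξ s τ := by
  refine ⟨h.1.congr hs (hs τ hτ), h.2.congr (fun t ht => ?_) ?_⟩
  · rw [hs t ht, hs τ hτ]
  · rw [hs τ hτ]

theorem hasLogDerivWithinAt_const (g : H) (s : Set ℝ) (τ : ℝ) :
    HasLogDerivWithinAt (fun _ => g) (0 : EuclideanSpace ℝ (Fin q)) s τ :=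
  ⟨continuousWithinAt_const, by simpa using hasDerivWithinAt_const τ s (0 : EuclideanSpace ℝ (Fin q))⟩

variable [LieGroup (𝓡 q) ∞ H]

theorem HasLogDerivWithinAt.const_mul {w : ℝ → H} {ξ : EuclideanSpace ℝ (Fin q)} {s : Set ℝ} {τ : ℝ}
    (h : HasLogDerivWithinAt w ξ s τ) (g : H) : HasLogDerivWithinAt (fun t => g * w t) ξ s τ := by
  have := topologicalGroup_of_lieGroup (𝓡 q) ∞ (G := H)
  exact ⟨continuousWithinAt_const.mul h.1, by simpa [mul_assoc] using h.2⟩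

theorem HasLogDerivWithinAt.eventually_mem_source {w : ℝ → H} {ξ : EuclideanSpace ℝ (Fin q)}
    {s : Set ℝ} {τ : ℝ} (h : HasLogDerivWithinAt w ξ s τ) :
    ∀ᶠ t in 𝓝[s] τ, (w τ)⁻¹ * w t ∈ (extChartAt (𝓡 q) (1 : H)).source := by
  have := topologicalGroup_of_lieGroup (𝓡 q) ∞ (G := H)
  have h1 : ContinuousWithinAt (fun t => (w τ)⁻¹ * w t) s τ := continuousWithinAt_const.mul h.1
  refine h1.eventually ?_
  simp only [inv_mul_cancel]; exact source_mem_nhds_one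

variable (q H) in
/-- The derivative of `f⁻¹ g` in the chart at `1`, in terms of the logarithmic derivatives. -/
theorem exists_hasDerivWithinAt_quotient : ∃ r > 0, ∀ (f g : ℝ → H)
    (c₀ c₁ : EuclideanSpace ℝ (Fin q)) (s : Set ℝ) (τ : ℝ),
    HasLogDerivWithinAt f c₀ s τ → HasLogDerivWithinAt g c₁ s τ →
    (f τ)⁻¹ * g τ ∈ nearOne q H r →
    HasDerivWithinAt (fun t => lgChart q ((f t)⁻¹ * g t))
      (leftField (conjMap q H) (lgChart q ((f τ)⁻¹ * g τ)) c₁ -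
        rightField (conjMap q H) (lgChart q ((f τ)⁻¹ * g τ)) c₀) s τ := by
  obtain ⟨r, hr, C, -, hb⟩ := (isLocalConj_conjMap q H).exists_bounds
  refine ⟨r, hr, fun f g c₀ c₁ s τ hf hg hv => ?_⟩
  obtain ⟨h1, h2, -⟩ := hb _ hv.2
  set z := lgChart q ((f τ)⁻¹ * g τ) with hz
  have h3 : HasDerivWithinAt (fun t => (lgChart q ((f τ)⁻¹ * f t), z, lgChart q ((g τ)⁻¹ * g t)))
      (c₀, (0 : EuclideanSpace ℝ (Fin q)), c₁) s τ :=
    hf.2.prodMk ((hasDerivWithinAt_const τ s z).prodMk hg.2)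
  have h4 : (lgChart q ((f τ)⁻¹ * f τ), z, lgChart q ((g τ)⁻¹ * g τ)) = (0, z, 0) := by simp
  have h5 : HasDerivWithinAt (fun t => conjMap q H
      (lgChart q ((f τ)⁻¹ * f t), z, lgChart q ((g τ)⁻¹ * g t)))
      (fderiv ℝ (conjMap q H) (0, z, 0) (c₀, 0, c₁)) s τ :=
    HasFDerivAt.comp_hasDerivWithinAt (l := conjMap q H)
      (f := fun t => (lgChart q ((f τ)⁻¹ * f t), z, lgChart q ((g τ)⁻¹ * g t))) τ
      (by rw [h4]; exact h1) h3
  have h6 : fderiv ℝ (conjMap q H) (0, z, 0) (c₀, 0, c₁) =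
      leftField (conjMap q H) z c₁ - rightField (conjMap q H) z c₀ := by
    have e : ((c₀, 0, c₁) : EuclideanSpace ℝ (Fin q) × EuclideanSpace ℝ (Fin q) ×
      EuclideanSpace ℝ (Fin q)) = (0, 0, c₁) + (c₀, 0, 0) := by simp
    rw [e, map_add]
    simp only [leftField, rightField, neg_apply, sub_neg_eq_add]
    rfl
  rw [h6] at h5
  -- `f(t)⁻¹ g(t) = (f(τ)⁻¹ f(t))⁻¹ (f(τ)⁻¹ g(τ)) (g(τ)⁻¹ g(t))`, so the quotient is `Ψ` along a
  -- curve through `(0, z, 0)` whose velocity consists of the logarithmic derivatives.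
  have key : ∀ t, (f τ)⁻¹ * f t ∈ (extChartAt (𝓡 q) (1 : H)).source →
      (g τ)⁻¹ * g t ∈ (extChartAt (𝓡 q) (1 : H)).source →
      lgChart q ((f t)⁻¹ * g t) =
        conjMap q H (lgChart q ((f τ)⁻¹ * f t), z, lgChart q ((g τ)⁻¹ * g t)) := by
    intro t e1 e2
    rw [conjMap, exChart_lgChart e1, exChart_lgChart e2, hz, exChart_lgChart hv.1]
    congr 1; group
  refine h5.congr_of_eventuallyEq ?_ ?_
  · filter_upwards [hf.eventually_mem_source, hg.eventually_mem_source] with t e1 e2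
    exact key t e1 e2
  · refine key τ ?_ ?_ <;> rw [inv_mul_cancel] <;> exact mem_extChartAt_source (I := 𝓡 q) (1 : H)

variable (q H) in
/-- Curves with close logarithmic derivatives stay close. -/
theorem exists_quotient_bound [T2Space H] (M : ℝ) (hM : 0 ≤ M) : ∃ r > 0, ∃ K > 0,
    ∀ (f g : ℝ → H) (c₀ c₁ : ℝ → EuclideanSpace ℝ (Fin q)) (a b δ ρ : ℝ), a ≤ b → b - a ≤ 1 →
    0 ≤ ρ → (∀ t ∈ Icc a b, HasLogDerivWithinAt f (c₀ t) (Icc a b) t) →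
    (∀ t ∈ Icc a b, HasLogDerivWithinAt g (c₁ t) (Icc a b) t) →
    (∀ t ∈ Icc a b, ‖c₀ t‖ ≤ M) → (∀ t ∈ Icc a b, ‖c₁ t - c₀ t‖ ≤ ρ) →
    (f a)⁻¹ * g a ∈ (extChartAt (𝓡 q) (1 : H)).source → ‖lgChart q ((f a)⁻¹ * g a)‖ ≤ δ →
    K * (δ + ρ * (b - a)) < r → ∀ t ∈ Icc a b,
      (f t)⁻¹ * g t ∈ (extChartAt (𝓡 q) (1 : H)).source ∧
      ‖lgChart q ((f t)⁻¹ * g t)‖ ≤ K * (δ + ρ * (b - a)) := by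
  have := topologicalGroup_of_lieGroup (𝓡 q) ∞ (G := H)
  obtain ⟨r₁, hr₁, h1⟩ := exists_hasDerivWithinAt_quotient q H
  obtain ⟨r₂, hr₂, C, hC, h2⟩ := (isLocalConj_conjMap q H).exists_bounds
  obtain ⟨r₃, hr₃, h3⟩ := exists_isClosed_nearOne (q := q) H
  have hrpos : 0 < min (min r₁ r₂) r₃ := lt_min (lt_min hr₁ hr₂) hr₃
  set r := min (min r₁ r₂) r₃
  have hrr₁ : r ≤ r₁ := (min_le_left _ _).trans (min_le_left _ _)
  have hrr₂ : r ≤ r₂ := (min_le_left _ _).trans (min_le_right _ _)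
  have hrr₃ : r ≤ r₃ := min_le_right _ _
  have hK1 : 1 ≤ Real.exp (C * M) := Real.one_le_exp (by positivity)
  -- The factor `2` is the bound for the left field and the exponential is the Grönwall factor over
  -- a time at most `1`.
  refine ⟨r, hrpos, 2 * Real.exp (C * M), by positivity,
    fun f g c₀ c₁ a b δ ρ hab hab1 hρ hf hg hc₀ hc₁ ha haδ hlt => ?_⟩
  have hδ : 0 ≤ δ := (norm_nonneg _).trans haδ
  set R := 2 * Real.exp (C * M) * (δ + ρ * (b - a)) with hR
  have hba : 0 ≤ b - a := sub_nonneg.2 hab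
  -- The differential inequality is available only while the quotient stays in the chart within
  -- radius `r`. It yields the smaller radius `R < r`, and continuous induction closes the argument.
  refine forall_mem_of_bootstrap (v := fun t => (f t)⁻¹ * g t) (a := a) (b := b)
    (fun t ht => (hf t ht).1.inv.mul (hg t ht).1) (h3 R (hlt.trans_le hrr₃)) (isOpen_nearOne r)
    (fun x hx => ⟨hx.1, hx.2.trans_lt hlt⟩) ⟨ha, haδ.trans ?_⟩ ?_
  · have : 0 ≤ ρ * (b - a) := by positivity
    nlinarith
  · intro t ht hU
    refine ⟨(hU t ⟨ht.1, le_rfl⟩).1, ?_⟩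
    have hsub : Icc a t ⊆ Icc a b := Icc_subset_Icc_right ht.2
    have e := norm_le_exp_of_norm_deriv_le (f := fun t => lgChart q ((f t)⁻¹ * g t))
      (f' := fun t => leftField (conjMap q H) (lgChart q ((f t)⁻¹ * g t)) (c₁ t) -
        rightField (conjMap q H) (lgChart q ((f t)⁻¹ * g t)) (c₀ t))
      (δ := δ) (K := C * M) (η := 2 * ρ) (a := a) (b := t) (by positivity) (by positivity)
      (fun u hu => h1 f g (c₀ u) (c₁ u) _ u ((hf u (hsub hu)).mono hsub)
        ((hg u (hsub hu)).mono hsub) (nearOne_mono hrr₁ (hU u hu))) haδ ?_ t ⟨ht.1, le_rfl⟩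
    · refine e.trans ?_
      have e1 : Real.exp (C * M * (t - a)) ≤ Real.exp (C * M) := by
        refine Real.exp_le_exp.2 (mul_le_of_le_one_right (by positivity) ?_)
        linarith [ht.2]
      have e2 : δ + 2 * ρ * (t - a) ≤ 2 * (δ + ρ * (b - a)) := by
        have := mul_le_mul_of_nonneg_left (sub_le_sub_right ht.2 a) hρ
        linarith
      have e3 : 0 ≤ t - a := sub_nonneg.2 ht.1
      calc _ ≤ 2 * (δ + ρ * (b - a)) * Real.exp (C * M) := by gcongr
        _ = R := by rw [hR]; ring
    · intro u hu
      have hu' : u ∈ Icc a b := hsub (Ico_subset_Icc_self hu)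
      have hz := (hU u (Ico_subset_Icc_self hu)).2
      obtain ⟨-, -, b1, -, b2⟩ := h2 _ (hz.trans_le hrr₂)
      set z := lgChart q ((f u)⁻¹ * g u)
      -- The difference of the logarithmic derivatives is the source term; the difference of the two
      -- fields is of order `‖z‖` and feeds the Grönwall rate.
      have e1 : leftField (conjMap q H) z (c₁ u) - rightField (conjMap q H) z (c₀ u) =
          leftField (conjMap q H) z (c₁ u - c₀ u) +
            (leftField (conjMap q H) z - rightField (conjMap q H) z) (c₀ u) := by
        rw [map_sub, sub_apply]; abel
      rw [e1]
      calc _ ≤ ‖leftField (conjMap q H) z‖ * ‖c₁ u - c₀ u‖ +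
            ‖leftField (conjMap q H) z - rightField (conjMap q H) z‖ * ‖c₀ u‖ :=
            (norm_add_le _ _).trans (add_le_add (ContinuousLinearMap.le_opNorm _ _)
              (ContinuousLinearMap.le_opNorm _ _))
        _ ≤ 2 * ρ + C * ‖z‖ * M := by
            gcongr
            · exact hc₁ u hu'
            · exact hc₀ u hu'
        _ = C * M * ‖z‖ + 2 * ρ := by ring

end Quotients

/-! ### Product integrals -/

section ProductIntegral

variable {q : ℕ} {H : Type*} [TopologicalSpace H] [ChartedSpace (EuclideanSpace ℝ (Fin q)) H]
  [Group H] [LieGroup (𝓡 q) ∞ H] [T2Space H]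

/-- First order expansion of a curve with continuous logarithmic derivative, uniformly in the base
point. -/
theorem HasLogDerivWithinAt.uniform_expansion {w : ℝ → H} {x : ℝ → EuclideanSpace ℝ (Fin q)}
    (hx : ContinuousOn x (Icc 0 1))
    (hw : ∀ τ ∈ Icc (0 : ℝ) 1, HasLogDerivWithinAt w (x τ) (Icc 0 1) τ) {η : ℝ} (hη : 0 < η) :
    ∃ δ > 0, ∀ s ∈ Icc (0 : ℝ) 1, ∀ t ∈ Icc (0 : ℝ) 1, s ≤ t → t - s < δ →
      (w s)⁻¹ * w t ∈ (extChartAt (𝓡 q) (1 : H)).source ∧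
      ‖lgChart q ((w s)⁻¹ * w t) - (t - s) • x s‖ ≤ η * (t - s) := by
  obtain ⟨M₀, hM₀⟩ := isCompact_Icc.exists_bound_of_continuousOn hx
  set M := max M₀ 0
  have hM : ∀ t ∈ Icc (0 : ℝ) 1, ‖x t‖ ≤ M := fun t ht => (hM₀ t ht).trans (le_max_left _ _)
  have hM0 : 0 ≤ M := le_max_right _ _
  obtain ⟨r₁, hr₁, K, hK, h1⟩ := exists_quotient_bound q H 0 le_rfl
  obtain ⟨r₂, hr₂, h2⟩ := exists_hasDerivWithinAt_quotient q H
  obtain ⟨r₃, hr₃, C, hC, h3⟩ := (isLocalConj_conjMap q H).exists_bounds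
  obtain ⟨δ₁, hδ₁, h4⟩ := Metric.uniformContinuousOn_iff.1
    (isCompact_Icc.uniformContinuousOn_of_continuous hx) (η / 2) (half_pos hη)
  have hlim : Tendsto (fun d : ℝ => K * (0 + M * d)) (𝓝 0) (𝓝 0) :=
    (Continuous.tendsto' (by fun_prop) _ _ (by simp))
  have hlim2 : Tendsto (fun d : ℝ => C * (K * (0 + M * d)) * M) (𝓝 0) (𝓝 0) :=
    (Continuous.tendsto' (by fun_prop) _ _ (by simp))
  obtain ⟨δ₂, hδ₂, h5⟩ := Metric.eventually_nhds_iff.1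
    ((hlim.eventually (gt_mem_nhds (lt_min hr₁ (lt_min hr₂ hr₃)))).and
      (hlim2.eventually (gt_mem_nhds (half_pos hη))))
  refine ⟨min δ₁ δ₂, lt_min hδ₁ hδ₂, fun s hs t ht hst hd => ?_⟩
  have hd0 : 0 ≤ t - s := sub_nonneg.2 hst
  obtain ⟨e1, e2⟩ := @h5 (t - s) (by
    rw [dist_zero_right, Real.norm_of_nonneg hd0]; exact hd.trans_le (min_le_right _ _))
  set R := K * (0 + M * (t - s)) with hR
  have hsub : Icc s t ⊆ Icc 0 1 := Icc_subset_Icc hs.1 ht.2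
  have hwI : ∀ u ∈ Icc s t, HasLogDerivWithinAt w (x u) (Icc s t) u :=
    fun u hu => (hw u (hsub hu)).mono hsub
  -- Comparison with the constant curve `w s`, of logarithmic derivative `0`, bounds the coordinates
  -- of `w(s)⁻¹ w(u)` by a multiple of `t - s`. On so small a ball the left field is nearly the
  -- identity.
  have e3 := h1 (fun _ => w s) w (fun _ => 0) x s t 0 M hst (by linarith [hs.1, ht.2]) hM0
    (fun u _ => hasLogDerivWithinAt_const _ _ _) hwI (by simp)
    (fun u hu => by simpa using hM u (hsub hu))
    (by rw [inv_mul_cancel]; exact mem_extChartAt_source (I := 𝓡 q) (1 : H)) (by simp)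
    (e1.trans_le (min_le_left _ _))
  refine ⟨(e3 t ⟨hst, le_rfl⟩).1, ?_⟩
  have hRr : R < r₂ ∧ R < r₃ :=
    ⟨e1.trans_le ((min_le_right _ _).trans (min_le_left _ _)),
      e1.trans_le ((min_le_right _ _).trans (min_le_right _ _))⟩
  have e4 : ∀ u ∈ Icc s t, HasDerivWithinAt
      (fun u => lgChart q ((w s)⁻¹ * w u) - (u - s) • x s)
      (leftField (conjMap q H) (lgChart q ((w s)⁻¹ * w u)) (x u) - x s) (Icc s t) u := by
    intro u hu
    have a1 := h2 (fun _ => w s) w 0 (x u) (Icc s t) u (hasLogDerivWithinAt_const _ _ _)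
      (hwI u hu) ⟨(e3 u hu).1, (e3 u hu).2.trans_lt hRr.1⟩
    rw [map_zero, sub_zero] at a1
    have a2 : HasDerivWithinAt (fun u : ℝ => (u - s) • x s) ((1 : ℝ) • x s) (Icc s t) u :=
      ((hasDerivWithinAt_id u _).sub_const s).smul_const (x s)
    rw [one_smul] at a2
    exact a1.sub a2
  have e5 : ∀ u ∈ Ico s t,
      ‖leftField (conjMap q H) (lgChart q ((w s)⁻¹ * w u)) (x u) - x s‖ ≤ η := by
    intro u hu'
    have hu := Ico_subset_Icc_self hu'
    set z := lgChart q ((w s)⁻¹ * w u)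
    have hz : ‖z‖ ≤ R := (e3 u hu).2
    obtain ⟨-, -, -, b1, -⟩ := h3 z (hz.trans_lt hRr.2)
    have b2 : leftField (conjMap q H) z (x u) - x s =
        (leftField (conjMap q H) z - .id ℝ _) (x u) + (x u - x s) := by
      simp
    have b3 : ‖x u - x s‖ < η / 2 := by
      rw [← dist_eq_norm]
      refine h4 u (hsub hu) s hs ?_
      rw [Real.dist_eq, abs_of_nonneg (sub_nonneg.2 hu.1)]
      linarith [hu.2, min_le_left δ₁ δ₂]
    have b4 : ‖(leftField (conjMap q H) z - .id ℝ _) (x u)‖ ≤ C * R * M :=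
      (ContinuousLinearMap.le_opNorm _ _).trans (by
        refine mul_le_mul (b1.trans ?_) (hM u (hsub hu)) (norm_nonneg _) ?_
        · gcongr
        · have : 0 ≤ R := (norm_nonneg _).trans hz
          positivity)
    rw [b2]
    refine (norm_add_le _ _).trans ?_
    linarith
  have e6 := norm_image_sub_le_of_norm_deriv_le_segment' e4 e5 t ⟨hst, le_rfl⟩
  simpa using e6

omit [LieGroup (𝓡 q) ∞ H] [T2Space H] in
/-- `κ` agrees to first order with the inverse of the chart at `1`. -/
def IsChartStep (κ : EuclideanSpace ℝ (Fin q) → H) : Prop :=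
  ∀ η > 0, ∃ r > 0, ∀ y, ‖y‖ < r → κ y ∈ (extChartAt (𝓡 q) (1 : H)).source ∧
    ‖lgChart q (κ y) - y‖ ≤ η * ‖y‖

omit [LieGroup (𝓡 q) ∞ H] [T2Space H] in
theorem IsInfinitesimalStep.isChartStep {κ : EuclideanSpace ℝ (Fin q) → H}
    (hκ : IsInfinitesimalStep (q := q) κ) : IsChartStep κ := by
  intro η hη
  have h0 : ContinuousAt κ 0 := hκ.hasMFDerivAt.1
  have h1 : HasFDerivAt (fun y => extChartAt (𝓡 q) (1 : H) (κ y))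
      (ContinuousLinearMap.id ℝ (EuclideanSpace ℝ (Fin q))) 0 := by
    have h := hκ.hasMFDerivAt.2
    have hk : κ 0 = 1 := hκ.map_zero
    have h2 : HasFDerivWithinAt (fun y => extChartAt (𝓡 q) (κ 0) (κ y))
      (ContinuousLinearMap.id ℝ (EuclideanSpace ℝ (Fin q))) (range fun y => y) 0 := h
    rw [hk] at h2
    rw [← hasFDerivWithinAt_univ]
    simpa using h2
  have h2 := h1.isLittleO.bound hη
  have h3 : ∀ᶠ y in 𝓝 (0 : EuclideanSpace ℝ (Fin q)),
      κ y ∈ (extChartAt (𝓡 q) (1 : H)).source := by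
    refine h0.eventually ?_
    rw [show κ 0 = 1 from hκ.map_zero]; exact source_mem_nhds_one
  obtain ⟨r, hr, H'⟩ := Metric.eventually_nhds_iff.1 (h2.and h3)
  refine ⟨r, hr, fun y hy => ?_⟩
  obtain ⟨a1, a2⟩ := @H' y (by simpa using hy)
  refine ⟨a2, ?_⟩
  rw [show κ 0 = 1 from hκ.map_zero] at a1
  simpa [lgChart] using a1

omit [T2Space H] in
variable (q H) in
theorem exists_conj_mem_source : ∃ r > 0, ∀ x z y : EuclideanSpace ℝ (Fin q),
    ‖x‖ < r → ‖z‖ < r → ‖y‖ < r → (exChart q H x)⁻¹ * exChart q H z * exChart q H y ∈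
      (extChartAt (𝓡 q) (1 : H)).source := by
  have := topologicalGroup_of_lieGroup (𝓡 q) ∞ (G := H)
  have t := tendsto_exChart_nhds_one (q := q) (H := H)
  have t1 := t.comp (continuous_fst.tendsto (0 : EuclideanSpace ℝ (Fin q) ×
    EuclideanSpace ℝ (Fin q) × EuclideanSpace ℝ (Fin q)))
  have t2 := t.comp ((continuous_fst.comp continuous_snd).tendsto
    (0 : EuclideanSpace ℝ (Fin q) × EuclideanSpace ℝ (Fin q) × EuclideanSpace ℝ (Fin q)))
  have t3 := t.comp ((continuous_snd.comp continuous_snd).tendsto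
    (0 : EuclideanSpace ℝ (Fin q) × EuclideanSpace ℝ (Fin q) × EuclideanSpace ℝ (Fin q)))
  have t4 := (t1.inv.mul t2).mul t3
  simp only [inv_one, mul_one] at t4
  obtain ⟨r, hr, h⟩ := Metric.eventually_nhds_iff.1
    (t4.eventually (source_mem_nhds_one (q := q) (H := H)))
  refine ⟨r, hr, fun x z y hx hz hy => @h (x, z, y) ?_⟩
  simp [dist_eq_norm, Prod.norm_def, hx, hz, hy]

omit [T2Space H] in
-- Inversion has derivative `-id` at `1`. The left gauge products are the inverses of ordered
-- products with the step `y ↦ κ(-y)⁻¹`, so one convergence theorem covers both kinds.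
theorem IsChartStep.neg_inv {κ : EuclideanSpace ℝ (Fin q) → H} (hκ : IsChartStep κ) :
    IsChartStep fun y : EuclideanSpace ℝ (Fin q) => (κ (-y))⁻¹ := by
  intro η hη
  obtain ⟨r₁, hr₁, h1⟩ := (isLocalConj_conjMap q H).exists_strict_bound (η := η / 4) (by positivity)
  obtain ⟨r₂, hr₂, h2⟩ := exists_conj_mem_source q H
  obtain ⟨r₃, hr₃, h3⟩ := hκ (min (η / 2) 1) (by positivity)
  refine ⟨min r₃ (min (r₁ / 2) (r₂ / 2)), by positivity, fun y hy => ?_⟩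
  simp only [lt_min_iff] at hy
  obtain ⟨a1, a2⟩ := h3 (-y) (by simpa using hy.1)
  set x := lgChart q (κ (-y)) with hx
  rw [norm_neg] at a2
  have a3 : ‖x - -y‖ ≤ ‖y‖ := a2.trans (mul_le_of_le_one_left (norm_nonneg _) (min_le_right _ _))
  have a4 : ‖x‖ ≤ 2 * ‖y‖ := by
    have := norm_sub_norm_le x (-y)
    rw [norm_neg] at this
    linarith
  have a5 : (exChart q H x)⁻¹ * exChart q H 0 * exChart q H 0 = (κ (-y))⁻¹ := by
    rw [hx, exChart_lgChart a1]; simp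
  have a6 : lgChart q (κ (-y))⁻¹ = conjMap q H (x, 0, 0) := by rw [conjMap, ← a5]
  refine ⟨?_, ?_⟩
  · have e := h2 x 0 0 (by linarith) (by simpa) (by simpa)
    rwa [a5] at e
  · have e := h1 x 0 0 0 (by linarith) (by simpa) (by simpa) (by simpa)
    have e0 : conjMap q H (0, 0, 0) = 0 := (isLocalConj_conjMap q H).apply_zero
    simp only [e0, sub_zero] at e
    change ‖lgChart q (κ (-y))⁻¹ - y‖ ≤ _
    have e2 : lgChart q (κ (-y))⁻¹ - y = (conjMap q H (x, 0, 0) + x) - (x - -y) := by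
      rw [a6]; abel
    rw [e2]
    refine (norm_sub_le _ _).trans ?_
    have e3 : ‖x - -y‖ ≤ η / 2 * ‖y‖ :=
      a2.trans (mul_le_mul_of_nonneg_right (min_le_left _ _) (norm_nonneg _))
    nlinarith

set_option maxHeartbeats 1000000 in
/-- Ordered products of infinitesimal steps converge to the path ordered exponential. -/
theorem IsChartStep.tendsto_prod {κ : EuclideanSpace ℝ (Fin q) → H} (hκ : IsChartStep κ)
    {w : ℝ → H} {x : ℝ → EuclideanSpace ℝ (Fin q)}
    (hx : ContinuousOn x (Icc 0 1)) (hw0 : w 0 = 1)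
    (hw : ∀ τ ∈ Icc (0 : ℝ) 1, HasLogDerivWithinAt w (x τ) (Icc 0 1) τ) :
    Tendsto (fun N : ℕ => ((List.range N).map fun j : ℕ => κ ((1 / N : ℝ) • x (j / N))).prod) atTop
      (𝓝 (w 1)) := by
  have := topologicalGroup_of_lieGroup (𝓡 q) ∞ (G := H)
  -- The error is measured multiplicatively, by the quotient of the product and the exact curve.
  suffices h : Tendsto (fun N : ℕ =>
      (((List.range N).map fun j : ℕ => κ ((1 / N : ℝ) • x (j / N))).prod)⁻¹ * w 1) atTop (𝓝 1) by
    have h2 := (tendsto_const_nhds (x := w 1)).mul h.inv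
    simpa using h2
  obtain ⟨M₀, hM₀⟩ := isCompact_Icc.exists_bound_of_continuousOn hx
  set M := max M₀ 0
  have hM : ∀ t ∈ Icc (0 : ℝ) 1, ‖x t‖ ≤ M := fun t ht => (hM₀ t ht).trans (le_max_left _ _)
  have hM0 : 0 ≤ M := le_max_right _ _
  rw [tendsto_one_iff q]
  intro R hR
  obtain ⟨r₁, hr₁, hstrict⟩ := (isLocalConj_conjMap q H).exists_strict_bound one_pos
  obtain ⟨r₂, hr₂, C, hC, hconj⟩ := (isLocalConj_conjMap q H).exists_conj_bound
  obtain ⟨r₃, hr₃, hsrc⟩ := exists_conj_mem_source q H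
  have hρ : 0 < min (min R r₁) (min r₂ r₃) := lt_min (lt_min hR hr₁) (lt_min hr₂ hr₃)
  set ρ := min (min R r₁) (min r₂ r₃)
  have hρR : ρ ≤ R := (min_le_left _ _).trans (min_le_left _ _)
  have hρ₁ : ρ ≤ r₁ := (min_le_left _ _).trans (min_le_right _ _)
  have hρ₂ : ρ ≤ r₂ := (min_le_right _ _).trans (min_le_left _ _)
  have hρ₃ : ρ ≤ r₃ := (min_le_right _ _).trans (min_le_right _ _)
  set X := Real.exp (C * (M + 1))
  have hX : 0 < X := Real.exp_pos _
  -- The accumulated error will be at most `4 η X`, which this choice keeps below `ρ`; thus the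
  -- quotient never leaves the region where the local estimates hold.
  set η := min 1 (ρ / (8 * X)) with hη
  have hηpos : 0 < η := lt_min one_pos (by positivity)
  have hη1 : η ≤ 1 := min_le_left _ _
  have hηX : 4 * η * X < ρ := by
    have : η ≤ ρ / (8 * X) := min_le_right _ _
    rw [le_div_iff₀ (by positivity)] at this
    linarith
  obtain ⟨δ, hδ, hexp⟩ := HasLogDerivWithinAt.uniform_expansion hx hw hηpos
  -- Since `‖ε x‖ ≤ ε M`, the tolerance `η / (M + 1)` makes the error of one step at most `η ε`.
  obtain ⟨r₄, hr₄, hstep⟩ := hκ (η / (M + 1)) (by positivity)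
  have hlim : Tendsto (fun N : ℕ => (M + 1) * (1 / (N : ℝ))) atTop (𝓝 0) := by
    simpa using tendsto_one_div_atTop_nhds_zero_nat.const_mul (M + 1)
  filter_upwards [hlim.eventually (gt_mem_nhds (lt_min hρ hr₄)),
    tendsto_one_div_atTop_nhds_zero_nat.eventually (gt_mem_nhds hδ), eventually_gt_atTop 0]
    with N hN1 hN2 hN0
  have hNpos : (0 : ℝ) < N := by exact_mod_cast hN0
  set ε : ℝ := 1 / N with hε
  have hεpos : 0 < ε := by positivity
  have hjε : ∀ j : ℕ, (j / N : ℝ) = j * ε := fun j => by rw [hε]; ring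
  have hNε : (N : ℝ) * ε = 1 := by rw [hε]; field_simp
  simp only [hjε]
  -- one step
  have hone : ∀ j < N, ∀ g : H, g ∈ (extChartAt (𝓡 q) (1 : H)).source → ‖lgChart q g‖ < ρ →
      (κ (ε • x (j * ε)))⁻¹ * g * ((w (j * ε))⁻¹ * w ((j + 1 : ℕ) * ε)) ∈
        (extChartAt (𝓡 q) (1 : H)).source ∧
      ‖lgChart q ((κ (ε • x (j * ε)))⁻¹ * g * ((w (j * ε))⁻¹ * w ((j + 1 : ℕ) * ε)))‖ ≤
        ‖lgChart q g‖ * (1 + C * (M + 1) * ε) + 4 * η * ε := by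
    intro j hj g hg hgρ
    have hjN : (j : ℝ) + 1 ≤ N := by exact_mod_cast hj
    have m1 : (j * ε : ℝ) ∈ Icc (0 : ℝ) 1 := ⟨by positivity, by nlinarith⟩
    have m2 : ((j + 1 : ℕ) * ε : ℝ) ∈ Icc (0 : ℝ) 1 := ⟨by positivity, by push_cast; nlinarith⟩
    have m3 : ((j + 1 : ℕ) * ε : ℝ) - j * ε = ε := by push_cast; ring
    obtain ⟨b1, b2⟩ := hexp _ m1 _ m2 (by linarith) (by rw [m3]; exact hN2)
    rw [m3] at b2
    have c0 : ‖ε • x (j * ε)‖ ≤ ε * M := by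
      rw [norm_smul, Real.norm_of_nonneg hεpos.le]; gcongr; exact hM _ m1
    obtain ⟨c1, c2⟩ := hstep (ε • x (j * ε)) (c0.trans_lt (by nlinarith [min_le_right ρ r₄]))
    have c3 : η / (M + 1) * ‖ε • x (j * ε)‖ ≤ η * ε := by
      rw [div_mul_eq_mul_div, div_le_iff₀ (by positivity)]
      nlinarith [mul_pos hηpos hεpos]
    set k := lgChart q (κ (ε • x (j * ε))) with hk
    set y := lgChart q ((w (j * ε))⁻¹ * w ((j + 1 : ℕ) * ε)) with hy
    set z := lgChart q g with hz
    have ηε : η * ε ≤ ε := by nlinarith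
    have nk : ‖k‖ ≤ (M + 1) * ε := by
      have := norm_le_norm_add_norm_sub' k (ε • x (j * ε))
      linarith
    have ny : ‖y‖ ≤ (M + 1) * ε := by
      have := norm_le_norm_add_norm_sub' y (ε • x (j * ε))
      linarith
    have nky : ‖k - y‖ ≤ 2 * η * ε := by
      have := norm_sub_le (k - ε • x (j * ε)) (y - ε • x (j * ε))
      rw [sub_sub_sub_cancel_right] at this
      linarith
    have hsm : (M + 1) * ε < ρ := hN1.trans_le (min_le_left _ _)
    have e0 : (κ (ε • x (j * ε)))⁻¹ * g * ((w (j * ε))⁻¹ * w ((j + 1 : ℕ) * ε)) =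
        (exChart q H k)⁻¹ * exChart q H z * exChart q H y := by
      rw [hk, hy, hz, exChart_lgChart c1, exChart_lgChart b1, exChart_lgChart hg]
    rw [e0]
    refine ⟨hsrc k z y ((nk.trans_lt hsm).trans_le hρ₃) (hgρ.trans_le hρ₃)
      ((ny.trans_lt hsm).trans_le hρ₃), ?_⟩
    change ‖conjMap q H (k, z, y)‖ ≤ _
    have f1 := hstrict k y z y ((nk.trans_lt hsm).trans_le hρ₁) ((ny.trans_lt hsm).trans_le hρ₁)
      (hgρ.trans_le hρ₁) ((ny.trans_lt hsm).trans_le hρ₁)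
    have f2 := hconj z y (hgρ.trans_le hρ₂) ((ny.trans_lt hsm).trans_le hρ₂)
    -- Replacing `k` by `y` in `k⁻¹ z y` costs at most `2 ‖k - y‖`, which is of order `η ε`; the
    -- remaining conjugation `y⁻¹ z y` moves `z` by at most `C ‖z‖ ‖y‖`.
    have f3 : conjMap q H (k, z, y) =
        (conjMap q H (k, z, y) - conjMap q H (y, z, y) + (k - y)) - (k - y) +
          (conjMap q H (y, z, y) - z) + z := by abel
    have f4 : C * ‖z‖ * ‖y‖ ≤ C * ‖z‖ * ((M + 1) * ε) := by gcongr
    calc ‖conjMap q H (k, z, y)‖ ≤ 1 * ‖k - y‖ + ‖k - y‖ + C * ‖z‖ * ‖y‖ + ‖z‖ := by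
          rw [f3]
          refine (norm_add_le _ _).trans (add_le_add_left ((norm_add_le _ _).trans
            (add_le_add ((norm_sub_le _ _).trans (add_le_add_left f1 _)) f2)) _)
      _ ≤ _ := by linarith
  -- all steps
  have hall : ∀ j ≤ N, (((List.range j).map fun j : ℕ => κ (ε • x (j * ε))).prod)⁻¹ * w (j * ε) ∈
        (extChartAt (𝓡 q) (1 : H)).source ∧
      ‖lgChart q ((((List.range j).map fun j : ℕ => κ (ε • x (j * ε))).prod)⁻¹ * w (j * ε))‖ ≤
        4 * η * (j * ε) * (1 + C * (M + 1) * ε) ^ j := by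
    intro j
    induction j with
    | zero =>
      intro _
      simp [hw0]
    | succ j ih =>
      intro hj
      obtain ⟨i1, i2⟩ := ih (by omega)
      have hjN : (j : ℝ) ≤ N := by exact_mod_cast (by omega : j ≤ N)
      have hpow : (1 + C * (M + 1) * ε) ^ j ≤ X := by
        calc (1 + C * (M + 1) * ε) ^ j ≤ (Real.exp (C * (M + 1) * ε)) ^ j := by
              gcongr
              rw [add_comm]; exact Real.add_one_le_exp _
          _ = Real.exp (j * ε * (C * (M + 1))) := by rw [← Real.exp_nat_mul]; congr 1; ring
          _ ≤ X := Real.exp_le_exp.2 (by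
              refine mul_le_of_le_one_left (by positivity) ?_
              rw [← hNε]; gcongr)
      have hb : 4 * η * (j * ε) * (1 + C * (M + 1) * ε) ^ j < ρ := by
        refine lt_of_le_of_lt ?_ hηX
        have : (j : ℝ) * ε ≤ 1 := by rw [← hNε]; gcongr
        calc _ ≤ 4 * η * 1 * X := by gcongr
          _ = _ := by ring
      obtain ⟨o1, o2⟩ := hone j (by omega) _ i1 (i2.trans_lt hb)
      -- The new factor of the product and the new increment of `w` enclose the previous quotient,
      -- which is the form treated in `hone`.
      have e : (((List.range (j + 1)).map fun j : ℕ => κ (ε • x (j * ε))).prod)⁻¹ *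
          w ((j + 1 : ℕ) * ε) = (κ (ε • x (j * ε)))⁻¹ *
          ((((List.range j).map fun j : ℕ => κ (ε • x (j * ε))).prod)⁻¹ * w (j * ε)) *
            ((w (j * ε))⁻¹ * w ((j + 1 : ℕ) * ε)) := by
        rw [List.range_succ, List.map_append, List.prod_append]
        simp [mul_assoc]
      rw [e]
      refine ⟨o1, o2.trans ?_⟩
      have hq : 0 ≤ C * (M + 1) * ε := by positivity
      have h1 : (1 : ℝ) ≤ (1 + C * (M + 1) * ε) ^ (j + 1) := one_le_pow₀ (by linarith)
      calc _ ≤ 4 * η * (j * ε) * (1 + C * (M + 1) * ε) ^ j * (1 + C * (M + 1) * ε) +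
            4 * η * ε * (1 + C * (M + 1) * ε) ^ (j + 1) := by
            refine add_le_add ?_ (le_mul_of_one_le_right (by positivity) h1)
            gcongr
        _ = _ := by push_cast; ring
  obtain ⟨l1, l2⟩ := hall N le_rfl
  rw [hNε] at l1 l2
  refine ⟨l1, (l2.trans_lt ?_).trans_le hρR⟩
  refine lt_of_le_of_lt ?_ hηX
  have hpow : (1 + C * (M + 1) * ε) ^ N ≤ X := by
    calc (1 + C * (M + 1) * ε) ^ N ≤ (Real.exp (C * (M + 1) * ε)) ^ N := by
          gcongr
          rw [add_comm]; exact Real.add_one_le_exp _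
      _ = Real.exp (N * ε * (C * (M + 1))) := by rw [← Real.exp_nat_mul]; congr 1; ring
      _ = X := by rw [hNε, one_mul]
  calc _ ≤ 4 * η * 1 * X := by gcongr
    _ = _ := by ring

/-- Path ordered exponentials are unique. -/
theorem HasLogDerivWithinAt.eq_one_of_eq {w w' : ℝ → H} {x : ℝ → EuclideanSpace ℝ (Fin q)}
    (hx : ContinuousOn x (Icc 0 1)) (hw0 : w 0 = 1)
    (hw : ∀ τ ∈ Icc (0 : ℝ) 1, HasLogDerivWithinAt w (x τ) (Icc 0 1) τ) (hw0' : w' 0 = 1)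
    (hw' : ∀ τ ∈ Icc (0 : ℝ) 1, HasLogDerivWithinAt w' (x τ) (Icc 0 1) τ) : w 1 = w' 1 := by
  obtain ⟨κ, hκ⟩ := exists_isInfinitesimalStep q H
  have h : IsChartStep (q := q) κ := hκ.isChartStep
  -- Both end values are the limit of the same ordered products.
  exact tendsto_nhds_unique (h.tendsto_prod hx hw0 hw) (h.tendsto_prod hx hw0' hw')

end ProductIntegral

/-! ### Existence of path ordered exponentials -/

section Existence

/-- The Picard-Lindelöf theorem for the vector field `(t, z) ↦ Φ z (x t)`, with a control of the
solution. -/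
theorem exists_local_solution {E : Type*} [NormedAddCommGroup E] [NormedSpace ℝ E] [CompleteSpace E]
    {Φ : E → E →L[ℝ] E} (hΦ : ContDiffAt ℝ 1 Φ 0) {x : ℝ → E} (hx : Continuous x) {M : ℝ}
    (hM : ∀ t, ‖x t‖ ≤ M) {ρ : ℝ} (hρ : 0 < ρ) :
    ∃ δ > 0, ∀ t₀ t₁ : ℝ, t₀ ≤ t₁ → t₁ - t₀ ≤ δ → ∃ z : ℝ → E, z t₀ = 0 ∧
      ∀ t ∈ Icc t₀ t₁, ‖z t‖ < ρ ∧ HasDerivWithinAt z (Φ (z t) (x t)) (Icc t₀ t₁) t := by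
  obtain ⟨K, u, hu, hK⟩ := hΦ.exists_lipschitzOnWith
  have hM0 : 0 ≤ M := (norm_nonneg _).trans (hM 0)
  obtain ⟨r, hr, hru⟩ := Metric.mem_nhds_iff.1 hu
  have ha : 0 < min r ρ / 2 := half_pos (lt_min hr hρ)
  set a := min r ρ / 2 with ha'
  have hau : Metric.closedBall (0 : E) a ⊆ u := fun y hy => hru (by
    rw [Metric.mem_closedBall] at hy; rw [Metric.mem_ball]
    linarith [min_le_left r ρ])
  have hlip : ∀ y ∈ Metric.closedBall (0 : E) a, ∀ y' ∈ Metric.closedBall (0 : E) a,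
      ‖Φ y - Φ y'‖ ≤ K * ‖y - y'‖ := fun y hy y' hy' => hK.norm_sub_le (hau hy) (hau hy')
  set L := (‖Φ 0‖ + K * a) * M with hL
  have hL0 : 0 ≤ L := by positivity
  -- `L` bounds the speed on the ball of radius `a`, so a solution from `0` cannot leave it within
  -- time `a / (L + 1)`. This time does not depend on `t₀`.
  refine ⟨a / (L + 1), by positivity, fun t₀ t₁ ht hδ => ?_⟩
  have h0 : t₀ ∈ Icc t₀ t₁ := ⟨le_rfl, ht⟩
  obtain ⟨aN, haN⟩ : ∃ aN : NNReal, (aN : ℝ) = a := ⟨⟨a, ha.le⟩, rfl⟩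
  obtain ⟨LN, hLN⟩ : ∃ LN : NNReal, (LN : ℝ) = L := ⟨⟨L, hL0⟩, rfl⟩
  obtain ⟨MN, hMN⟩ : ∃ MN : NNReal, (MN : ℝ) = M := ⟨⟨M, hM0⟩, rfl⟩
  have hPL : IsPicardLindelof (fun t z => Φ z (x t)) (⟨t₀, h0⟩ : Icc t₀ t₁) (0 : E)
      aN 0 LN (K * MN) := by
    rw [← haN] at hlip
    refine ⟨fun t _ => ?_, fun y _ => ?_, fun t _ y hy => ?_, ?_⟩
    · refine LipschitzOnWith.of_dist_le_mul fun y hy y' hy' => ?_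
      rw [dist_eq_norm, dist_eq_norm, ← sub_apply]
      refine (ContinuousLinearMap.le_opNorm _ _).trans ?_
      calc _ ≤ (K * ‖y - y'‖) * M := by
            gcongr
            · exact hlip y hy y' hy'
            · exact hM t
        _ = _ := by rw [NNReal.coe_mul, hMN]; ring
    · exact ((Φ y).continuous.comp hx).continuousOn
    · rw [hLN]
      refine (ContinuousLinearMap.le_opNorm _ _).trans ?_
      have h1 := hlip y hy 0 (Metric.mem_closedBall_self aN.2)
      have h2 : ‖y‖ ≤ a := by simpa [haN] using hy
      have h3 := norm_le_norm_add_norm_sub' (Φ y) (Φ 0)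
      rw [sub_zero] at h1
      have h4 : ‖Φ y‖ ≤ ‖Φ 0‖ + K * a :=
        h3.trans (by gcongr; exact h1.trans (by gcongr))
      exact mul_le_mul h4 (hM t) (norm_nonneg _) (by positivity)
    · change LN * max (t₁ - t₀) (t₀ - t₀) ≤ (aN : ℝ) - 0
      rw [hLN, haN]
      rw [sub_self, max_eq_left (sub_nonneg.2 ht), sub_zero]
      calc L * (t₁ - t₀) ≤ (L + 1) * (a / (L + 1)) := by gcongr; linarith
        _ = a := by field_simp
  -- The fixed point itself is used because membership of its values in the ball of radius `a` is
  -- needed together with the equation.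
  obtain ⟨α, hα⟩ := ODE.FunSpace.exists_isFixedPt_next hPL (x := 0) (by simp)
  have hmem : ∀ t, α.compProj t ∈ Metric.closedBall (0 : E) aN := fun t =>
    α.compProj_mem_closedBall hPL.mul_max_le
  have heq : ∀ t ∈ Icc t₀ t₁, α.compProj t =
      ODE.picard (fun t z => Φ z (x t)) t₀ 0 α.compProj t := by
    intro t ht
    conv_lhs => rw [← hα]
    rw [ODE.FunSpace.compProj_apply, ODE.FunSpace.next_apply, projIcc_of_mem _ ht]
  refine ⟨α.compProj, ?_, fun t ht => ⟨?_, ?_⟩⟩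
  · rw [heq t₀ h0, ODE.picard_apply₀]
  · have : ‖α.compProj t‖ ≤ a := by simpa [haN] using hmem t
    linarith [min_le_right r ρ]
  · have hc : ContinuousOn (Function.uncurry fun t z => Φ z (x t))
        (Icc t₀ t₁ ×ˢ Metric.closedBall (0 : E) aN) :=
      continuousOn_prod_of_continuousOn_lipschitzOnWith' (Function.uncurry fun t z => Φ z (x t))
        (K * MN) hPL.lipschitzOnWith hPL.continuousOn
    exact (ODE.hasDerivWithinAt_picard_Icc h0 hc α.continuous_compProj.continuousOn
      (fun t _ => hmem t) 0 ht).congr heq (heq t ht)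

variable {q : ℕ} {H : Type*} [TopologicalSpace H] [ChartedSpace (EuclideanSpace ℝ (Fin q)) H]
  [Group H] [LieGroup (𝓡 q) ∞ H]

variable (q H) in
theorem exists_hasLogDerivWithinAt_exChart : ∃ ρ > 0, ∀ (z : ℝ → EuclideanSpace ℝ (Fin q))
    (c : EuclideanSpace ℝ (Fin q)) (s : Set ℝ) (τ : ℝ), ‖z τ‖ < ρ →
    HasDerivWithinAt z (leftField (conjMap q H) (z τ) c) s τ →
    HasLogDerivWithinAt (fun t => exChart q H (z t)) c s τ := by
  obtain ⟨ρ, hρ, h⟩ := Metric.eventually_nhds_iff.1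
    ((isLocalConj_conjMap q H).eventually_fderiv_leftField.and
      (eventually_continuousAt_exChart (q := q) (H := H)))
  refine ⟨ρ, hρ, fun z c s τ hz hd => ?_⟩
  obtain ⟨⟨h1, h2⟩, h3⟩ := @h (z τ) (by simpa using hz)
  refine ⟨ContinuousAt.comp_continuousWithinAt (f := z) h3 hd.continuousWithinAt, ?_⟩
  have h4 := HasFDerivAt.comp_hasDerivWithinAt (l := fun y => conjMap q H (z τ, y, 0)) (f := z) τ
    h1 hd
  have h5 : (fderiv ℝ (conjMap q H) (z τ, z τ, 0) ∘L (.inr ℝ _ _ ∘L .inl ℝ _ _))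
      (leftField (conjMap q H) (z τ) c) = c := h2 c
  rw [h5] at h4
  refine h4.congr_of_eventuallyEq (Eventually.of_forall fun t => ?_) ?_ <;> simp [conjMap]

/-- Path ordered exponentials exist. -/
theorem exists_hasLogDerivWithinAt {x : ℝ → EuclideanSpace ℝ (Fin q)} (hx : Continuous x)
    {M : ℝ} (hM : ∀ t, ‖x t‖ ≤ M) : ∃ w : ℝ → H, w 0 = 1 ∧
      ∀ τ ∈ Icc (0 : ℝ) 1, HasLogDerivWithinAt w (x τ) (Icc 0 1) τ := by
  obtain ⟨ρ, hρ, h1⟩ := exists_hasLogDerivWithinAt_exChart q H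
  have hc : ContDiffAt ℝ 1 (leftField (conjMap q H)) 0 := by
    have h2 : ContDiffAt ℝ 1 (fderiv ℝ (conjMap q H)) 0 :=
      (isLocalConj_conjMap q H).contDiffAt.fderiv_right (m := 1) (by exact two_le_smooth)
    have h3 : ContDiffAt ℝ 1 (fun z : EuclideanSpace ℝ (Fin q) =>
        fderiv ℝ (conjMap q H) (0, z, 0)) 0 :=
      ContDiffAt.comp (f := fun z : EuclideanSpace ℝ (Fin q) =>
        ((0 : EuclideanSpace ℝ (Fin q)), z, (0 : EuclideanSpace ℝ (Fin q)))) 0 h2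
        (contDiff_const.prodMk (contDiff_id.prodMk contDiff_const)).contDiffAt
    exact h3.clm_comp contDiffAt_const
  obtain ⟨δ, hδ, h2⟩ := exists_local_solution hc hx hM hρ
  obtain ⟨N, hN⟩ := exists_nat_gt (1 / δ)
  have hNpos : (0 : ℝ) < N := (by positivity : 0 < 1 / δ).trans hN
  have hstep : 1 / (N : ℝ) ≤ δ := by
    rw [div_le_iff₀ hNpos]; rw [div_lt_iff₀ hδ] at hN; linarith
  -- The equation `w' = w · x` is invariant under left translation, so each piece of length `1 / N`
  -- is solved in the chart at `1` and translated by the value already reached. The uniform `δ`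
  -- makes `N` pieces suffice.
  have key : ∀ j : ℕ, ∃ w : ℝ → H, w 0 = 1 ∧
      ∀ τ ∈ Icc (0 : ℝ) (j * (1 / N)), HasLogDerivWithinAt w (x τ) (Icc 0 (j * (1 / N))) τ := by
    intro j
    induction j with
    | zero =>
      refine ⟨fun _ => 1, rfl, fun τ hτ => ?_⟩
      have h0 : Icc (0 : ℝ) ((0 : ℕ) * (1 / N)) = {0} := by simp
      rw [h0] at hτ ⊢
      rw [mem_singleton_iff] at hτ
      subst hτ
      exact ⟨continuousWithinAt_const, by
        simp only [inv_one, mul_one, lgChart_one]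
        exact HasFDerivWithinAt.of_subsingleton Set.subsingleton_singleton⟩
    | succ j ih =>
      obtain ⟨w, hw0, hw⟩ := ih
      set b : ℝ := j * (1 / N) with hb
      have hb0 : 0 ≤ b := by positivity
      have hcb : (((j + 1 : ℕ) : ℝ) * (1 / N)) = b + 1 / N := by rw [hb]; push_cast; ring
      rw [hcb]
      have hN' : 0 < 1 / (N : ℝ) := by positivity
      set c := b + 1 / (N : ℝ) with hcdef
      have hbc : b < c := by linarith
      obtain ⟨z, hz0, hz⟩ := h2 b c hbc.le (by linarith)
      let u : ℝ → H := fun t => w b * exChart q H (z t)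
      have hu : ∀ t ∈ Icc b c, HasLogDerivWithinAt u (x t) (Icc b c) t := fun t ht =>
        (h1 z (x t) _ t (hz t ht).1 (hz t ht).2).const_mul (w b)
      have hub : u b = w b := by simp [u, hz0]
      classical
      let v : ℝ → H := fun t => if t ≤ b then w t else u t
      have hvw : ∀ t ∈ Icc 0 b, v t = w t := fun t ht => if_pos ht.2
      have hvu : ∀ t ∈ Icc b c, v t = u t := fun t ht => by
        rcases ht.1.eq_or_lt with rfl | h
        · simp [v, hub]
        · exact if_neg (not_le.2 h)
      have hvw' : ∀ t ∈ Icc 0 b, HasLogDerivWithinAt v (x t) (Icc 0 b) t := fun t ht =>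
        (hw t ht).congr hvw ht
      have hvu' : ∀ t ∈ Icc b c, HasLogDerivWithinAt v (x t) (Icc b c) t := fun t ht =>
        (hu t ht).congr hvu ht
      refine ⟨v, by rw [hvw 0 ⟨le_rfl, hb0⟩, hw0], fun τ hτ => ?_⟩
      rcases lt_trichotomy τ b with h | h | h
      · refine (hvw' τ ⟨hτ.1, h.le⟩).mono_of_mem_nhdsWithin ?_
        filter_upwards [self_mem_nhdsWithin, mem_nhdsWithin_of_mem_nhds (Iio_mem_nhds h)]
          with t ht1 ht2 using ⟨ht1.1, (mem_Iio.1 ht2).le⟩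
      · rw [← Icc_union_Icc_eq_Icc hb0 hbc.le]
        exact (hvw' τ ⟨hτ.1, h.le⟩).union (hvu' τ ⟨h.ge, hτ.2⟩)
      · refine (hvu' τ ⟨h.le, hτ.2⟩).mono_of_mem_nhdsWithin ?_
        filter_upwards [self_mem_nhdsWithin, mem_nhdsWithin_of_mem_nhds (Ioi_mem_nhds h)]
          with t ht1 ht2 using ⟨(mem_Ioi.1 ht2).le, ht1.2⟩
  obtain ⟨w, hw0, hw⟩ := key N
  have hN1 : (N : ℝ) * (1 / N) = 1 := by field_simp
  rw [hN1] at hw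
  exact ⟨w, hw0, hw⟩

end Existence

/-! ### A Frobenius type theorem -/

section Frobenius

variable {q : ℕ} {H : Type*} [TopologicalSpace H] [ChartedSpace (EuclideanSpace ℝ (Fin q)) H]
  [Group H] [LieGroup (𝓡 q) ∞ H] [T2Space H]

set_option maxHeartbeats 1000000 in
/-- If `∂_ε 𝒜 - ∂_τ c + [c, 𝒜] = 0`, the logarithmic derivative of `w · U_τ` in `τ` is `𝒜`, where
`U_τ` is the path ordered exponential of `c` in `ε`. -/
theorem HasLogDerivWithinAt.mul_of_zeroCurvature
    {c dc conn : ℝ × ℝ → EuclideanSpace ℝ (Fin q)} (hc : Continuous c) (hdc : Continuous dc)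
    (hconn : Continuous conn)
    (hcd : ∀ τ ∈ Icc (0 : ℝ) 1, ∀ ε ∈ Icc (0 : ℝ) 1,
      HasDerivWithinAt (fun τ => c (τ, ε)) (dc (τ, ε)) (Icc 0 1) τ)
    (hconnd : ∀ τ ∈ Icc (0 : ℝ) 1, ∀ ε ∈ Icc (0 : ℝ) 1,
      HasDerivWithinAt (fun ε => conn (τ, ε))
        (dc (τ, ε) - localBracket (conjMap q H) (c (τ, ε)) (conn (τ, ε))) (Icc 0 1) ε)
    {w : ℝ → H} (hw : ∀ τ ∈ Icc (0 : ℝ) 1, HasLogDerivWithinAt w (conn (τ, 0)) (Icc 0 1) τ)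
    {U : ℝ → ℝ → H} (hU0 : ∀ τ ∈ Icc (0 : ℝ) 1, U τ 0 = 1)
    (hU : ∀ τ ∈ Icc (0 : ℝ) 1, ∀ ε ∈ Icc (0 : ℝ) 1,
      HasLogDerivWithinAt (U τ) (c (τ, ε)) (Icc 0 1) ε) :
    ∀ τ ∈ Icc (0 : ℝ) 1,
      HasLogDerivWithinAt (fun τ => w τ * U τ 1) (conn (τ, 1)) (Icc 0 1) τ := by
  have := topologicalGroup_of_lieGroup (𝓡 q) ∞ (G := H)
  intro τ hτ
  have hloc := isLocalConj_conjMap q H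
  -- bounds
  have hbd : ∀ f : ℝ × ℝ → EuclideanSpace ℝ (Fin q), Continuous f →
      ∃ M ≥ 0, ∀ ε ∈ Icc (0 : ℝ) 1, ‖f (τ, ε)‖ ≤ M := by
    intro f hf
    obtain ⟨M, hM⟩ := isCompact_Icc.exists_bound_of_continuousOn
      ((hf.comp (by fun_prop : Continuous fun ε : ℝ => (τ, ε))).continuousOn (s := Icc (0 : ℝ) 1))
    exact ⟨max M 0, le_max_right _ _, fun ε hε => (hM ε hε).trans (le_max_left _ _)⟩
  obtain ⟨Mc, hMc0, hMc⟩ := hbd c hc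
  obtain ⟨Md, hMd0, hMd⟩ := hbd dc hdc
  obtain ⟨Ma, hMa0, hMa⟩ := hbd conn hconn
  obtain ⟨r₁, hr₁, K, hK, h1⟩ := exists_quotient_bound q H Mc hMc0
  obtain ⟨r₂, hr₂, h2⟩ := exists_hasDerivWithinAt_quotient q H
  obtain ⟨r₃, hr₃, C, hC, h3⟩ := hloc.exists_bounds
  set β := localBracket (conjMap q H) with hβ
  have hβanti : ∀ x y, β x y = -β y x := fun x y => by
    rw [hβ, hloc.localBracket_apply, hloc.localBracket_apply]; abel
  -- the a priori bound
  set ρ₀ := Ma + 1 + (Md + 1) with hρ₀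
  -- First order expansion of `w(τ) U_τ(1)` in `τ`, obtained without differentiating `U` in `τ`: for
  -- neighbouring `τ`, `τ'` the curves `ε ↦ w(τ) U_τ(ε)` and `ε ↦ w(τ') U_{τ'}(ε)` are compared.
  have key : ∀ η > 0, η ≤ 1 → ∃ δ > 0, ∀ τ' ∈ Icc (0 : ℝ) 1, |τ' - τ| < δ →
      (w τ * U τ 1)⁻¹ * (w τ' * U τ' 1) ∈ (extChartAt (𝓡 q) (1 : H)).source ∧
      ‖lgChart q ((w τ * U τ 1)⁻¹ * (w τ' * U τ' 1)) - (τ' - τ) • conn (τ, 1)‖ ≤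
        (2 + K * ρ₀ * Mc + (Md + 1)) * Real.exp (‖β‖ * Mc) * η * |τ' - τ| := by
    intro η hη hη1
    obtain ⟨r₄, hr₄, h4⟩ := hloc.exists_sub_localBracket_le hη
    obtain ⟨δ₁, hδ₁, h5⟩ := uniform_hasDerivWithinAt (F := fun τ ε => c (τ, ε))
      (F' := fun τ ε => dc (τ, ε)) (N := Icc (0 : ℝ) 1) isCompact_Icc hcd hdc hτ hη
    have h6 := (hw τ hτ).2.hasFDerivWithinAt.isLittleO.bound hη
    obtain ⟨δ₂, hδ₂, h6⟩ := Metric.mem_nhdsWithin_iff.1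
      (h6.and (hw τ hτ).eventually_mem_source)
    have hlim : Tendsto (fun d : ℝ => K * (ρ₀ * d)) (𝓝 0) (𝓝 0) :=
      Continuous.tendsto' (by fun_prop) _ _ (by simp)
    have hlim2 : Tendsto (fun d : ℝ => C * (K * (ρ₀ * d))) (𝓝 0) (𝓝 0) :=
      Continuous.tendsto' (by fun_prop) _ _ (by simp)
    obtain ⟨δ₃, hδ₃, h7⟩ := Metric.eventually_nhds_iff.1
      ((hlim.eventually (gt_mem_nhds (lt_min (lt_min hr₁ hr₂) (lt_min hr₃ hr₄)))).and
        (hlim2.eventually (gt_mem_nhds hη)))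
    refine ⟨min δ₁ (min δ₂ δ₃), lt_min hδ₁ (lt_min hδ₂ hδ₃), fun τ' hτ' hd => ?_⟩
    simp only [lt_min_iff] at hd
    set h := τ' - τ with hh
    have habs : 0 ≤ |h| := abs_nonneg h
    obtain ⟨b1, b2⟩ := @h7 |h| (by simpa using hd.2.2)
    simp only [lt_min_iff] at b1
    obtain ⟨b3, b4⟩ := h6 ⟨by rw [Metric.mem_ball, Real.dist_eq]; exact hd.2.1, hτ'⟩
    have b3' : ‖lgChart q ((w τ)⁻¹ * w τ') - h • conn (τ, 0)‖ ≤ η * |h| := by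
      simpa using b3
    have b5 : ∀ ε ∈ Icc (0 : ℝ) 1, ‖c (τ', ε) - c (τ, ε) - h • dc (τ, ε)‖ ≤ η * |h| :=
      h5 τ' hτ' hd.1
    have b6 : ∀ ε ∈ Icc (0 : ℝ) 1, ‖c (τ', ε) - c (τ, ε)‖ ≤ (Md + 1) * |h| := by
      intro ε hε
      have := norm_le_norm_add_norm_sub' (c (τ', ε) - c (τ, ε)) (h • dc (τ, ε))
      rw [norm_smul, Real.norm_eq_abs] at this
      have e := b5 ε hε
      have e2 := mul_le_mul_of_nonneg_left (hMd ε hε) habs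
      nlinarith
    have hz01 : (0 : ℝ) ∈ Icc (0 : ℝ) 1 := ⟨le_rfl, zero_le_one⟩
    have h101 : (1 : ℝ) ∈ Icc (0 : ℝ) 1 := ⟨zero_le_one, le_rfl⟩
    have b7 : ‖lgChart q ((w τ)⁻¹ * w τ')‖ ≤ (Ma + 1) * |h| := by
      have := norm_le_norm_add_norm_sub' (lgChart q ((w τ)⁻¹ * w τ')) (h • conn (τ, 0))
      rw [norm_smul, Real.norm_eq_abs] at this
      have e2 := mul_le_mul_of_nonneg_left (hMa 0 hz01) habs
      nlinarith
    have hf : ∀ ε ∈ Icc (0 : ℝ) 1,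
        HasLogDerivWithinAt (fun ε => w τ * U τ ε) (c (τ, ε)) (Icc 0 1) ε :=
      fun ε hε => (hU τ hτ ε hε).const_mul _
    have hg : ∀ ε ∈ Icc (0 : ℝ) 1,
        HasLogDerivWithinAt (fun ε => w τ' * U τ' ε) (c (τ', ε)) (Icc 0 1) ε :=
      fun ε hε => (hU τ' hτ' ε hε).const_mul _
    have e0 : (w τ * U τ 0)⁻¹ * (w τ' * U τ' 0) = (w τ)⁻¹ * w τ' := by
      rw [hU0 τ hτ, hU0 τ' hτ', mul_one, mul_one]
    have e1 : K * ((Ma + 1) * |h| + (Md + 1) * |h| * (1 - 0)) = K * (ρ₀ * |h|) := by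
      rw [hρ₀]; ring
    -- A priori estimate: at `ε = 0` the quotient is `w(τ)⁻¹ w(τ')`, of size `O(|h|)`, and the
    -- logarithmic derivatives differ by `O(|h|)`. Thus the quotient stays in the chart and is
    -- `O(|h|)` for all `ε`.
    have b8 := h1 _ _ _ _ 0 1 ((Ma + 1) * |h|) ((Md + 1) * |h|) zero_le_one (by norm_num)
      (by positivity) hf hg hMc b6 (by rw [e0]; exact b4) (by rw [e0]; exact b7)
      (by rw [e1]; exact b1.1.1)
    simp only [e1] at b8
    refine ⟨(b8 1 h101).1, ?_⟩
    set y : ℝ → EuclideanSpace ℝ (Fin q) :=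
      fun ε => lgChart q ((w τ * U τ ε)⁻¹ * (w τ' * U τ' ε)) with hy
    have hyR : ∀ ε ∈ Icc (0 : ℝ) 1, ‖y ε‖ ≤ K * (ρ₀ * |h|) := fun ε hε => (b8 ε hε).2
    have hder : ∀ ε ∈ Icc (0 : ℝ) 1, HasDerivWithinAt (fun ε => y ε - h • conn (τ, ε))
        ((leftField (conjMap q H) (y ε) (c (τ', ε)) - rightField (conjMap q H) (y ε) (c (τ, ε))) -
          h • (dc (τ, ε) - β (c (τ, ε)) (conn (τ, ε)))) (Icc 0 1) ε := by
      intro ε hε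
      exact (h2 _ _ _ _ _ ε (hf ε hε) (hg ε hε)
        ⟨(b8 ε hε).1, (hyR ε hε).trans_lt b1.1.2⟩).sub ((hconnd τ hτ ε hε).const_smul h)
    have hbound : ∀ ε ∈ Ico (0 : ℝ) 1,
        ‖(leftField (conjMap q H) (y ε) (c (τ', ε)) - rightField (conjMap q H) (y ε) (c (τ, ε))) -
          h • (dc (τ, ε) - β (c (τ, ε)) (conn (τ, ε)))‖ ≤
        ‖β‖ * Mc * ‖y ε - h • conn (τ, ε)‖ + (1 + K * ρ₀ * Mc + (Md + 1)) * η * |h| := by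
      intro ε hε'
      have hε := Ico_subset_Icc_self hε'
      obtain ⟨-, -, -, d1, -⟩ := h3 (y ε) ((hyR ε hε).trans_lt b1.2.1)
      have d2 := h4 (y ε) ((hyR ε hε).trans_lt b1.2.2) (c (τ, ε))
      -- Flatness says that `h • conn` solves the linearization `y' = [y, c] + h • dc` of the
      -- equation for the quotient. The deviation is driven by three errors of order `η |h|`: the
      -- expansion of `c` in `τ`, the nonlinearity of the difference of the fields, and the left
      -- field acting on the increment of `c`.
      have d3 : (leftField (conjMap q H) (y ε) (c (τ', ε)) -
            rightField (conjMap q H) (y ε) (c (τ, ε))) -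
            h • (dc (τ, ε) - β (c (τ, ε)) (conn (τ, ε))) =
          β (y ε - h • conn (τ, ε)) (c (τ, ε)) +
          (c (τ', ε) - c (τ, ε) - h • dc (τ, ε)) +
          (leftField (conjMap q H) (y ε) (c (τ, ε)) - rightField (conjMap q H) (y ε) (c (τ, ε)) -
            β (y ε) (c (τ, ε))) +
          (leftField (conjMap q H) (y ε) - .id ℝ _) (c (τ', ε) - c (τ, ε)) := by
        rw [hβanti (c (τ, ε))]
        simp only [map_sub, map_smul, sub_apply, smul_apply, ContinuousLinearMap.id_apply]
        module
      rw [d3]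
      have d4 : ‖β (y ε - h • conn (τ, ε)) (c (τ, ε))‖ ≤
          ‖β‖ * Mc * ‖y ε - h • conn (τ, ε)‖ := by
        calc _ ≤ ‖β‖ * ‖y ε - h • conn (τ, ε)‖ * ‖c (τ, ε)‖ := β.le_opNorm₂ _ _
          _ ≤ ‖β‖ * ‖y ε - h • conn (τ, ε)‖ * Mc := by gcongr; exact hMc ε hε
          _ = _ := by ring
      have d5 : ‖leftField (conjMap q H) (y ε) (c (τ, ε)) -
          rightField (conjMap q H) (y ε) (c (τ, ε)) - β (y ε) (c (τ, ε))‖ ≤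
          K * ρ₀ * Mc * η * |h| := by
        calc _ ≤ η * (K * (ρ₀ * |h|)) * Mc := d2.trans (by
              gcongr
              · exact hyR ε hε
              · exact hMc ε hε)
          _ = _ := by ring
      have d6 : ‖(leftField (conjMap q H) (y ε) - .id ℝ _) (c (τ', ε) - c (τ, ε))‖ ≤
          (Md + 1) * η * |h| := by
        calc _ ≤ C * (K * (ρ₀ * |h|)) * ((Md + 1) * |h|) :=
              (ContinuousLinearMap.le_opNorm _ _).trans (mul_le_mul
                (d1.trans (mul_le_mul_of_nonneg_left (hyR ε hε) hC)) (b6 ε hε) (norm_nonneg _)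
                (by positivity))
          _ ≤ η * ((Md + 1) * |h|) := by gcongr
          _ = _ := by ring
      have d7 := b5 ε hε
      refine (norm_add_le _ _).trans ?_
      refine (add_le_add_left (norm_add_le _ _) _).trans ?_
      refine (add_le_add_left (add_le_add_left (norm_add_le _ _) _) _).trans ?_
      linarith
    have hini : ‖y 0 - h • conn (τ, 0)‖ ≤ η * |h| := by
      rw [hy]; simp only [e0]; exact b3'
    have fin := norm_le_exp_of_norm_deriv_le (K := ‖β‖ * Mc)
      (η := (1 + K * ρ₀ * Mc + (Md + 1)) * η * |h|) (δ := η * |h|) (by positivity)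
      (by positivity) hder hini hbound 1 h101
    refine fin.trans (le_of_eq ?_)
    rw [sub_zero, mul_one, mul_one]
    ring
  have hX : 0 < (2 + K * ρ₀ * Mc + (Md + 1)) * Real.exp (‖β‖ * Mc) := by positivity
  set X := (2 + K * ρ₀ * Mc + (Md + 1)) * Real.exp (‖β‖ * Mc)
  have hderiv : HasDerivWithinAt (fun τ' => lgChart q ((w τ * U τ 1)⁻¹ * (w τ' * U τ' 1)))
      (conn (τ, 1)) (Icc 0 1) τ := by
    rw [hasDerivWithinAt_iff_isLittleO, Asymptotics.isLittleO_iff]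
    intro η hη
    obtain ⟨δ, hδ, h⟩ := key (min (η / X) 1) (lt_min (by positivity) one_pos) (min_le_right _ _)
    filter_upwards [self_mem_nhdsWithin, mem_nhdsWithin_of_mem_nhds (Metric.ball_mem_nhds τ hδ)]
      with τ' h1 h2
    have e := (h τ' h1 (by rwa [Metric.mem_ball, Real.dist_eq] at h2)).2
    simp only [inv_mul_cancel, lgChart_one, sub_zero, Real.norm_eq_abs]
    refine e.trans ?_
    gcongr
    calc X * min (η / X) 1 ≤ X * (η / X) := by gcongr; exact min_le_left _ _
      _ = η := by field_simp
  refine ⟨?_, hderiv⟩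
  -- Small coordinates imply closeness to `1` only inside the chart domain, so the membership
  -- supplied by `key` is used as well.
  have hlim : Tendsto (fun τ' => (w τ * U τ 1)⁻¹ * (w τ' * U τ' 1)) (𝓝[Icc 0 1] τ) (𝓝 1) := by
    rw [tendsto_one_iff q]
    intro r hr
    obtain ⟨δ, hδ, h⟩ := key 1 one_pos le_rfl
    have h0 : ContinuousWithinAt (fun τ' => ‖lgChart q ((w τ * U τ 1)⁻¹ * (w τ' * U τ' 1))‖)
      (Icc 0 1) τ := hderiv.continuousWithinAt.norm
    filter_upwards [self_mem_nhdsWithin, mem_nhdsWithin_of_mem_nhds (Metric.ball_mem_nhds τ hδ),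
      h0.eventually (gt_mem_nhds (by simpa using hr))] with τ' h1 h2 h3
    exact ⟨(h τ' h1 (by rwa [Metric.mem_ball, Real.dist_eq] at h2)).1, h3⟩
  have := (tendsto_const_nhds (x := w τ * U τ 1)).mul hlim
  simpa only [mul_inv_cancel_left, mul_one, ContinuousWithinAt] using this

end Frobenius

/-! ### Pulling back forms along maps from a normed space -/

section Pullback

variable {m : ℕ} {M : Type*} [TopologicalSpace M] [ChartedSpace (EuclideanSpace ℝ (Fin m)) M]
  {F : Type*} [NormedAddCommGroup F] [NormedSpace ℝ F]
  {V : Type*} [NormedAddCommGroup V] [NormedSpace ℝ V] {k : ℕ}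

/-- The derivative of `f` within `s`, with values in the model space. -/
def mderivWithin (m : ℕ) {M : Type*} [TopologicalSpace M]
    [ChartedSpace (EuclideanSpace ℝ (Fin m)) M] (f : F → M) (s : Set F) (z : F) :
    F →L[ℝ] EuclideanSpace ℝ (Fin m) :=
  mfderivWithin 𝓘(ℝ, F) (𝓡 m) f s z

/-- The values of a form, on vectors of the model space. -/
def MForm.modelValue (η : MForm m M k V) (x : M) : EuclideanSpace ℝ (Fin m) [⋀^Fin k]→L[ℝ] V := η x

/-- The pullback of a form along `f`, on constant vector fields. -/
def MForm.pull (η : MForm m M k V) (f : F → M) (s : Set F) (v : Fin k → F) (z : F) : V :=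
  η.modelValue (f z) fun i => mderivWithin m f s z (v i)

/-- The derivative of the inverse of the chart at `p`. -/
def symmDeriv (m : ℕ) {M : Type*} [TopologicalSpace M]
    [ChartedSpace (EuclideanSpace ℝ (Fin m)) M] (p : M) (y : EuclideanSpace ℝ (Fin m)) :
    EuclideanSpace ℝ (Fin m) →L[ℝ] EuclideanSpace ℝ (Fin m) :=
  mfderiv (𝓡 m) (𝓡 m) (extChartAt (𝓡 m) p).symm y

/-- The coordinate expression of `f` in the chart at `p`. -/
def coordExpr (m : ℕ) {M : Type*} [TopologicalSpace M]
    [ChartedSpace (EuclideanSpace ℝ (Fin m)) M] (p : M) (f : F → M) (z : F) :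
    EuclideanSpace ℝ (Fin m) :=
  extChartAt (𝓡 m) p (f z)

theorem MForm.inChart_apply (η : MForm m M k V) (p : M) (y : EuclideanSpace ℝ (Fin m))
    (v : Fin k → EuclideanSpace ℝ (Fin m)) :
    η.inChart p y v = η.modelValue ((extChartAt (𝓡 m) p).symm y) fun i => symmDeriv m p y (v i) :=
  rfl

variable [IsManifold (𝓡 m) ∞ M] {f : F → M} {s : Set F}

omit [IsManifold (𝓡 m) ∞ M] in
theorem eventually_mem_chart_source (hf : ContMDiffOn 𝓘(ℝ, F) (𝓡 m) ∞ f s) {z₀ : F} (hz₀ : z₀ ∈ s) :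
    ∀ᶠ z in 𝓝[s] z₀, f z ∈ (extChartAt (𝓡 m) (f z₀)).source :=
  (hf z₀ hz₀).continuousWithinAt.eventually (extChartAt_source_mem_nhds (I := 𝓡 m) (f z₀))

theorem contDiffWithinAt_coordExpr (hf : ContMDiffOn 𝓘(ℝ, F) (𝓡 m) ∞ f s) {p : M} {z : F}
    (hz : z ∈ s) (hp : f z ∈ (extChartAt (𝓡 m) p).source) :
    ContDiffWithinAt ℝ ∞ (coordExpr m p f) s z := by
  rw [extChartAt_source] at hp
  have h := ((contMDiffWithinAt_iff_target_of_mem_source hp).1 (hf z hz)).2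
  exact h.contDiffWithinAt

theorem mderivWithin_eq (hs : UniqueDiffOn ℝ s) (hf : ContMDiffOn 𝓘(ℝ, F) (𝓡 m) ∞ f s) {p : M}
    {z : F} (hz : z ∈ s) (hp : f z ∈ (extChartAt (𝓡 m) p).source) :
    mderivWithin m f s z = symmDeriv m p (coordExpr m p f z) ∘L
      fderivWithin ℝ (coordExpr m p f) s z := by
  have hc : ContinuousWithinAt f s z := (hf z hz).continuousWithinAt
  have h1 : ∀ᶠ z' in 𝓝[s] z, f z' ∈ (extChartAt (𝓡 m) p).source :=
    hc.eventually ((isOpen_extChartAt_source (I := 𝓡 m) p).mem_nhds hp)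
  have h2 : f =ᶠ[𝓝[s] z] (extChartAt (𝓡 m) p).symm ∘ coordExpr m p f := by
    filter_upwards [h1] with z' hz'
    exact ((extChartAt (𝓡 m) p).left_inv hz').symm
  have hu : DifferentiableWithinAt ℝ (coordExpr m p f) s z :=
    (contDiffWithinAt_coordExpr hf hz hp).differentiableWithinAt (by simp)
  have h3 : MDifferentiableAt (𝓡 m) (𝓡 m) (extChartAt (𝓡 m) p).symm (coordExpr m p f z) := by
    have ht := (extChartAt (𝓡 m) p).map_source hp
    have h := mdifferentiableWithinAt_extChartAt_symm (I := 𝓡 m) ht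
    rw [ModelWithCorners.range_eq_univ, mdifferentiableWithinAt_univ] at h
    exact h
  have h4 := mfderiv_comp_mfderivWithin (I := 𝓘(ℝ, F)) z h3 hu.mdifferentiableWithinAt
    (hs z hz).uniqueMDiffWithinAt
  rw [mfderivWithin_eq_fderivWithin] at h4
  exact (h2.mfderivWithin_eq_of_mem hz).trans h4

/-- One fixed chart serves all points near a given one, so regularity of a pullback reduces to that
of maps between normed spaces. -/
theorem MForm.pull_eq (hs : UniqueDiffOn ℝ s) (hf : ContMDiffOn 𝓘(ℝ, F) (𝓡 m) ∞ f s)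
    (η : MForm m M k V) {p : M} {z : F} (hz : z ∈ s) (hp : f z ∈ (extChartAt (𝓡 m) p).source)
    (v : Fin k → F) :
    η.pull f s v z = η.inChart p (coordExpr m p f z)
      fun i => fderivWithin ℝ (coordExpr m p f) s z (v i) := by
  rw [MForm.inChart_apply, MForm.pull, mderivWithin_eq hs hf hz hp]
  have h : (extChartAt (𝓡 m) p).symm (coordExpr m p f z) = f z :=
    (extChartAt (𝓡 m) p).left_inv hp
  rw [h]; rfl

omit [IsManifold (𝓡 m) ∞ M] in
theorem SmoothForm.contDiffAt_inChart {η : MForm m M k V} (hη : SmoothForm η) {p : M}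
    {y : EuclideanSpace ℝ (Fin m)} (hy : y ∈ (extChartAt (𝓡 m) p).target) :
    ContDiffAt ℝ ∞ (η.inChart p) y :=
  (hη p).contDiffAt ((isOpen_extChartAt_target (I := 𝓡 m) p).mem_nhds hy)

theorem MForm.continuousOn_pull (hs : UniqueDiffOn ℝ s) (hf : ContMDiffOn 𝓘(ℝ, F) (𝓡 m) ∞ f s)
    {η : MForm m M k V} (hη : SmoothForm η) (v : Fin k → F) :
    ContinuousOn (η.pull f s v) s := by
  intro z₀ hz₀
  have hp := mem_extChartAt_source (I := 𝓡 m) (f z₀)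
  have hu := contDiffWithinAt_coordExpr hf hz₀ hp
  have h1 : ContinuousWithinAt (fun z => η.inChart (f z₀) (coordExpr m (f z₀) f z)) s z₀ :=
    ContinuousAt.comp_continuousWithinAt (f := coordExpr m (f z₀) f)
      (hη.contDiffAt_inChart ((extChartAt (𝓡 m) (f z₀)).map_source hp)).continuousAt
      hu.continuousWithinAt
  have h2 : ∀ i, ContinuousWithinAt
      (fun z => fderivWithin ℝ (coordExpr m (f z₀) f) s z (v i)) s z₀ := fun i =>
    ((hu.fderivWithin_right (m := 1) hs (by exact two_le_smooth) hz₀).continuousWithinAt).clm_apply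
      continuousWithinAt_const
  have h3 : ContinuousWithinAt (fun z => η.inChart (f z₀) (coordExpr m (f z₀) f z)
      fun i => fderivWithin ℝ (coordExpr m (f z₀) f) s z (v i)) s z₀ :=
    ContinuousWithinAt.eval h1 (continuousWithinAt_pi.2 h2)
  refine h3.congr_of_eventuallyEq_of_mem ?_ hz₀
  filter_upwards [eventually_mem_chart_source hf hz₀, self_mem_nhdsWithin] with z h4 h5
  exact η.pull_eq hs hf h5 h4 v

/-- The expression of a `1`-form in a chart, with values in linear maps. -/
def MForm.oneInChart (η : MForm m M 1 V) (p : M) (y : EuclideanSpace ℝ (Fin m)) :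
    EuclideanSpace ℝ (Fin m) →L[ℝ] V :=
  (ContinuousAlternatingMap.ofSubsingletonLIE (𝕜 := ℝ) (E := EuclideanSpace ℝ (Fin m)) (F := V)
    (0 : Fin 1)).symm.toContinuousLinearEquiv (η.inChart p y)

omit [IsManifold (𝓡 m) ∞ M] in
theorem MForm.hasFDerivAt_oneInChart {η : MForm m M 1 V} (hη : SmoothForm η) {p : M}
    {y : EuclideanSpace ℝ (Fin m)} (hy : y ∈ (extChartAt (𝓡 m) p).target) :
    HasFDerivAt (η.oneInChart p) (fderiv ℝ (η.oneInChart p) y) y ∧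
    ∀ w x, fderiv ℝ (η.oneInChart p) y w x = fderiv ℝ (η.inChart p) y w fun _ => x := by
  have h1 : HasFDerivAt (η.inChart p) (fderiv ℝ (η.inChart p) y) y :=
    ((hη.contDiffAt_inChart hy).differentiableAt (by simp)).hasFDerivAt
  have h2 : HasFDerivAt (η.oneInChart p) _ y :=
    ((ContinuousAlternatingMap.ofSubsingletonLIE (𝕜 := ℝ) (E := EuclideanSpace ℝ (Fin m)) (F := V)
      (0 : Fin 1)).symm.toContinuousLinearEquiv.toContinuousLinearMap).hasFDerivAt.comp y h1
  refine ⟨h2.differentiableAt.hasFDerivAt, fun w x => ?_⟩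
  rw [h2.fderiv]; rfl

/-- The exterior derivative of a `1`-form in a chart, on two directions. -/
theorem MForm.extd_apply_pull (hs : UniqueDiffOn ℝ s) (hf : ContMDiffOn 𝓘(ℝ, F) (𝓡 m) ∞ f s)
    {η : MForm m M 1 V} (hη : SmoothForm η) {z : F} (hz : z ∈ s) (v w : F) :
    η.extd.pull f s ![w, v] z =
      fderiv ℝ (η.oneInChart (f z)) (coordExpr m (f z) f z)
        (fderivWithin ℝ (coordExpr m (f z) f) s z w) (fderivWithin ℝ (coordExpr m (f z) f) s z v) -
      fderiv ℝ (η.oneInChart (f z)) (coordExpr m (f z) f z)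
        (fderivWithin ℝ (coordExpr m (f z) f) s z v)
        (fderivWithin ℝ (coordExpr m (f z) f) s z w) := by
  have hp := mem_extChartAt_source (I := 𝓡 m) (f z)
  have ht : coordExpr m (f z) f z ∈ (extChartAt (𝓡 m) (f z)).target :=
    (extChartAt (𝓡 m) (f z)).map_source hp
  obtain ⟨-, h2⟩ := MForm.hasFDerivAt_oneInChart hη ht
  have hu : DifferentiableWithinAt ℝ (coordExpr m (f z) f) s z :=
    (contDiffWithinAt_coordExpr hf hz hp).differentiableWithinAt (by simp)
  have hd : MDifferentiableAt (𝓡 m) 𝓘(ℝ, EuclideanSpace ℝ (Fin m)) (extChartAt (𝓡 m) (f z)) (f z) :=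
    mdifferentiableAt_extChartAt (I := 𝓡 m) (mem_chart_source _ _)
  have h3 := mfderiv_comp_mfderivWithin (I := 𝓘(ℝ, F)) z hd
    ((hf z hz).mdifferentiableWithinAt (by simp)) (hs z hz).uniqueMDiffWithinAt
  have h4 : ∀ x : F, (mfderiv (𝓡 m) 𝓘(ℝ, EuclideanSpace ℝ (Fin m)) (extChartAt (𝓡 m) (f z)) (f z) :
      EuclideanSpace ℝ (Fin m) →L[ℝ] EuclideanSpace ℝ (Fin m)) (mderivWithin m f s z x) =
      fderivWithin ℝ (coordExpr m (f z) f) s z x := by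
    intro x
    have h5 : mfderivWithin 𝓘(ℝ, F) 𝓘(ℝ, EuclideanSpace ℝ (Fin m))
      ((extChartAt (𝓡 m) (f z)) ∘ f) s z = fderivWithin ℝ (coordExpr m (f z) f) s z :=
      mfderivWithin_eq_fderivWithin
    rw [← h5, h3]; rfl
  have h5 : η.extd.pull f s ![w, v] z =
      extDeriv (η.inChart (f z)) (coordExpr m (f z) f z) fun i =>
        (mfderiv (𝓡 m) 𝓘(ℝ, EuclideanSpace ℝ (Fin m)) (extChartAt (𝓡 m) (f z)) (f z) :
          EuclideanSpace ℝ (Fin m) →L[ℝ] EuclideanSpace ℝ (Fin m))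
          (mderivWithin m f s z (![w, v] i)) := rfl
  rw [h5]
  simp only [h4]
  rw [extDeriv, ContinuousAlternatingMap.alternatizeUncurryFin_apply, Fin.sum_univ_two]
  have e0 : Fin.removeNth (0 : Fin 2)
      (fun i => fderivWithin ℝ (coordExpr m (f z) f) s z (![w, v] i)) =
      fun _ => fderivWithin ℝ (coordExpr m (f z) f) s z v := by
    ext i; fin_cases i; rfl
  have e1 : Fin.removeNth (1 : Fin 2)
      (fun i => fderivWithin ℝ (coordExpr m (f z) f) s z (![w, v] i)) =
      fun _ => fderivWithin ℝ (coordExpr m (f z) f) s z w := by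
    ext i; fin_cases i; rfl
  rw [e0, e1, ← h2, ← h2]
  simp [sub_eq_add_neg]

theorem MForm.contDiffOn_pull (hs : UniqueDiffOn ℝ s) (hf : ContMDiffOn 𝓘(ℝ, F) (𝓡 m) ∞ f s)
    {η : MForm m M 1 V} (hη : SmoothForm η) (v : F) :
    ContDiffOn ℝ 1 (η.pull f s fun _ => v) s := by
  intro z₀ hz₀
  have hp := mem_extChartAt_source (I := 𝓡 m) (f z₀)
  have ht := (extChartAt (𝓡 m) (f z₀)).map_source hp
  have hu := contDiffWithinAt_coordExpr hf hz₀ hp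
  have h0 : ContDiffAt ℝ 1 (η.oneInChart (f z₀)) (coordExpr m (f z₀) f z₀) :=
    ((ContinuousLinearEquiv.contDiff _).contDiffAt.comp _ (hη.contDiffAt_inChart ht)).of_le
      (by simp)
  have h1 : ContDiffWithinAt ℝ 1 (fun z => η.oneInChart (f z₀) (coordExpr m (f z₀) f z)) s z₀ :=
    ContDiffAt.comp_contDiffWithinAt (f := coordExpr m (f z₀) f) z₀ h0 (hu.of_le (by simp))
  have h2 : ContDiffWithinAt ℝ 1 (fun z => fderivWithin ℝ (coordExpr m (f z₀) f) s z v) s z₀ :=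
    (hu.fderivWithin_right (m := 1) hs (by exact two_le_smooth) hz₀).clm_apply
      contDiffWithinAt_const
  refine (h1.clm_apply h2).congr_of_eventuallyEq_of_mem ?_ hz₀
  filter_upwards [eventually_mem_chart_source hf hz₀, self_mem_nhdsWithin] with z h4 h5
  exact η.pull_eq hs hf h5 h4 fun _ => v

/-- Pullback commutes with the exterior derivative. -/
theorem MForm.fderivWithin_pull_sub (hs : UniqueDiffOn ℝ s) (hsi : s ⊆ closure (interior s))
    (hf : ContMDiffOn 𝓘(ℝ, F) (𝓡 m) ∞ f s)
    {η : MForm m M 1 V} (hη : SmoothForm η) {z : F} (hz : z ∈ s) (v w : F) :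
    fderivWithin ℝ (η.pull f s fun _ => v) s z w - fderivWithin ℝ (η.pull f s fun _ => w) s z v =
      η.extd.pull f s ![w, v] z := by
  have hp := mem_extChartAt_source (I := 𝓡 m) (f z)
  have ht : coordExpr m (f z) f z ∈ (extChartAt (𝓡 m) (f z)).target :=
    (extChartAt (𝓡 m) (f z)).map_source hp
  have hu := contDiffWithinAt_coordExpr hf hz hp
  have h1 := (MForm.hasFDerivAt_oneInChart hη ht).1
  set u := coordExpr m (f z) f with hu_def
  have hu1 : HasFDerivWithinAt u (fderivWithin ℝ u s z) s z :=
    (hu.differentiableWithinAt (by simp)).hasFDerivWithinAt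
  have hu2 : HasFDerivWithinAt (fderivWithin ℝ u s) (fderivWithin ℝ (fderivWithin ℝ u s) s z) s z :=
    ((hu.fderivWithin_right (m := 1) hs (by exact two_le_smooth) hz).differentiableWithinAt
      (by simp)).hasFDerivWithinAt
  -- Symmetry of the second derivative also holds at boundary points, as limits of interior points
  -- of `s`.
  have hsymm : IsSymmSndFDerivWithinAt ℝ u s z :=
    hu.isSymmSndFDerivWithinAt (by simpa using two_le_smooth) hs (hsi hz) hz
  -- Product rule in the chart. Its second term contains the second derivative of the coordinate
  -- expression and cancels in the antisymmetrization by `hsymm`.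
  have key : ∀ v w, fderivWithin ℝ (η.pull f s fun _ => v) s z w =
      fderiv ℝ (η.oneInChart (f z)) (u z) (fderivWithin ℝ u s z w) (fderivWithin ℝ u s z v) +
        η.oneInChart (f z) (u z) (fderivWithin ℝ (fderivWithin ℝ u s) s z w v) := by
    intro v w
    have h2 : HasFDerivWithinAt (fun z' => η.oneInChart (f z) (u z'))
        (fderiv ℝ (η.oneInChart (f z)) (u z) ∘L fderivWithin ℝ u s z) s z :=
      HasFDerivAt.comp_hasFDerivWithinAt (g := η.oneInChart (f z)) (f := u) z h1 hu1
    have h3 : HasFDerivWithinAt (fun z' => fderivWithin ℝ u s z' v)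
        ((fderivWithin ℝ (fderivWithin ℝ u s) s z).flip v) s z :=
      (hu2.clm_apply (hasFDerivWithinAt_const v z s)).congr_fderiv (by ext; simp)
    have h4 := h2.clm_apply h3
    have h5 : η.pull f s (fun _ => v) =ᶠ[𝓝[s] z]
        fun z' => η.oneInChart (f z) (u z') (fderivWithin ℝ u s z' v) := by
      filter_upwards [eventually_mem_chart_source hf hz, self_mem_nhdsWithin] with z' h4 h5
      exact η.pull_eq hs hf h5 h4 fun _ => v
    have h6 := (h4.congr_of_eventuallyEq h5 (h5.self_of_nhdsWithin hz)).fderivWithin (hs z hz)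
    rw [h6]
    simp [add_comm]
  rw [key, key, MForm.extd_apply_pull hs hf hη hz, hsymm v w]
  abel

end Pullback

/-! ### Functions on the unit square -/

section UnitSquare

/-- The unit square. -/
def unitSquare : Set (ℝ × ℝ) := Icc 0 1 ×ˢ Icc 0 1

/-- The retraction of `ℝ` onto the unit interval. -/
def unitClip (t : ℝ) : ℝ := projIcc (0 : ℝ) 1 zero_le_one t

theorem unitClip_mem (t : ℝ) : unitClip t ∈ Icc (0 : ℝ) 1 := (projIcc (0 : ℝ) 1 zero_le_one t).2

theorem unitClip_of_mem {t : ℝ} (ht : t ∈ Icc (0 : ℝ) 1) : unitClip t = t := by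
  rw [unitClip, projIcc_of_mem _ ht]

theorem continuous_unitClip : Continuous unitClip :=
  continuous_subtype_val.comp continuous_projIcc

theorem uniqueDiffOn_unitSquare : UniqueDiffOn ℝ unitSquare :=
  (uniqueDiffOn_Icc zero_lt_one).prod (uniqueDiffOn_Icc zero_lt_one)

theorem unitSquare_subset_closure_interior : unitSquare ⊆ closure (interior unitSquare) := by
  rw [unitSquare, interior_prod_eq, closure_prod_eq, interior_Icc, closure_Ioo zero_ne_one]

variable {V : Type*} [NormedAddCommGroup V] [NormedSpace ℝ V]

/-- Composition with the retraction yields functions continuous on the whole plane, as `SquareData`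
requires; derivatives are only claimed within `[0,1]`, where nothing changes. -/
theorem ContinuousOn.comp_unitClip {X : Type*} [TopologicalSpace X] {g : ℝ × ℝ → X}
    (hg : ContinuousOn g unitSquare) :
    Continuous fun z : ℝ × ℝ => g (unitClip z.1, unitClip z.2) :=
  hg.comp_continuous ((continuous_unitClip.comp continuous_fst).prodMk
    (continuous_unitClip.comp continuous_snd)) fun _ => ⟨unitClip_mem _, unitClip_mem _⟩

theorem ContDiffOn.hasDerivWithinAt_fst {g : ℝ × ℝ → V} (hg : ContDiffOn ℝ 1 g unitSquare) {τ σ : ℝ}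
    (hτ : τ ∈ Icc (0 : ℝ) 1) (hσ : σ ∈ Icc (0 : ℝ) 1) :
    HasDerivWithinAt (fun τ => g (unitClip τ, unitClip σ))
      (fderivWithin ℝ g unitSquare (unitClip τ, unitClip σ) (1, 0)) (Icc 0 1) τ := by
  have h1 : HasFDerivWithinAt g (fderivWithin ℝ g unitSquare (τ, σ)) unitSquare (τ, σ) :=
    ((hg (τ, σ) ⟨hτ, hσ⟩).differentiableWithinAt one_ne_zero).hasFDerivWithinAt
  have h2 : HasDerivWithinAt (fun τ : ℝ => (τ, σ)) ((1 : ℝ), (0 : ℝ)) (Icc 0 1) τ :=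
    (hasDerivWithinAt_id τ _).prodMk (hasDerivWithinAt_const τ _ σ)
  have h3 := HasFDerivWithinAt.comp_hasDerivWithinAt (l := g) (f := fun τ : ℝ => (τ, σ)) τ h1 h2
    fun τ' hτ' => ⟨hτ', hσ⟩
  rw [unitClip_of_mem hτ, unitClip_of_mem hσ]
  exact h3.congr (fun t ht => by simp [unitClip_of_mem ht]) (by simp [unitClip_of_mem hτ])

theorem ContDiffOn.hasDerivWithinAt_snd {g : ℝ × ℝ → V} (hg : ContDiffOn ℝ 1 g unitSquare) {τ σ : ℝ}
    (hτ : τ ∈ Icc (0 : ℝ) 1) (hσ : σ ∈ Icc (0 : ℝ) 1) :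
    HasDerivWithinAt (fun σ => g (unitClip τ, unitClip σ))
      (fderivWithin ℝ g unitSquare (unitClip τ, unitClip σ) (0, 1)) (Icc 0 1) σ := by
  have h1 : HasFDerivWithinAt g (fderivWithin ℝ g unitSquare (τ, σ)) unitSquare (τ, σ) :=
    ((hg (τ, σ) ⟨hτ, hσ⟩).differentiableWithinAt one_ne_zero).hasFDerivWithinAt
  have h2 : HasDerivWithinAt (fun σ : ℝ => (τ, σ)) ((0 : ℝ), (1 : ℝ)) (Icc 0 1) σ :=
    (hasDerivWithinAt_const σ _ τ).prodMk (hasDerivWithinAt_id σ _)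
  have h3 := HasFDerivWithinAt.comp_hasDerivWithinAt (l := g) (f := fun σ : ℝ => (τ, σ)) σ h1 h2
    fun σ' hσ' => ⟨hτ, hσ'⟩
  rw [unitClip_of_mem hτ, unitClip_of_mem hσ]
  exact h3.congr (fun t ht => by simp [unitClip_of_mem ht]) (by simp [unitClip_of_mem hσ])

theorem ContDiffOn.continuousOn_fderivWithin_apply_unitSquare {g : ℝ × ℝ → V}
    (hg : ContDiffOn ℝ 1 g unitSquare) (v : ℝ × ℝ) :
    ContinuousOn (fun z => fderivWithin ℝ g unitSquare z v) unitSquare :=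
  (hg.continuousOn_fderivWithin uniqueDiffOn_unitSquare le_rfl).clm_apply continuousOn_const

end UnitSquare

/-! ### Velocities of curves in path space -/

section Velocity

variable {m : ℕ} {M : Type*} [TopologicalSpace M] [ChartedSpace (EuclideanSpace ℝ (Fin m)) M]
  {s t : M} {S : ℝ → ℝ → M}

/-- The velocity of a curve, in the model space. -/
def modelVelocity (m : ℕ) {M : Type*} [TopologicalSpace M]
    [ChartedSpace (EuclideanSpace ℝ (Fin m)) M] (X : ℝ → M) (σ : ℝ) : EuclideanSpace ℝ (Fin m) :=
  velocity m X σ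

/-- The curve in path space as a map on the plane. -/
def squareMap (S : ℝ → ℝ → M) (z : ℝ × ℝ) : M := S z.1 z.2

theorem mdifferentiableWithinAt_squareMap (hS : IsPathSpaceCurve m s t S) {z : ℝ × ℝ}
    (hz : z ∈ unitSquare) :
    MDifferentiableWithinAt 𝓘(ℝ, ℝ × ℝ) (𝓡 m) (squareMap S) unitSquare z :=
  (hS.smooth z hz).mdifferentiableWithinAt (by simp)

theorem modelVelocity_comp (hS : IsPathSpaceCurve m s t S) {γ : ℝ → ℝ × ℝ} {v : ℝ × ℝ}
    (hγ : ∀ r ∈ Icc (0 : ℝ) 1, γ r ∈ unitSquare ∧ HasDerivWithinAt γ v (Icc 0 1) r) {r : ℝ}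
    (hr : r ∈ Icc (0 : ℝ) 1) :
    modelVelocity m (fun r => squareMap S (γ r)) r =
      mderivWithin m (squareMap S) unitSquare (γ r) v := by
  have h1 : HasMFDerivWithinAt 𝓘(ℝ, ℝ × ℝ) (𝓡 m) (squareMap S) unitSquare (γ r)
      (mderivWithin m (squareMap S) unitSquare (γ r)) :=
    (mdifferentiableWithinAt_squareMap hS (hγ r hr).1).hasMFDerivWithinAt
  have h2 : HasMFDerivWithinAt 𝓘(ℝ, ℝ) 𝓘(ℝ, ℝ × ℝ) γ (Icc 0 1) r
      ((1 : ℝ →L[ℝ] ℝ).smulRight v) := (hγ r hr).2.hasFDerivWithinAt.hasMFDerivWithinAt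
  have h3 := HasMFDerivWithinAt.comp r h1 h2 fun r' hr' => (hγ r' hr').1
  have h4 := h3.mfderivWithin (uniqueDiffOn_Icc zero_lt_one r hr).uniqueMDiffWithinAt
  have h5 : modelVelocity m (fun r => squareMap S (γ r)) r =
      (mderivWithin m (squareMap S) unitSquare (γ r) ∘L (1 : ℝ →L[ℝ] ℝ).smulRight v) 1 :=
    DFunLike.congr_fun h4 (1 : ℝ)
  rw [h5]; simp

theorem modelVelocity_path (hS : IsPathSpaceCurve m s t S) {τ σ : ℝ} (hτ : τ ∈ Icc (0 : ℝ) 1)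
    (hσ : σ ∈ Icc (0 : ℝ) 1) :
    modelVelocity m (S τ) σ = mderivWithin m (squareMap S) unitSquare (τ, σ) (0, 1) :=
  modelVelocity_comp hS (γ := fun σ => (τ, σ)) (fun σ hσ => ⟨⟨hτ, hσ⟩,
    (hasDerivWithinAt_const σ _ τ).prodMk (hasDerivWithinAt_id σ _)⟩) hσ

theorem modelVelocity_transverse (hS : IsPathSpaceCurve m s t S) {τ σ : ℝ}
    (hτ : τ ∈ Icc (0 : ℝ) 1) (hσ : σ ∈ Icc (0 : ℝ) 1) :
    modelVelocity m (fun τ => S τ σ) τ = mderivWithin m (squareMap S) unitSquare (τ, σ) (1, 0) :=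
  modelVelocity_comp hS (γ := fun τ => (τ, σ)) (fun τ hτ => ⟨⟨hτ, hσ⟩,
    (hasDerivWithinAt_id τ _).prodMk (hasDerivWithinAt_const τ _ σ)⟩) hτ

/-- All paths of the curve share their end points, so the curve in `τ` is constant at `σ = 0` and `σ
= 1`. -/
theorem mderivWithin_transverse_eq_zero (hS : IsPathSpaceCurve m s t S) {τ σ : ℝ}
    (hτ : τ ∈ Icc (0 : ℝ) 1) (hσ : σ = 0 ∨ σ = 1) :
    mderivWithin m (squareMap S) unitSquare (τ, σ) (1, 0) = 0 := by
  have h0 : (0 : ℝ) ∈ Icc (0 : ℝ) 1 := ⟨le_rfl, zero_le_one⟩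
  have h1 : (1 : ℝ) ∈ Icc (0 : ℝ) 1 := ⟨zero_le_one, le_rfl⟩
  have hσ' : σ ∈ Icc (0 : ℝ) 1 := by rcases hσ with rfl | rfl <;> assumption
  rw [← modelVelocity_transverse hS hτ hσ']
  obtain ⟨x, hx⟩ : ∃ x, ∀ τ ∈ Icc (0 : ℝ) 1, S τ σ = x := by
    rcases hσ with rfl | rfl
    · exact ⟨s, fun τ hτ => (hS.based τ hτ).source.self_of_nhdsWithin h0⟩
    · exact ⟨t, fun τ hτ => (hS.based τ hτ).target.self_of_nhdsWithin h1⟩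
  have h2 : mfderivWithin 𝓘(ℝ, ℝ) (𝓡 m) (fun τ => S τ σ) (Icc 0 1) τ =
      mfderivWithin 𝓘(ℝ, ℝ) (𝓡 m) (fun _ : ℝ => x) (Icc 0 1) τ :=
    mfderivWithin_congr hx (hx τ hτ)
  rw [mfderivWithin_const] at h2
  exact DFunLike.congr_fun h2 (1 : ℝ)

end Velocity

/-! ### The crossed module as continuous bilinear maps -/

section CrossedModule

variable {p : ℕ} {G : Type*} [TopologicalSpace G] [ChartedSpace (EuclideanSpace ℝ (Fin p)) G]
  [Group G] [LieGroup (𝓡 p) ∞ G]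
  {q : ℕ} {H : Type*} [TopologicalSpace H] [ChartedSpace (EuclideanSpace ℝ (Fin q)) H]
  [Group H] [LieGroup (𝓡 q) ∞ H]
  (𝒞 : DifferentialCrossedModule (GroupLieAlgebra (𝓡 p) G) (GroupLieAlgebra (𝓡 q) H))

instance instCompleteSpaceGroupLieAlgebra : CompleteSpace (GroupLieAlgebra (𝓡 q) H) :=
  FiniteDimensional.complete ℝ _

/-- The action of the crossed module as a continuous bilinear map. -/
def actionCLM : GroupLieAlgebra (𝓡 p) G →L[ℝ]
    GroupLieAlgebra (𝓡 q) H →L[ℝ] GroupLieAlgebra (𝓡 q) H :=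
  LinearMap.toContinuousLinearMap ((LinearMap.toContinuousLinearMap :
    (GroupLieAlgebra (𝓡 q) H →ₗ[ℝ] GroupLieAlgebra (𝓡 q) H) ≃ₗ[ℝ] _).toLinearMap ∘ₗ 𝒞.action)

theorem actionCLM_apply (x : GroupLieAlgebra (𝓡 p) G) (y : GroupLieAlgebra (𝓡 q) H) :
    actionCLM 𝒞 x y = 𝒞.dα x y := rfl

variable (q H) in
/-- The Lie bracket as a continuous bilinear map. -/
def bracketCLM : GroupLieAlgebra (𝓡 q) H →L[ℝ]
    GroupLieAlgebra (𝓡 q) H →L[ℝ] GroupLieAlgebra (𝓡 q) H :=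
  LinearMap.toContinuousLinearMap ((LinearMap.toContinuousLinearMap :
    (GroupLieAlgebra (𝓡 q) H →ₗ[ℝ] GroupLieAlgebra (𝓡 q) H) ≃ₗ[ℝ] _).toLinearMap ∘ₗ
      bracketBilin (GroupLieAlgebra (𝓡 q) H))

theorem bracketCLM_apply (x y : GroupLieAlgebra (𝓡 q) H) : bracketCLM q H x y = ⁅x, y⁆ := rfl

theorem bracketCLM_jacobi (x y z : GroupLieAlgebra (𝓡 q) H) :
    bracketCLM q H x (bracketCLM q H y z) =
      bracketCLM q H (bracketCLM q H x y) z + bracketCLM q H y (bracketCLM q H x z) :=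
  leibniz_lie x y z

theorem actionCLM_bracketCLM (x : GroupLieAlgebra (𝓡 p) G) (y z : GroupLieAlgebra (𝓡 q) H) :
    actionCLM 𝒞 x (bracketCLM q H y z) =
      bracketCLM q H (actionCLM 𝒞 x y) z + bracketCLM q H y (actionCLM 𝒞 x z) :=
  ((𝒞.dα x).apply_lie_eq_add y z).trans (add_comm _ _)

theorem actionCLM_lie (x y : GroupLieAlgebra (𝓡 p) G) (z : GroupLieAlgebra (𝓡 q) H) :
    actionCLM 𝒞 ⁅x, y⁆ z =
      actionCLM 𝒞 x (actionCLM 𝒞 y z) - actionCLM 𝒞 y (actionCLM 𝒞 x z) := by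
  rw [actionCLM_apply, LieHom.map_lie]
  exact LieDerivation.commutator_apply z

theorem actionCLM_dt (y z : GroupLieAlgebra (𝓡 q) H) :
    actionCLM 𝒞 (𝒞.dt y) z = bracketCLM q H y z := 𝒞.dα_dt y z

end CrossedModule

/-! ### Flat connections on path space along a curve -/

section FlatConnection

variable {m : ℕ} {M : Type*} [TopologicalSpace M] [ChartedSpace (EuclideanSpace ℝ (Fin m)) M]
  {p : ℕ} {G : Type*} [TopologicalSpace G] [ChartedSpace (EuclideanSpace ℝ (Fin p)) G]
  [Group G] [LieGroup (𝓡 p) ∞ G]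
  {q : ℕ} {H : Type*} [TopologicalSpace H] [ChartedSpace (EuclideanSpace ℝ (Fin q)) H]
  [Group H] [LieGroup (𝓡 q) ∞ H]
  (𝒞 : DifferentialCrossedModule (GroupLieAlgebra (𝓡 p) G) (GroupLieAlgebra (𝓡 q) H))

theorem covExtd_pull {F : Type*} [NormedAddCommGroup F] [NormedSpace ℝ F]
    (A : MForm m M 1 (GroupLieAlgebra (𝓡 p) G)) (a : MForm m M 1 (GroupLieAlgebra (𝓡 q) H))
    (f : F → M) (s : Set F) (w v : F) (z : F) :
    (covExtd 𝒞 A a).pull f s ![w, v] z = a.extd.pull f s ![w, v] z +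
      (actionCLM 𝒞 (A.pull f s (fun _ => w) z) (a.pull f s (fun _ => v) z) -
        actionCLM 𝒞 (A.pull f s (fun _ => v) z) (a.pull f s (fun _ => w) z)) := rfl

theorem wedgeSelf_pull {F : Type*} [NormedAddCommGroup F] [NormedSpace ℝ F]
    (a : MForm m M 1 (GroupLieAlgebra (𝓡 q) H)) (f : F → M) (s : Set F) (w v : F) (z : F) :
    (wedgeSelf a).pull f s ![w, v] z =
      bracketCLM q H (a.pull f s (fun _ => w) z) (a.pull f s (fun _ => v) z) := by
  have h : (wedgeSelf a).pull f s ![w, v] z = (1 / 2 : ℝ) •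
      (⁅a.pull f s (fun _ => w) z, a.pull f s (fun _ => v) z⁆ -
        ⁅a.pull f s (fun _ => v) z, a.pull f s (fun _ => w) z⁆) := rfl
  rw [h, bracketCLM_apply, ← lie_skew (a.pull f s (fun _ => w) z)]
  module

theorem fakeCurvature_pull {F : Type*} [NormedAddCommGroup F] [NormedSpace ℝ F]
    (A : MForm m M 1 (GroupLieAlgebra (𝓡 p) G)) (B : MForm m M 2 (GroupLieAlgebra (𝓡 q) H))
    (f : F → M) (s : Set F) (w v : F) (z : F) :
    (fakeCurvature 𝒞 A B).pull f s ![w, v] z = A.extd.pull f s ![w, v] z +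
      ⁅A.pull f s (fun _ => w) z, A.pull f s (fun _ => v) z⁆ + 𝒞.dt (B.pull f s ![w, v] z) := by
  have h : (fakeCurvature 𝒞 A B).pull f s ![w, v] z = A.extd.pull f s ![w, v] z +
      (1 / 2 : ℝ) • (⁅A.pull f s (fun _ => w) z, A.pull f s (fun _ => v) z⁆ -
        ⁅A.pull f s (fun _ => v) z, A.pull f s (fun _ => w) z⁆) + 𝒞.dt (B.pull f s ![w, v] z) := rfl
  rw [h, ← lie_skew (A.pull f s (fun _ => w) z)]
  module

theorem MForm.pull_transverse_eq_zero {V : Type*} [NormedAddCommGroup V] [NormedSpace ℝ V]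
    (η : MForm m M 1 V) {s t : M} {S : ℝ → ℝ → M} (hS : IsPathSpaceCurve m s t S) {τ σ : ℝ}
    (hσ : σ = 0 ∨ σ = 1) :
    η.pull (squareMap S) unitSquare (fun _ => (1, 0)) (unitClip τ, unitClip σ) = 0 := by
  have h1 : unitClip σ = σ := by
    rcases hσ with rfl | rfl
    · exact unitClip_of_mem ⟨le_rfl, zero_le_one⟩
    · exact unitClip_of_mem ⟨zero_le_one, le_rfl⟩
  rw [h1, MForm.pull, mderivWithin_transverse_eq_zero hS (unitClip_mem τ) hσ]
  exact (η.modelValue _).map_zero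

variable [IsManifold (𝓡 m) ∞ M]
  {A : MForm m M 1 (GroupLieAlgebra (𝓡 p) G)} (hA : SmoothForm A)
  {B : MForm m M 2 (GroupLieAlgebra (𝓡 q) H)} (hB : SmoothForm B)
  (hflat : fakeCurvature 𝒞 A B = 0)
  {a : MForm m M 1 (GroupLieAlgebra (𝓡 q) H)} (ha : SmoothForm a)
  {s t : M} {S : ℝ → ℝ → M} (hS : IsPathSpaceCurve m s t S)

/-- The pullbacks of `A`, `B` and `a` to the unit square. -/
def squareData : SquareData (GroupLieAlgebra (𝓡 q) H) :=
  have hu := uniqueDiffOn_unitSquare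
  have hf : ContMDiffOn 𝓘(ℝ, ℝ × ℝ) (𝓡 m) ∞ (squareMap S) unitSquare := hS.smooth
  have hAd := fun v => MForm.contDiffOn_pull hu hf hA v
  have had := fun v => MForm.contDiffOn_pull hu hf ha v
  have hkd := fun v => ((actionCLM 𝒞).contDiff (n := 1)).comp_contDiffOn (hAd v)
  { br := bracketCLM q H
    br_self := fun x => lie_self x
    jacobi := bracketCLM_jacobi
    k := fun τ σ => actionCLM 𝒞
      (A.pull (squareMap S) unitSquare (fun _ => (0, 1)) (unitClip τ, unitClip σ))
    kt := fun τ σ => actionCLM 𝒞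
      (A.pull (squareMap S) unitSquare (fun _ => (1, 0)) (unitClip τ, unitClip σ))
    dk := fun τ σ => fderivWithin ℝ (actionCLM 𝒞 ∘ A.pull (squareMap S) unitSquare fun _ => (0, 1))
      unitSquare (unitClip τ, unitClip σ) (1, 0)
    dkt := fun τ σ => fderivWithin ℝ (actionCLM 𝒞 ∘ A.pull (squareMap S) unitSquare fun _ => (1, 0))
      unitSquare (unitClip τ, unitClip σ) (0, 1)
    a := fun τ σ => a.pull (squareMap S) unitSquare (fun _ => (0, 1)) (unitClip τ, unitClip σ)
    at' := fun τ σ => a.pull (squareMap S) unitSquare (fun _ => (1, 0)) (unitClip τ, unitClip σ)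
    da := fun τ σ => fderivWithin ℝ (a.pull (squareMap S) unitSquare fun _ => (0, 1)) unitSquare
      (unitClip τ, unitClip σ) (1, 0)
    dat := fun τ σ => fderivWithin ℝ (a.pull (squareMap S) unitSquare fun _ => (1, 0)) unitSquare
      (unitClip τ, unitClip σ) (0, 1)
    b := fun τ σ => B.pull (squareMap S) unitSquare ![(0, 1), (1, 0)] (unitClip τ, unitClip σ)
    continuous_k := (hkd _).continuousOn.comp_unitClip
    continuous_kt := (hkd _).continuousOn.comp_unitClip
    continuous_dk := ((hkd _).continuousOn_fderivWithin_apply_unitSquare _).comp_unitClip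
    continuous_a := (had _).continuousOn.comp_unitClip
    continuous_at := (had _).continuousOn.comp_unitClip
    continuous_da := ((had _).continuousOn_fderivWithin_apply_unitSquare _).comp_unitClip
    continuous_dat := ((had _).continuousOn_fderivWithin_apply_unitSquare _).comp_unitClip
    continuous_b := (MForm.continuousOn_pull hu hf hB _).comp_unitClip
    hasDeriv_k := fun τ hτ σ hσ => (hkd _).hasDerivWithinAt_fst hτ hσ
    hasDeriv_kt := fun τ hτ σ hσ => (hkd _).hasDerivWithinAt_snd hτ hσ
    hasDeriv_a := fun τ hτ σ hσ => (had _).hasDerivWithinAt_fst hτ hσ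
    hasDeriv_at := fun τ hτ σ hσ => (had _).hasDerivWithinAt_snd hτ hσ
    derivation_k := fun τ _ σ _ x y => actionCLM_bracketCLM 𝒞 _ x y
    derivation_kt := fun τ _ σ _ x y => actionCLM_bracketCLM 𝒞 _ x y
    flat := by
      intro τ hτ σ hσ x
      have hz : (unitClip τ, unitClip σ) ∈ unitSquare := ⟨unitClip_mem _, unitClip_mem _⟩
      set z := (unitClip τ, unitClip σ)
      have h1 : ∀ v, HasFDerivWithinAt (A.pull (squareMap S) unitSquare fun _ => v)
          (fderivWithin ℝ (A.pull (squareMap S) unitSquare fun _ => v) unitSquare z)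
          unitSquare z := fun v =>
        (((hAd v) z hz).differentiableWithinAt one_ne_zero).hasFDerivWithinAt
      have h2 : ∀ v w, fderivWithin ℝ (actionCLM 𝒞 ∘ A.pull (squareMap S) unitSquare fun _ => v)
          unitSquare z w =
          actionCLM 𝒞 (fderivWithin ℝ (A.pull (squareMap S) unitSquare fun _ => v)
            unitSquare z w) := fun v w => by
        rw [((actionCLM 𝒞).hasFDerivAt.comp_hasFDerivWithinAt z (h1 v)).fderivWithin (hu z hz)]
        rfl
      have h3 := MForm.fderivWithin_pull_sub hu unitSquare_subset_closure_interior hf hA hz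
        (1, 0) (0, 1)
      have h4 := fakeCurvature_pull 𝒞 A B (squareMap S) unitSquare (0, 1) (1, 0) z
      have h5 : (fakeCurvature 𝒞 A B).pull (squareMap S) unitSquare ![(0, 1), (1, 0)] z = 0 := by
        rw [hflat]; rfl
      rw [h5, ← h3] at h4
      -- The action of the fake curvature equation on `x`: `dα` turns the bracket of `𝔤` into a
      -- commutator and `dt B` into `ad B`.
      have h6 := congrArg (fun y => actionCLM 𝒞 y x) h4
      simp only [map_add, map_sub, map_zero, add_apply, sub_apply, zero_apply, actionCLM_dt,
        actionCLM_lie] at h6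
      rw [h2, h2]
      rw [eq_comm, ← sub_eq_zero] at h6 ⊢
      rw [← h6]
      abel
    kt_one := fun τ _ => by
      rw [A.pull_transverse_eq_zero hS (Or.inr rfl), map_zero]
    at_zero := fun τ _ => a.pull_transverse_eq_zero hS (Or.inl rfl)
    at_one := fun τ _ => a.pull_transverse_eq_zero hS (Or.inr rfl) }

omit [IsManifold (𝓡 m) ∞ M] in
-- Agreement of the generators on `[0,1]` suffices, since all integrals run inside this interval.
theorem transportTerm_eq_dysonTerm {P : Type*} {k : P → ℝ → GroupLieAlgebra (𝓡 q) H →L[ℝ]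
    GroupLieAlgebra (𝓡 q) H} {r : P} {A : MForm m M 1 (GroupLieAlgebra (𝓡 p) G)} {X : ℝ → M}
    (h : ∀ ρ ∈ Icc (0 : ℝ) 1, actionCLM 𝒞 (A.linearAt (X ρ) (velocity m X ρ)) = k r ρ) {σ : ℝ}
    (hσ : σ ∈ Icc (0 : ℝ) 1) (y : GroupLieAlgebra (𝓡 q) H) (n : ℕ) :
    ∀ τ ∈ Icc (0 : ℝ) 1,
      transportTerm 𝒞 A X σ y n τ = dysonTerm (fun p ρ => -k p ρ) σ y n r τ := by
  induction n with
  | zero => exact fun _ _ => rfl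
  | succ n ih =>
    intro τ hτ
    refine intervalIntegral.integral_congr fun ρ hρ => ?_
    have hρ' : ρ ∈ Icc (0 : ℝ) 1 := uIcc_subset_Icc hσ hτ hρ
    change actionCLM 𝒞 (-(A.linearAt (X ρ) (velocity m X ρ))) (transportTerm 𝒞 A X σ y n ρ) = _
    rw [map_neg, h ρ hρ', ih ρ hρ']

omit [IsManifold (𝓡 m) ∞ M] in
theorem transport_eq_linearTransport {P : Type*} [TopologicalSpace P] [WeaklyLocallyCompactSpace P]
    {k : P → ℝ → GroupLieAlgebra (𝓡 q) H →L[ℝ] GroupLieAlgebra (𝓡 q) H}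
    (hk : Continuous fun z : P × ℝ => k z.1 z.2) {r : P}
    {A : MForm m M 1 (GroupLieAlgebra (𝓡 p) G)} {X : ℝ → M}
    (h : ∀ ρ ∈ Icc (0 : ℝ) 1, actionCLM 𝒞 (A.linearAt (X ρ) (velocity m X ρ)) = k r ρ) {σ : ℝ}
    (hσ : σ ∈ Icc (0 : ℝ) 1) (y : GroupLieAlgebra (𝓡 q) H) :
    transport 𝒞 A X σ y = linearTransport k r σ y := by
  rw [← dysonSum_neg_one_eq_linearTransport hk r σ y]
  exact tsum_congr fun n => transportTerm_eq_dysonTerm 𝒞 h hσ y n 1 ⟨zero_le_one, le_rfl⟩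

omit [IsManifold (𝓡 m) ∞ M] in
theorem MForm.linearAt_velocity {V : Type*} [NormedAddCommGroup V] [NormedSpace ℝ V]
    (η : MForm m M 1 V) {τ σ : ℝ} {s t : M} {S : ℝ → ℝ → M} (hS : IsPathSpaceCurve m s t S)
    (hτ : τ ∈ Icc (0 : ℝ) 1) (hσ : σ ∈ Icc (0 : ℝ) 1) :
    η.linearAt (S τ σ) (velocity m (S τ) σ) =
      η.pull (squareMap S) unitSquare (fun _ => (0, 1)) (unitClip τ, unitClip σ) := by
  rw [unitClip_of_mem hτ, unitClip_of_mem hσ, MForm.pull, ← modelVelocity_path hS hτ hσ]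
  rfl

omit [IsManifold (𝓡 m) ∞ M] in
theorem MForm.apply_velocities {V : Type*} [NormedAddCommGroup V] [NormedSpace ℝ V]
    (η : MForm m M 2 V) {τ σ : ℝ} {s t : M} {S : ℝ → ℝ → M} (hS : IsPathSpaceCurve m s t S)
    (hτ : τ ∈ Icc (0 : ℝ) 1) (hσ : σ ∈ Icc (0 : ℝ) 1) :
    η (S τ σ) (Fin.cons (velocity m (S τ) σ) fun _ => pathSpaceVelocity m S τ σ) =
      η.pull (squareMap S) unitSquare ![(0, 1), (1, 0)] (unitClip τ, unitClip σ) := by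
  rw [unitClip_of_mem hτ, unitClip_of_mem hσ, MForm.pull]
  have h : (fun i => mderivWithin m (squareMap S) unitSquare (τ, σ)
      ((![(0, 1), (1, 0)] : Fin 2 → ℝ × ℝ) i)) =
      (Fin.cons (modelVelocity m (S τ) σ) fun _ => modelVelocity m (fun τ => S τ σ) τ :
        Fin 2 → EuclideanSpace ℝ (Fin m)) := by
    rw [modelVelocity_path hS hτ hσ, modelVelocity_transverse hS hτ hσ]
    ext i : 1
    fin_cases i <;> rfl
  rw [h]; rfl

/-- The identity `dα ∘ dt = ad` turns the deformation by `ε dt(a)` into the addition of `ε ad a`, so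
the deformed generator involves only the bracket of `𝔥`. -/
theorem actionCLM_linearAt_velocity {τ ε ρ : ℝ} (hτ : τ ∈ Icc (0 : ℝ) 1) (hρ : ρ ∈ Icc (0 : ℝ) 1) :
    actionCLM 𝒞 ((A + ε • dtForm 𝒞 a).linearAt (S τ ρ) (velocity m (S τ) ρ)) =
      (squareData 𝒞 hA hB hflat ha hS).kE (τ, ε) ρ := by
  rw [MForm.linearAt_velocity _ hS hτ hρ]
  have h : (A + ε • dtForm 𝒞 a).pull (squareMap S) unitSquare (fun _ => (0, 1))
      (unitClip τ, unitClip ρ) =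
      A.pull (squareMap S) unitSquare (fun _ => (0, 1)) (unitClip τ, unitClip ρ) +
        ε • 𝒞.dt (a.pull (squareMap S) unitSquare (fun _ => (0, 1)) (unitClip τ, unitClip ρ)) := rfl
  rw [h, map_add, map_smul]
  have h2 : ∀ y : GroupLieAlgebra (𝓡 q) H, actionCLM 𝒞 (𝒞.dt y) = bracketCLM q H y :=
    fun y => ContinuousLinearMap.ext fun z => actionCLM_dt 𝒞 y z
  rw [h2]
  rfl

theorem chenFunction_eq_gaugeFunction {τ ε : ℝ} (hτ : τ ∈ Icc (0 : ℝ) 1) :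
    chenFunction 𝒞 (A + ε • dtForm 𝒞 a) a (S τ) =
      (squareData 𝒞 hA hB hflat ha hS).gaugeFunction (τ, ε) := by
  refine intervalIntegral.integral_congr fun σ hσ => ?_
  rw [uIcc_of_le zero_le_one] at hσ
  have h2 (D : Fin 0 → TangentSpace (𝓡 m) (S τ σ)) :
      a (S τ σ) (Fin.cons (velocity m (S τ) σ) D) = a.linearAt (S τ σ) (velocity m (S τ) σ) := by
    change a (S τ σ) _ = a (S τ σ) _
    congr 1
    ext i : 1
    fin_cases i; rfl
  refine (congrArg (transport 𝒞 _ (S τ) σ)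
    ((h2 _).trans (a.linearAt_velocity hS hτ hσ))).trans ?_
  exact transport_eq_linearTransport 𝒞 (squareData 𝒞 hA hB hflat ha hS).continuous_kE
    (fun ρ hρ => actionCLM_linearAt_velocity 𝒞 hA hB hflat ha hS hτ hρ) hσ _

/-- Only the component of `B'` on the square matters. The cases needed are `ε = 0` with `B` and `ε =
1` with the transformed form. -/
theorem standardConnection_eq_connection {τ ε : ℝ} (hτ : τ ∈ Icc (0 : ℝ) 1)
    {B' : MForm m M 2 (GroupLieAlgebra (𝓡 q) H)}
    (hB' : ∀ σ, B'.pull (squareMap S) unitSquare ![(0, 1), (1, 0)] (unitClip τ, unitClip σ) =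
      (squareData 𝒞 hA hB hflat ha hS).bE (τ, ε) σ) :
    standardConnection 𝒞 (A + ε • dtForm 𝒞 a) B' (S τ) (pathSpaceVelocity m S τ) =
      (squareData 𝒞 hA hB hflat ha hS).connection (τ, ε) := by
  refine intervalIntegral.integral_congr fun σ hσ => ?_
  rw [uIcc_of_le zero_le_one] at hσ
  have h1 := B'.apply_velocities hS hτ hσ
  simp only
  erw [h1, hB']
  exact transport_eq_linearTransport 𝒞 (squareData 𝒞 hA hB hflat ha hS).continuous_kE
    (fun ρ hρ => actionCLM_linearAt_velocity 𝒞 hA hB hflat ha hS hτ hρ) hσ _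

theorem standardConnection_eq_connection_zero {τ : ℝ} (hτ : τ ∈ Icc (0 : ℝ) 1) :
    standardConnection 𝒞 A B (S τ) (pathSpaceVelocity m S τ) =
      (squareData 𝒞 hA hB hflat ha hS).connection (τ, 0) := by
  have h := standardConnection_eq_connection (ε := 0) 𝒞 hA hB hflat ha hS hτ (B' := B) fun σ => by
    simp [SquareData.bE]; rfl
  rwa [zero_smul, add_zero] at h

theorem standardConnection_eq_connection_one {τ : ℝ} (hτ : τ ∈ Icc (0 : ℝ) 1) :
    standardConnection 𝒞 (A + dtForm 𝒞 a) (B - (covExtd 𝒞 A a + wedgeSelf a)) (S τ)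
      (pathSpaceVelocity m S τ) = (squareData 𝒞 hA hB hflat ha hS).connection (τ, 1) := by
  have h := standardConnection_eq_connection (ε := 1) 𝒞 hA hB hflat ha hS hτ
    (B' := B - (covExtd 𝒞 A a + wedgeSelf a)) fun σ => by
      have hz : (unitClip τ, unitClip σ) ∈ unitSquare := ⟨unitClip_mem _, unitClip_mem _⟩
      have hf : ContMDiffOn 𝓘(ℝ, ℝ × ℝ) (𝓡 m) ∞ (squareMap S) unitSquare := hS.smooth
      have h1 : ∀ z, (B - (covExtd 𝒞 A a + wedgeSelf a)).pull (squareMap S) unitSquare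
          ![(0, 1), (1, 0)] z = B.pull (squareMap S) unitSquare ![(0, 1), (1, 0)] z -
          ((covExtd 𝒞 A a).pull (squareMap S) unitSquare ![(0, 1), (1, 0)] z +
            (wedgeSelf a).pull (squareMap S) unitSquare ![(0, 1), (1, 0)] z) := fun _ => rfl
      rw [h1, covExtd_pull, wedgeSelf_pull,
        ← MForm.fderivWithin_pull_sub uniqueDiffOn_unitSquare
          unitSquare_subset_closure_interior hf ha hz, ← sub_sub]
      simp only [SquareData.bE, one_smul, one_pow]
      rfl
  rwa [one_smul] at h

end FlatConnection

/-! ### Path ordered exponentials and gauge factors -/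

section PathOrdered

variable {q : ℕ} {H : Type*} [TopologicalSpace H] [ChartedSpace (EuclideanSpace ℝ (Fin q)) H]
  [Group H] [LieGroup (𝓡 q) ∞ H] [T2Space H]

omit [T2Space H] in
theorem exists_hasLogDerivWithinAt_of_continuousOn {x : ℝ → EuclideanSpace ℝ (Fin q)}
    (hx : ContinuousOn x (Icc 0 1)) :
    ∃ w : ℝ → H, w 0 = 1 ∧ ∀ τ ∈ Icc (0 : ℝ) 1, HasLogDerivWithinAt w (x τ) (Icc 0 1) τ := by
  obtain ⟨C, hC⟩ := (isCompact_Icc (a := (0 : ℝ)) (b := 1)).exists_bound_of_continuousOn hx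
  have hc : Continuous fun τ => x (unitClip τ) :=
    hx.comp_continuous continuous_unitClip unitClip_mem
  obtain ⟨w, hw0, hw⟩ := exists_hasLogDerivWithinAt (H := H) hc fun τ => hC _ (unitClip_mem τ)
  refine ⟨w, hw0, fun τ hτ => ?_⟩
  have h := hw τ hτ
  rwa [unitClip_of_mem hτ] at h

/-- The connection along the curve is known only through its agreement on `[0,1]` with an explicit
function, and continuity is established for the latter; hence the two functions `x` and `y`. -/
theorem existsUnique_isPathOrderedExp {x y : ℝ → EuclideanSpace ℝ (Fin q)}
    (hx : ContinuousOn x (Icc 0 1)) (hxy : ∀ τ ∈ Icc (0 : ℝ) 1, y τ = x τ) :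
    ∃! h : H, IsPathOrderedExp (q := q) y h := by
  obtain ⟨w, hw0, hw⟩ := exists_hasLogDerivWithinAt_of_continuousOn (H := H) hx
  refine ⟨w 1, isPathOrderedExp_iff.2 ⟨w, hw0, rfl, fun τ hτ => ?_⟩, fun h' hh' => ?_⟩
  · rw [hxy τ hτ]; exact hw τ hτ
  · obtain ⟨w', hw0', rfl, hw'⟩ := isPathOrderedExp_iff.1 hh'
    refine HasLogDerivWithinAt.eq_one_of_eq hx hw0' (fun τ hτ => ?_) hw0 hw
    rw [← hxy τ hτ]; exact hw' τ hτ

end PathOrdered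

/-! ### Gauge factors as product integrals. -/

section GaugeFactor

variable {m : ℕ} {M : Type*} [TopologicalSpace M] [ChartedSpace (EuclideanSpace ℝ (Fin m)) M]
  {p : ℕ} {G : Type*} [TopologicalSpace G] [ChartedSpace (EuclideanSpace ℝ (Fin p)) G]
  [Group G] [LieGroup (𝓡 p) ∞ G]
  {q : ℕ} {H : Type*} [TopologicalSpace H] [ChartedSpace (EuclideanSpace ℝ (Fin q)) H]
  [Group H] [LieGroup (𝓡 q) ∞ H] [T2Space H]
  (𝒞 : DifferentialCrossedModule (GroupLieAlgebra (𝓡 p) G) (GroupLieAlgebra (𝓡 q) H))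
  {A : MForm m M 1 (GroupLieAlgebra (𝓡 p) G)} {a : MForm m M 1 (GroupLieAlgebra (𝓡 q) H)}
  {X : ℝ → M}

theorem isGaugeFactor_of_hasLogDerivWithinAt {x : ℝ → EuclideanSpace ℝ (Fin q)}
    (hx : ContinuousOn x (Icc 0 1))
    (hc : ∀ ε ∈ Icc (0 : ℝ) 1, chenFunction 𝒞 (A + ε • dtForm 𝒞 a) a X = x ε)
    {U : ℝ → H} (hU0 : U 0 = 1)
    (hU : ∀ ε ∈ Icc (0 : ℝ) 1, HasLogDerivWithinAt U (x ε) (Icc 0 1) ε) :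
    IsGaugeFactor 𝒞 A a X (U 1) := by
  have := topologicalGroup_of_lieGroup (𝓡 q) ∞ (G := H)
  intro κ hκ
  have hcj : ∀ N : ℕ, ∀ j ∈ List.range N,
      chenFunction 𝒞 (A + (j / N : ℝ) • dtForm 𝒞 a) a X = x (j / N) := fun N j hj => by
    have hjN : (j : ℝ) ≤ N := by exact_mod_cast (List.mem_range.1 hj).le
    exact hc _ ⟨by positivity, div_le_one_of_le₀ hjN (by positivity)⟩
  have hκ' : IsChartStep (q := q) κ := hκ.isChartStep
  -- In the gauge products the index is a real number and the list `List.range N` is coerced in the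
  -- list monad; this rewrites the coercion as a map.
  have hcast (N : ℕ) : (do let j ← List.range N; pure (j : ℝ)) = (List.range N).map Nat.cast := by
    rw [bind_pure_comp]; rfl
  constructor
  · refine (hκ'.tendsto_prod hx hU0 hU).congr fun N => ?_
    rw [rightGaugeProduct, hcast, List.map_map]
    refine congrArg List.prod (List.map_congr_left fun j hj => ?_)
    rw [Function.comp_apply, hcj N j hj]
    rfl
  -- Inverting the product with steps `κ(-y)⁻¹` reverses the order of the factors and leaves
  -- `κ(-y)`, which is the left product.
  · refine (hκ'.neg_inv.tendsto_prod hx hU0 hU).inv.congr fun N => ?_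
    rw [leftGaugeProduct, hcast, List.prod_inv_reverse, List.map_map, List.map_map]
    refine congrArg (fun l : List H => l.reverse.prod) (List.map_congr_left fun j hj => ?_)
    rw [Function.comp_apply, Function.comp_apply, hcj N j hj]
    exact inv_inv _

omit [T2Space H] in
theorem IsGaugeFactor.isFiniteGaugeTransform {X₀ X₁ : ℝ → M} {U₀ U₁ : H}
    (h₀ : IsGaugeFactor 𝒞 A a X₀ U₀) (h₁ : IsGaugeFactor 𝒞 A a X₁ U₁) (h : H) :
    IsFiniteGaugeTransform 𝒞 A a X₀ X₁ h (U₀⁻¹ * h * U₁) := by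
  have := topologicalGroup_of_lieGroup (𝓡 q) ∞ (G := H)
  exact fun κ hκ => ((h₀ κ hκ).2.mul_const h).mul (h₁ κ hκ).1

end GaugeFactor

/-- `U τ` is the path ordered exponential in `ε` of the gauge function at the path `S τ`. It is
taken for every `τ`, although only `τ = 0, 1` appear in the conclusion, because the holonomy of the
transformed connection is read off from the whole curve `τ ↦ w τ * U τ 1`. -/
theorem mainTheorem9
    {m : ℕ} {M : Type*} [TopologicalSpace M] [ChartedSpace (EuclideanSpace ℝ (Fin m)) M]
    [IsManifold (𝓡 m) ∞ M]
    {p : ℕ} {G : Type*} [TopologicalSpace G] [ChartedSpace (EuclideanSpace ℝ (Fin p)) G]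
    [Group G] [LieGroup (𝓡 p) ∞ G]
    {q : ℕ} {H : Type*} [TopologicalSpace H] [ChartedSpace (EuclideanSpace ℝ (Fin q)) H]
    [Group H] [LieGroup (𝓡 q) ∞ H] [T2Space H]
    (𝒞 : DifferentialCrossedModule (GroupLieAlgebra (𝓡 p) G) (GroupLieAlgebra (𝓡 q) H))
    (A : MForm m M 1 (GroupLieAlgebra (𝓡 p) G)) (hA : SmoothForm A)
    (B : MForm m M 2 (GroupLieAlgebra (𝓡 q) H)) (hB : SmoothForm B)
    (hflat : fakeCurvature 𝒞 A B = 0)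
    (a : MForm m M 1 (GroupLieAlgebra (𝓡 q) H)) (ha : SmoothForm a)
    (s t : M) (S : ℝ → ℝ → M) (hS : IsPathSpaceCurve m s t S) :
    (∃! h : H, IsPathSpaceHolonomy 𝒞 A B S h) ∧
    (∃! h' : H, IsPathSpaceHolonomy 𝒞 (A + dtForm 𝒞 a)
      (B - (covExtd 𝒞 A a + wedgeSelf a)) S h') ∧
    ∃ U₀ U₁ : H, IsGaugeFactor 𝒞 A a (S 0) U₀ ∧ IsGaugeFactor 𝒞 A a (S 1) U₁ ∧
      ∀ h : H, IsPathSpaceHolonomy 𝒞 A B S h →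
        IsFiniteGaugeTransform 𝒞 A a (S 0) (S 1) h (U₀⁻¹ * h * U₁) ∧
        IsPathSpaceHolonomy 𝒞 (A + dtForm 𝒞 a) (B - (covExtd 𝒞 A a + wedgeSelf a)) S
          (U₀⁻¹ * h * U₁) := by
  have := topologicalGroup_of_lieGroup (𝓡 q) ∞ (G := H)
  let D := squareData 𝒞 hA hB hflat ha hS
  let c : ℝ × ℝ → EuclideanSpace ℝ (Fin q) := D.gaugeFunction
  let conn : ℝ × ℝ → EuclideanSpace ℝ (Fin q) := D.connection
  have hc : Continuous c := D.continuous_gaugeFunction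
  have hconn : Continuous conn := D.continuous_connection
  have hconn0 : ContinuousOn (fun τ => conn (τ, 0)) (Icc 0 1) :=
    (hconn.comp (continuous_id.prodMk continuous_const)).continuousOn
  have hconn1 : ContinuousOn (fun τ => conn (τ, 1)) (Icc 0 1) :=
    (hconn.comp (continuous_id.prodMk continuous_const)).continuousOn
  have hcτ (τ : ℝ) : ContinuousOn (fun ε => c (τ, ε)) (Icc 0 1) :=
    (hc.comp (continuous_const.prodMk continuous_id)).continuousOn
  choose U hU0 hU using fun τ => exists_hasLogDerivWithinAt_of_continuousOn (H := H) (hcτ τ)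
  have hfac (τ : ℝ) (hτ : τ ∈ Icc (0 : ℝ) 1) : IsGaugeFactor 𝒞 A a (S τ) (U τ 1) :=
    isGaugeFactor_of_hasLogDerivWithinAt 𝒞 (hcτ τ)
      (fun ε _ => chenFunction_eq_gaugeFunction 𝒞 hA hB hflat ha hS hτ) (hU0 τ) (hU τ)
  have h0 := hfac 0 ⟨le_rfl, zero_le_one⟩
  have h1 := hfac 1 ⟨zero_le_one, le_rfl⟩
  refine ⟨existsUnique_isPathOrderedExp hconn0
      fun τ hτ => standardConnection_eq_connection_zero 𝒞 hA hB hflat ha hS hτ,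
    existsUnique_isPathOrderedExp hconn1
      fun τ hτ => standardConnection_eq_connection_one 𝒞 hA hB hflat ha hS hτ,
    U 0 1, U 1 1, h0, h1, fun h hh => ⟨h0.isFiniteGaugeTransform 𝒞 h1 h, ?_⟩⟩
  obtain ⟨w, hw0, rfl, hw⟩ := isPathOrderedExp_iff.1 hh
  have hg := HasLogDerivWithinAt.mul_of_zeroCurvature hc D.continuous_dGaugeFunction hconn
    (fun τ hτ ε _ => D.hasDerivWithinAt_gaugeFunction hτ)
    (fun τ hτ ε hε => by
      have h := D.hasDerivWithinAt_connection hτ hε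
      have hb : D.br (D.gaugeFunction (τ, ε)) (D.connection (τ, ε)) =
          localBracket (conjMap q H) (c (τ, ε)) (conn (τ, ε)) :=
        bracket_eq_localBracket (D.gaugeFunction (τ, ε)) (D.connection (τ, ε))
      rw [hb] at h
      exact h)
    (w := w) (fun τ hτ => by
      have h := hw τ hτ
      rwa [standardConnection_eq_connection_zero 𝒞 hA hB hflat ha hS hτ] at h)
    (fun τ _ => hU0 τ) (fun τ _ => hU τ)
  -- Left multiplication by the constant `(U 0 1)⁻¹` normalizes the curve to `1` at `τ = 0` and does
  -- not affect the logarithmic derivative.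
  refine isPathOrderedExp_iff.2 ⟨fun τ => (U 0 1)⁻¹ * (w τ * U τ 1), by simp [hw0],
    (mul_assoc _ _ _).symm, fun τ hτ => ?_⟩
  rw [standardConnection_eq_connection_one 𝒞 hA hB hflat ha hS hτ]
  exact (hg τ hτ).const_mul _

end
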